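/- Fix $\Lambda\in\mathbb R$. The spherically symmetric Einstein--null dust system for $(r,\Omega^2;\tau,\bar\tau)$, functions of $(u,v)$, is $$\partial_u\partial_v(r^2)=-\tfrac12(1-\Lambda r^2)\Omega^2,\qquad \partial_u\partial_v\log\Omega^2=\frac{\Omega^2}{2r^2}\bigl(1+4\Omega^{-2}\partial_ur\,\partial_vr\bigr),$$ $$\partial_v(\Omega^{-2}\partial_vr)=-4\pi r^{-1}\Omega^{-2}\bar\tau,\qquad \partial_u(\Omega^{-2}\partial_ur)=-4\pi r^{-1}\Omega^{-2}\tau,\qquad \partial_u\bar\tau=0,\qquad \partial_v\tau=0.\tag{1}$$ **Definitions.** A $C^0$ spacetime is a $C^1$ four-manifold $\mathcal M$ (Hausdorff, second countable, without boundary) with a continuous Lorentzian metric $g$. It is *spherically symmetric* if $SO(3)$ acts on it in a $C^1$ way by isometries, each orbit is a point or homeomorphic to $\mathbb S^2$, and every point has an invariant open neighbourhood that is equivariantly $C^1$-diffeomorphic to $U\times\mathbb S^2$, $U\subset\mathbb R^2$ open (if its orbit is not a point), or to $\mathbb D^3\times(-1,1)$ (if it is). The *axis* $\mathcal Z$ is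 the set of fixed points. A *double null foliation* is a pair of continuous functions $(u,v)$ on $\mathcal M$ that identifies $\mathcal M/SO(3)$ topologically with $\mathcal U\cup\gamma_{\mathcal Z}\subset\mathbb R^2$, where $\mathcal U$, $\gamma_{\mathcal Z}$ are the images of $\mathcal M\setminus\mathcal Z$, $\mathcal Z$ and $\gamma_{\mathcal Z}\subset\partial\mathcal U$, such that there is an equivariant $C^1$-diffeomorphism $((u,v),\omega):\mathcal M\setminus\mathcal Z\to\mathcal U\times\mathbb S^2$ in which $g=-\Omega^2\,du\,dv+r^2g_{\mathbb S^2}$, with $r,\Omega^2$ continuous on $\mathcal U\cup\gamma_{\mathcal Z}$, $r>0$ on $\mathcal U$, $r=0$ on $\gamma_{\mathcal Z}$ and $\Omega^2\ne0$ on $\mathcal U\cup\gamma_{\mathcal Z}$. The spacetime is *admissible* if it is spherically symmetric, $\mathcal Z$ is non-empty and connected, a double null foliation $(u,v)$ exists, and every other one is $(U(u),V(v))$, up to interchanging its two components, with $U,V$ strictly monotonic and locally bi-Lipschitz. *Weak solutions* of (1) on an open $D\subset\mathbb R^2$ consist of continuous $r,\Omega^2>0$ and non-negative Radon measures $\tau,\bar\tau$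 satisfying (1) in the sense of distributions; here $\partial_ur,\partial_vr$ are required to be signed Radon measures, so that $\Omega^{-2}\partial_ur$, $\Omega^{-2}\partial_vr$ make sense, and $\frac2{r^2}\partial_ur\,\partial_vr$ is read as $\frac1{2r^2}\partial_u\partial_v(r^2)-\partial_u\partial_v\log r$, with $\partial_u\partial_v(r^2)$ given by the first equation. If $u=v$ on $\gamma_{\mathcal Z}$, then $\tau|_{\gamma_{\mathcal Z}}=\bar\tau|_{\gamma_{\mathcal Z}}$ means that near each point of $\gamma_{\mathcal Z}$ there is a finite Borel measure $\mu$ on $\mathbb R$ with $\tau=\mu(du)\,dv$ and $\bar\tau=du\,\mu(dv)$. A time oriented $C^0$ spacetime is *globally hyperbolic* if it has no closed causal curves and all sets $J^+(p)\cap J^-(q)$ are compact, where $J^\pm$ are defined with piecewise $C^1$ causal curves. **Data and development.** Let $0<v_*<v_0$ and let $(r_/,\Omega_/^2,\tau_/,\bar\tau_/)$ be smooth on $[0,v_0)$ with $r_/(0)=0$, $r_/>0$ on $(0,v_0)$, $\Omega_/^2>0$, $\bar\tau_/\ge0$, $\tau_/=0$, $\partial_v(\Omega_/^{-2}\partial_vr_/)=-4\pi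 r_/^{-1}\Omega_/^{-2}\bar\tau_/$ on $(0,v_0)$, $\bar\tau_/=0$ on $[0,v_*]$ and, if $\Lambda>0$, $1-\frac13\Lambda r_/^2>0$ on $[0,v_*]$. Let $0<\delta<v_0-v_*$ and put $$\mathcal U=\{0<u<v_*,\ u<v<v_*+\delta\},\qquad \gamma_{\mathcal Z}=\{u=v,\ 0<u<v_*\}.$$ Let $(r,\Omega^2,\tau,\bar\tau)$ be $C^\infty$ on $\overline{\mathcal U}$, solve (1) on $\mathcal U$, coincide with the data on $\{u=0,\ 0<v<v_*+\delta\}$, and satisfy $r=0$, $\tau=\bar\tau$ on $\gamma_{\mathcal Z}$, $\Omega^2>0$ on $\overline{\mathcal U}$ and $r>0$ on $\overline{\mathcal U}\cap\{u<v\}$. Let $(\mathcal M,g)$ be the spacetime with boundary obtained from $(\overline{\mathcal U}\cap\{u<v\})\times\mathbb S^2$ with $g=-\Omega^2du\,dv+r^2g_{\mathbb S^2}$ by attaching an axis along $\gamma_{\mathcal Z}$; concretely, $\mathcal M$ is the subset of $\mathbb R\times\mathbb R^3\ni(t,x)$ on which $(u,v)=(t-|x|,t+|x|)\in\overline{\mathcal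 U}\setminus\{(0,0),(v_*,v_*)\}$, with $\omega=x/|x|$. It is time oriented by $\partial_u+\partial_v$. Assume that $\bar\tau_/>0$ on $(v_*,v_*+\delta_1)$ for some $0<\delta_1\le\delta$. **Theorem.** There is no globally hyperbolic, time oriented, admissible $C^0$ spherically symmetric spacetime $(\widetilde{\mathcal M},\tilde g)$ that is a $C^0$ spherically symmetric future extension of $(\mathcal M,g)$ as a solution of (1), that is, for which 1. there is a $C^1$ isometric embedding $i:\mathcal M\to\widetilde{\mathcal M}$ preserving the time orientation; 2. some point of $\widetilde{\mathcal M}\setminus i(\mathcal M)$ lies in $J^+(i(\mathcal M))$; 3. there are a double null foliation $(\tilde u,\tilde v)$ of $\widetilde{\mathcal M}$ with $\tilde u=\tilde v$ on the axis, with metric components $\tilde r,\tilde\Omega^2$ and associated sets $\widetilde{\mathcal U},\gamma_{\widetilde{\mathcal Z}}$, and non-negative Radon measures $\tilde\tau,\tilde{\bar\tau}$ on $\widetilde{\mathcal U}$, such that $(\tilde r,\tilde\Omega^2;\tilde\tau,\tilde{\bar\tau})$ is a weak solution of (1) on $\widetilde{\mathcal U}$ with $\tilde r=0$ and $\tilde\tau=\tilde{\bar\tau}$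 on $\gamma_{\widetilde{\mathcal Z}}$, and such that, for some strictly increasing, locally bi-Lipschitz $U,V$, one has $\tilde u\circ i=U(u)$, $\tilde v\circ i=V(v)$ on $\mathcal M$ and, on the image of $\mathcal U$ under $(U,V)$, the measures $\tilde\tau,\tilde{\bar\tau}$ have the densities $\tau/(U')^2$ and $\bar\tau/(V')^2$ (evaluated at the preimage $(u,v)$) with respect to $d\tilde u\,d\tilde v$. -/

import Mathlib

open Set Filter Topology MeasureTheory
open scoped Manifold ContDiff Bundle

namespace NullDust

/-! ### Model spaces and the rotation group -/

abbrev E3 := EuclideanSpace ℝ (Fin 3)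
abbrev E4 := EuclideanSpace ℝ (Fin 4)
abbrev S2 := Metric.sphere (0 : E3) 1
abbrev SO3 := Matrix.specialOrthogonalGroup (Fin 3) ℝ

instance finrank_E3_fact : Fact (Module.finrank ℝ E3 = 2 + 1) := ⟨by simp⟩

/-- The rotation of `x ∈ ℝ³` by the matrix `a`. -/
noncomputable def rotate (a : SO3) (x : E3) : E3 := WithLp.toLp 2 (a.1.mulVec x.ofLp)

/-- `f` restricts to a `C¹` diffeomorphism from the open set `s` onto the open set `t`. -/
def IsC1DiffeoOn {E H E' H' : Type*} [NormedAddCommGroup E] [NormedSpace ℝ E]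
    [TopologicalSpace H] (I : ModelWithCorners ℝ E H)
    [NormedAddCommGroup E'] [NormedSpace ℝ E'] [TopologicalSpace H'] (J : ModelWithCorners ℝ E' H')
    {M N : Type*} [TopologicalSpace M] [ChartedSpace H M] [TopologicalSpace N] [ChartedSpace H' N]
    (f : M → N) (s : Set M) (t : Set N) : Prop :=
  IsOpen s ∧ IsOpen t ∧ ContMDiffOn I J 1 f s ∧ MapsTo f s t ∧
    ∃ h : N → M, ContMDiffOn J I 1 h t ∧ MapsTo h t s ∧ InvOn h f s t

/-- `f` is locally bi-Lipschitz on `s ⊆ ℝ`. -/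
def LocallyBiLipschitzOn (f : ℝ → ℝ) (s : Set ℝ) : Prop :=
  ∀ x ∈ s, ∃ t ∈ 𝓝[s] x, ∃ K : ℝ, 0 < K ∧
    ∀ y ∈ t, ∀ z ∈ t, K⁻¹ * |y - z| ≤ |f y - f z| ∧ |f y - f z| ≤ K * |y - z|

/-! ### `C⁰` Lorentzian metrics on `C¹` four-manifolds, causality -/

section Spacetimes

variable {M : Type*} [TopologicalSpace M] [ChartedSpace E4 M] [IsManifold 𝓘(ℝ, E4) 1 M]

variable (M) in
/-- A continuous Lorentzian metric, of signature `(-,+,+,+)`, on the `C¹` manifold `M`. -/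
structure LorentzMetric where
  val : ∀ x : M, TangentSpace 𝓘(ℝ, E4) x →L[ℝ] TangentSpace 𝓘(ℝ, E4) x →L[ℝ] ℝ
  symm : ∀ x v w, val x v w = val x w v
  signature : ∀ x, ∃ b : Module.Basis (Fin 4) ℝ (TangentSpace 𝓘(ℝ, E4) x),
    ∀ i j, val x (b i) (b j) = if i = j then (if i = 0 then -1 else 1) else 0
  continuous : Continuous (fun x : M =>
    Bundle.TotalSpace.mk' (E4 →L[ℝ] E4 →L[ℝ] ℝ)
      (E := fun x : M => TangentSpace 𝓘(ℝ, E4) x →L[ℝ] TangentSpace 𝓘(ℝ, E4) x →L[ℝ] ℝ) x (val x))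

/-- A time orientation: a continuous vector field that is timelike everywhere and is declared to be
future directed. -/
structure TimeOrientation (g : LorentzMetric M) where
  field : ∀ x : M, TangentSpace 𝓘(ℝ, E4) x
  continuous : Continuous (fun x => (⟨x, field x⟩ : TangentBundle 𝓘(ℝ, E4) M))
  timelike : ∀ x, g.val x (field x) (field x) < 0

/-- Future directed causal tangent vectors. -/
def FutureCausal (g : LorentzMetric M) (T : TimeOrientation g) (x : M)
    (X : TangentSpace 𝓘(ℝ, E4) x) : Prop :=
  X ≠ 0 ∧ g.val x X X ≤ 0 ∧ g.val x X (T.field x) < 0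

/-- There is a future directed causal curve of class `C¹` from `p` to `q`. -/
def CausalStep (g : LorentzMetric M) (T : TimeOrientation g) (p q : M) : Prop :=
  ∃ c : ℝ → M, ContMDiffOn 𝓘(ℝ, ℝ) 𝓘(ℝ, E4) 1 c (Icc 0 1) ∧ c 0 = p ∧ c 1 = q ∧
    ∀ s ∈ Icc (0 : ℝ) 1,
      FutureCausal g T (c s) (mfderivWithin 𝓘(ℝ, ℝ) 𝓘(ℝ, E4) c (Icc 0 1) s (1 : ℝ))

/-- The causal relation `q ∈ J⁺(p)`: `q = p`, or there is a future directed, piecewise `C¹` causal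
curve from `p` to `q`. -/
def CausalLE (g : LorentzMetric M) (T : TimeOrientation g) : M → M → Prop :=
  Relation.ReflTransGen (CausalStep g T)

/-- Global hyperbolicity: there are no closed causal curves, and all causal diamonds
`J⁺(p) ∩ J⁻(q)` are compact. -/
def GloballyHyperbolic (g : LorentzMetric M) (T : TimeOrientation g) : Prop :=
  (∀ p, ¬ Relation.TransGen (CausalStep g T) p p) ∧
    ∀ p q, IsCompact {x | CausalLE g T p x ∧ CausalLE g T x q}

/-! ### Spherical symmetry -/

variable [MulAction SO3 M]

variable (M) in
/-- The axis: the set of fixed points of the action. -/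
def axis : Set M := {p | MulAction.orbit SO3 p = {p}}

/-- The derivative at `x` of a map `f : M → F` into a normed space. -/
noncomputable def diff {F : Type*} [NormedAddCommGroup F] [NormedSpace ℝ F] (f : M → F) (x : M) :
    TangentSpace 𝓘(ℝ, E4) x →L[ℝ] F :=
  mfderiv 𝓘(ℝ, E4) 𝓘(ℝ, F) f x

/-- The given action of `SO(3)` makes `(M, g)` a `C⁰` spherically symmetric spacetime. The action is
jointly `C¹` in the group element and the point, because by the last two fields it is so in the
local models. -/
structure IsSphericallySymmetric (g : LorentzMetric M) : Prop where
  smooth_action : ∀ a : SO3, ContMDiff 𝓘(ℝ, E4) 𝓘(ℝ, E4) 1 (fun x : M => a • x)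
  isometry : ∀ (a : SO3) (x : M) (X Y : TangentSpace 𝓘(ℝ, E4) x),
    g.val (a • x) (mfderiv 𝓘(ℝ, E4) 𝓘(ℝ, E4) (fun y : M => a • y) x X)
      (mfderiv 𝓘(ℝ, E4) 𝓘(ℝ, E4) (fun y : M => a • y) x Y) = g.val x X Y
  orbits : ∀ p : M, MulAction.orbit SO3 p = {p} ∨ Nonempty (MulAction.orbit SO3 p ≃ₜ S2)
  model_off_axis : ∀ p : M, p ∉ axis M → ∃ (V : Set M) (U : Set (ℝ × ℝ)) (F : M → (ℝ × ℝ) × S2),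
    p ∈ V ∧ (∀ a : SO3, ∀ x ∈ V, a • x ∈ V) ∧ IsOpen U ∧
    IsC1DiffeoOn 𝓘(ℝ, E4) ((𝓘(ℝ, ℝ × ℝ)).prod (𝓡 2)) F V (U ×ˢ univ) ∧
    ∀ a : SO3, ∀ x ∈ V, (F (a • x)).1 = (F x).1 ∧ ((F (a • x)).2 : E3) = rotate a (F x).2
  model_on_axis : ∀ p ∈ axis M, ∃ (V : Set M) (F : M → E3 × ℝ),
    p ∈ V ∧ (∀ a : SO3, ∀ x ∈ V, a • x ∈ V) ∧
    IsC1DiffeoOn 𝓘(ℝ, E4) 𝓘(ℝ, E3 × ℝ) F V (Metric.ball 0 1 ×ˢ Ioo (-1) 1) ∧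
    ∀ a : SO3, ∀ x ∈ V, (F (a • x)).1 = rotate a (F x).1 ∧ (F (a • x)).2 = (F x).2

/-- The set `𝒰` in the `(u,v)`-plane: the image of the complement of the axis. -/
def offAxisImage (u v : M → ℝ) : Set (ℝ × ℝ) := (fun x => (u x, v x)) '' (axis M)ᶜ

/-- The curve `γ_𝒵` in the `(u,v)`-plane: the image of the axis. -/
def axisImage (u v : M → ℝ) : Set (ℝ × ℝ) := (fun x => (u x, v x)) '' axis M

/-- `(u, v)` is a double null foliation of `(M, g)`. Here `θ` is the spherical coordinate of the
`SO(3)`-equivariant diffeomorphism `((u, v), θ) : M \ 𝒵 → 𝒰 × 𝕊²`, and `r`, `W = Ω²` are the metric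
components, as functions on the `(u,v)`-plane, in `g = -Ω² du dv + r² g_{𝕊²}`.
The field `metric` says at once that `∂_u`, `∂_v` are null, that `𝒰` is orthogonal to the orbits and
that the orbits are round spheres of area `4πr²`. The foliation is regular up to the axis: `(u, v)`
identifies the orbit space topologically with `𝒰 ∪ γ_𝒵`, and `Ω²` extends continuously, without
zeros, to `γ_𝒵`. (A foliation in which one of `u`, `v` is reversed has `Ω² < 0`.) -/
structure IsDoubleNullFoliation (g : LorentzMetric M) (u v : M → ℝ) (θ : M → S2)
    (r W : ℝ × ℝ → ℝ) : Prop where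
  continuous_u : Continuous u
  continuous_v : Continuous v
  fibers : ∀ x y : M, (u x = u y ∧ v x = v y) ↔ y ∈ MulAction.orbit SO3 x
  quotient : Topology.IsQuotientMap (Set.rangeFactorization (fun x => (u x, v x)))
  axis_boundary : axisImage u v ⊆ frontier (offAxisImage u v)
  diffeo : IsC1DiffeoOn 𝓘(ℝ, E4) ((𝓘(ℝ, ℝ × ℝ)).prod (𝓡 2)) (fun x => ((u x, v x), θ x))
    (axis M)ᶜ (offAxisImage u v ×ˢ univ)
  equivariant : ∀ (a : SO3), ∀ x ∉ axis M, ((θ (a • x)) : E3) = rotate a (θ x)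
  r_continuous : ContinuousOn r (offAxisImage u v ∪ axisImage u v)
  r_pos : ∀ p ∈ offAxisImage u v, 0 < r p
  r_axis : ∀ p ∈ axisImage u v, r p = 0
  W_continuous : ContinuousOn W (offAxisImage u v ∪ axisImage u v)
  W_ne_zero : ∀ p ∈ offAxisImage u v ∪ axisImage u v, W p ≠ 0
  metric : ∀ x ∉ axis M, ∀ X : TangentSpace 𝓘(ℝ, E4) x,
    g.val x X X = -(W (u x, v x)) * diff u x X * diff v x X
      + r (u x, v x) ^ 2 * ‖diff (fun y => (θ y : E3)) x X‖ ^ 2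

/-- `f' = h ∘ f` for a strictly monotonic, locally bi-Lipschitz function `h`. -/
def IsReparametrization (f f' : M → ℝ) : Prop :=
  ∃ h : ℝ → ℝ, (StrictMonoOn h (range f) ∨ StrictAntiOn h (range f)) ∧
    LocallyBiLipschitzOn h (range f) ∧ ∀ x, f' x = h (f x)

/-- Admissible `C⁰` spherically symmetric spacetimes: spherically symmetric, with non-empty and
connected axis, with a double null foliation, and such that any two double null foliations differ by
a reparametrization of the two null coordinates (up to interchanging them). -/
def IsAdmissible (g : LorentzMetric M) : Prop :=
  IsSphericallySymmetric g ∧ IsConnected (axis M) ∧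
  ∃ (u v : M → ℝ) (θ : M → S2) (r W : ℝ × ℝ → ℝ), IsDoubleNullFoliation g u v θ r W ∧
    ∀ (u' v' : M → ℝ) (θ' : M → S2) (r' W' : ℝ × ℝ → ℝ), IsDoubleNullFoliation g u' v' θ' r' W' →
      (IsReparametrization u u' ∧ IsReparametrization v v') ∨
      (IsReparametrization v u' ∧ IsReparametrization u v')

end Spacetimes

/-! ### The Einstein--null dust system -/

/-- `∂_u f` for a function `f` of `(u, v)`. -/
noncomputable def pu (f : ℝ × ℝ → ℝ) (p : ℝ × ℝ) : ℝ := fderiv ℝ f p (1, 0)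

/-- `∂_v f` for a function `f` of `(u, v)`. -/
noncomputable def pv (f : ℝ × ℝ → ℝ) (p : ℝ × ℝ) : ℝ := fderiv ℝ f p (0, 1)

/-- Classical solutions `(r, Ω², τ, τ̄)`, with `W = Ω²` and `τb = τ̄`, on the set `D`. -/
structure IsClassicalSolution (Λ : ℝ) (D : Set (ℝ × ℝ)) (r W τ τb : ℝ × ℝ → ℝ) : Prop where
  eq_r : ∀ p ∈ D, pu (pv (fun q => r q ^ 2)) p = -(1 / 2) * (1 - Λ * r p ^ 2) * W p
  eq_W : ∀ p ∈ D, pu (pv (fun q => Real.log (W q))) p =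
    W p / (2 * r p ^ 2) * (1 + 4 * (W p)⁻¹ * pu r p * pv r p)
  eq_vv : ∀ p ∈ D, pv (fun q => (W q)⁻¹ * pv r q) p = -4 * Real.pi * (r p)⁻¹ * (W p)⁻¹ * τb p
  eq_uu : ∀ p ∈ D, pu (fun q => (W q)⁻¹ * pu r q) p = -4 * Real.pi * (r p)⁻¹ * (W p)⁻¹ * τ p
  eq_in : ∀ p ∈ D, pu τb p = 0
  eq_out : ∀ p ∈ D, pv τ p = 0

/-- Smooth functions with compact support in `D`. -/
def IsTestFunction (D : Set (ℝ × ℝ)) (φ : ℝ × ℝ → ℝ) : Prop :=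
  ContDiff ℝ ∞ φ ∧ HasCompactSupport φ ∧ tsupport φ ⊆ D

/-- A Borel measure in the plane that is finite on compact subsets of the open set `D`, that is, a
regular Borel measure on `D`. -/
def IsRadonOn (D : Set (ℝ × ℝ)) (μ : Measure (ℝ × ℝ)) : Prop :=
  ∀ K ⊆ D, IsCompact K → μ K < ⊤

/-- The distribution `∂f` on `D`, for the first order operator `∂` (`pu` or `pv`), is the difference
of the two Radon measures `μ₁ - μ₂`. -/
def WeakDerivEq (D : Set (ℝ × ℝ)) (dd : (ℝ × ℝ → ℝ) → ℝ × ℝ → ℝ) (f : ℝ × ℝ → ℝ)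
    (μ₁ μ₂ : Measure (ℝ × ℝ)) : Prop :=
  IsRadonOn D μ₁ ∧ IsRadonOn D μ₂ ∧ ∀ φ, IsTestFunction D φ →
    ∫ p in D, f p * dd φ p = -(∫ p in D, φ p ∂μ₁ - ∫ p in D, φ p ∂μ₂)

/-- The constraint equation `∂(Ω⁻² ∂r) = -4π r⁻¹ Ω⁻² σ` in the sense of distributions on `D`, where
`∂` is `pu` or `pv` and `σ` is a measure. As `Ω²` is merely continuous, the product `Ω⁻² ∂r` is
meaningful when the distribution `∂r` has order zero, i.e. is a (signed) Radon measure `μ₁ - μ₂`. -/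
def WeakConstraint (D : Set (ℝ × ℝ)) (dd : (ℝ × ℝ → ℝ) → ℝ × ℝ → ℝ) (r W : ℝ × ℝ → ℝ)
    (σ : Measure (ℝ × ℝ)) : Prop :=
  ∃ μ₁ μ₂ : Measure (ℝ × ℝ), WeakDerivEq D dd r μ₁ μ₂ ∧ ∀ φ, IsTestFunction D φ →
    -(∫ p in D, (W p)⁻¹ * dd φ p ∂μ₁ - ∫ p in D, (W p)⁻¹ * dd φ p ∂μ₂) =
      -4 * Real.pi * ∫ p in D, (r p)⁻¹ * (W p)⁻¹ * φ p ∂σ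

/-- Weak solutions on the open set `D`, for continuous `r, W = Ω² > 0` and Radon measures
`τ, τb = τ̄`.

In the equation `∂_u∂_v log Ω² = Ω²/(2r²) (1 + 4 Ω⁻² ∂_u r ∂_v r)` the product of derivatives is
understood, for continuous `r`, through the identity
`(2/r²) ∂_u r ∂_v r = (1/(2r²)) ∂_u∂_v(r²) - ∂_u∂_v log r`, in which, by the first equation,
`∂_u∂_v(r²) = -(1/2)(1 - Λr²)Ω²` is a continuous function; this is `eq_W`. -/
structure IsWeakSolution (Λ : ℝ) (D : Set (ℝ × ℝ)) (r W : ℝ × ℝ → ℝ)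
    (τ τb : Measure (ℝ × ℝ)) : Prop where
  r_continuous : ContinuousOn r D
  r_pos : ∀ p ∈ D, 0 < r p
  W_continuous : ContinuousOn W D
  W_pos : ∀ p ∈ D, 0 < W p
  radon_τ : IsRadonOn D τ
  radon_τb : IsRadonOn D τb
  eq_r : ∀ φ, IsTestFunction D φ →
    ∫ p in D, r p ^ 2 * pu (pv φ) p = ∫ p in D, -(1 / 2) * (1 - Λ * r p ^ 2) * W p * φ p
  eq_W : ∀ φ, IsTestFunction D φ →
    ∫ p in D, Real.log (W p) * pu (pv φ) p =
      (∫ p in D, (W p / (2 * r p ^ 2) +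
        1 / (2 * r p ^ 2) * (-(1 / 2) * (1 - Λ * r p ^ 2) * W p)) * φ p)
      - ∫ p in D, Real.log (r p) * pu (pv φ) p
  eq_vv : WeakConstraint D pv r W τb
  eq_uu : WeakConstraint D pu r W τ
  eq_in : ∀ φ, IsTestFunction D φ → ∫ p in D, pu φ p ∂τb = 0
  eq_out : ∀ φ, IsTestFunction D φ → ∫ p in D, pv φ p ∂τ = 0

/-- The boundary condition `τ = τ̄` on the axis `Γ ⊆ {u = v}`, for measures with `∂_v τ = 0` and
`∂_u τ̄ = 0` on `D`: near each point of the axis, `τ = μ(du) dv` and `τ̄ = du μ(dv)` with one and the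
same measure `μ` in one variable. -/
def DustsAgreeOnAxis (D Γ : Set (ℝ × ℝ)) (τ τb : Measure (ℝ × ℝ)) : Prop :=
  ∀ q ∈ Γ, ∃ ε > 0, ∃ μ : Measure ℝ, IsFiniteMeasure μ ∧
    τ.restrict (D ∩ Metric.ball q ε) = (μ.prod volume).restrict (D ∩ Metric.ball q ε) ∧
    τb.restrict (D ∩ Metric.ball q ε) = ((volume : Measure ℝ).prod μ).restrict (D ∩ Metric.ball q ε)

/-! ### Smooth characteristic data and their development -/

/-- Smooth characteristic initial data `(r, Ω², τ, τ̄)` on `{u = 0}`, `0 ≤ v < v₀`. -/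
structure IsSmoothData (v₀ : ℝ) (r₀ W₀ τ₀ τb₀ : ℝ → ℝ) : Prop where
  smooth_r : ContDiffOn ℝ ∞ r₀ (Ico 0 v₀)
  smooth_W : ContDiffOn ℝ ∞ W₀ (Ico 0 v₀)
  smooth_τ : ContDiffOn ℝ ∞ τ₀ (Ico 0 v₀)
  smooth_τb : ContDiffOn ℝ ∞ τb₀ (Ico 0 v₀)
  r_zero : r₀ 0 = 0
  r_pos : ∀ v ∈ Ioo 0 v₀, 0 < r₀ v
  W_pos : ∀ v ∈ Ico 0 v₀, 0 < W₀ v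
  τ_nonneg : ∀ v ∈ Ico 0 v₀, 0 ≤ τ₀ v
  τb_nonneg : ∀ v ∈ Ico 0 v₀, 0 ≤ τb₀ v
  eq_vv : ∀ v ∈ Ioo 0 v₀, deriv (fun s => (W₀ s)⁻¹ * deriv r₀ s) v =
    -4 * Real.pi * (r₀ v)⁻¹ * (W₀ v)⁻¹ * τb₀ v
  eq_out : ∀ v ∈ Ioo 0 v₀, deriv τ₀ v = 0

/-- The domain `𝒰 = {0 < u < v_*} ∩ {u < v < v_* + δ}`. -/
def devDomain (vs δ : ℝ) : Set (ℝ × ℝ) := {p | 0 < p.1 ∧ p.1 < vs ∧ p.1 < p.2 ∧ p.2 < vs + δ}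

/-- `(r, Ω², τ, τ̄)` is a smooth development of the data on `𝒰`: it is smooth up to the boundary of
`𝒰`, solves the system on `𝒰`, satisfies the initial conditions on `{u = 0}` and the boundary
conditions on the axis `{u = v, 0 < u < v_*}`; moreover `-Ω² du dv + r² g_{𝕊²}` is non-degenerate up
to the boundary, i.e. `Ω² > 0` there and `r > 0` away from `{u = v}`. -/
structure IsSmoothDevelopment (Λ vs δ : ℝ) (r₀ W₀ τ₀ τb₀ : ℝ → ℝ) (r W τ τb : ℝ × ℝ → ℝ) :
    Prop where
  smooth_r : ContDiffOn ℝ ∞ r (closure (devDomain vs δ))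
  smooth_W : ContDiffOn ℝ ∞ W (closure (devDomain vs δ))
  smooth_τ : ContDiffOn ℝ ∞ τ (closure (devDomain vs δ))
  smooth_τb : ContDiffOn ℝ ∞ τb (closure (devDomain vs δ))
  solution : IsClassicalSolution Λ (devDomain vs δ) r W τ τb
  initial : ∀ v ∈ Ioo 0 (vs + δ),
    r (0, v) = r₀ v ∧ W (0, v) = W₀ v ∧ τ (0, v) = τ₀ v ∧ τb (0, v) = τb₀ v
  axis : ∀ s ∈ Ioo 0 vs, r (s, s) = 0 ∧ τ (s, s) = τb (s, s)
  r_pos : ∀ p ∈ closure (devDomain vs δ), p.1 < p.2 → 0 < r p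
  W_pos : ∀ p ∈ closure (devDomain vs δ), 0 < W p

/-- The null coordinates `(t - |x|, t + |x|)` of a point `(t, x) ∈ ℝ × ℝ³`. -/
noncomputable def nullCoords (p : ℝ × E3) : ℝ × ℝ := (p.1 - ‖p.2‖, p.1 + ‖p.2‖)

/-- The spacetime with boundary `𝓜`, obtained from `(clos 𝒰 \ γ_𝒵) × 𝕊²` by attaching an axis
along `γ_𝒵 = {u = v, 0 < u < v_*}`, is realised in `ℝ × ℝ³` through `((u, v), θ) ↦ (t, x)`,
`t = (u+v)/2`, `x = ((v-u)/2) θ`; the axis is `{x = 0}`. The two end points `(0,0)`, `(v_*,v_*)` of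
`γ_𝒵`, where `r = 0` but no axis is attached, do not belong to the spacetime. -/
def devSpacetime (vs δ : ℝ) : Set (ℝ × E3) :=
  {p | nullCoords p ∈ closure (devDomain vs δ) \ {(0, 0), (vs, vs)}}

/-- The quadratic form of `g = -Ω² du dv + r² g_{𝕊²}` at `p = (t, x)`, `x ≠ 0`, on the tangent
vector `X = (ẋ⁰, ξ)`, in terms of `u = t - |x|`, `v = t + |x|` and `θ = x / |x|`. -/
noncomputable def devMetric (r W : ℝ × ℝ → ℝ) (p X : ℝ × E3) : ℝ :=
  let ρ' : ℝ := inner ℝ p.2 X.2 / ‖p.2‖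
  r (nullCoords p) ^ 2 * ((‖X.2‖ ^ 2 - ρ' ^ 2) / ‖p.2‖ ^ 2)
    - W (nullCoords p) * (X.1 - ρ') * (X.1 + ρ')

/-- The measure `μ`, on the image `(U × V)(D)`, has the density that corresponds to the function
`f / (dw)²` on `D` under the coordinate change `(U, V)`. -/
def IsTransformedDust (D : Set (ℝ × ℝ)) (U V : ℝ → ℝ) (f dw : ℝ × ℝ → ℝ)
    (μ : Measure (ℝ × ℝ)) : Prop :=
  ∃ h : ℝ × ℝ → ℝ, (∀ p ∈ D, h (U p.1, V p.2) = f p / dw p ^ 2) ∧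
    μ.restrict ((fun p : ℝ × ℝ => (U p.1, V p.2)) '' D) =
      (volume.restrict ((fun p : ℝ × ℝ => (U p.1, V p.2)) '' D)).withDensity
        (fun q => ENNReal.ofReal (h q))

/-- `(M, g)`, with time orientation `T`, is a `C⁰` spherically symmetric future extension, as a
solution of the Einstein--null dust system, of the spacetime with boundary `devSpacetime vs δ` with
metric components `r`, `W = Ω²` and dusts `τ`, `τb = τ̄`, time oriented by `∂_t = ∂_u + ∂_v`. -/
def IsFutureExtension (Λ vs δ : ℝ) (r W τ τb : ℝ × ℝ → ℝ)
    {M : Type*} [TopologicalSpace M] [ChartedSpace E4 M] [IsManifold 𝓘(ℝ, E4) 1 M]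
    [MulAction SO3 M] (g : LorentzMetric M) (T : TimeOrientation g) : Prop :=
  -- a `C¹` isometric embedding (the isometry property extends to the axis by continuity) that
  -- preserves the time orientation
  ∃ i : ℝ × E3 → M,
    ContMDiffOn 𝓘(ℝ, ℝ × E3) 𝓘(ℝ, E4) 1 i (devSpacetime vs δ) ∧
    Topology.IsEmbedding (fun p : devSpacetime vs δ => i p) ∧
    (∀ p ∈ devSpacetime vs δ, p.2 ≠ 0 → ∀ X : ℝ × E3,
      g.val (i p) (mfderivWithin 𝓘(ℝ, ℝ × E3) 𝓘(ℝ, E4) i (devSpacetime vs δ) p X)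
        (mfderivWithin 𝓘(ℝ, ℝ × E3) 𝓘(ℝ, E4) i (devSpacetime vs δ) p X) = devMetric r W p X) ∧
    (∀ p ∈ devSpacetime vs δ,
      g.val (i p) (mfderivWithin 𝓘(ℝ, ℝ × E3) 𝓘(ℝ, E4) i (devSpacetime vs δ) p ((1, 0) : ℝ × E3))
        (T.field (i p)) < 0) ∧
    -- a point outside the image, to the future of the image
    (∃ y, y ∉ i '' devSpacetime vs δ ∧ ∃ x ∈ i '' devSpacetime vs δ, CausalLE g T x y) ∧
    -- a double null foliation, with `u' = v'` on the axis, and dust measures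
    ∃ (u' v' : M → ℝ) (θ' : M → S2) (r' W' : ℝ × ℝ → ℝ), IsDoubleNullFoliation g u' v' θ' r' W' ∧
      (∀ x ∈ axis M, u' x = v' x) ∧
      ∃ τ' τb' : Measure (ℝ × ℝ),
        IsWeakSolution Λ (offAxisImage u' v') r' W' τ' τb' ∧
        DustsAgreeOnAxis (offAxisImage u' v') (axisImage u' v') τ' τb' ∧
        -- which restrict to the given ones, up to the change of null coordinates
        ∃ U V : ℝ → ℝ,
          StrictMonoOn U (Icc 0 vs) ∧ LocallyBiLipschitzOn U (Icc 0 vs) ∧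
          StrictMonoOn V (Ioc 0 (vs + δ)) ∧ LocallyBiLipschitzOn V (Ioc 0 (vs + δ)) ∧
          (∀ p ∈ devSpacetime vs δ,
            u' (i p) = U (nullCoords p).1 ∧ v' (i p) = V (nullCoords p).2) ∧
          IsTransformedDust (devDomain vs δ) U V τ (fun p => deriv U p.1) τ' ∧
          IsTransformedDust (devDomain vs δ) U V τb (fun p => deriv V p.2) τb'

end NullDust

/-!
A globally hyperbolic extension would have to contain the missing end point of the axis, and no
incoming dust can reach an axis along which `Ω²` is continuous and positive; but immediately after
`v = v_*` incoming dust does arrive there.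

*The end point of the axis is attached.* The points `(s, 0)`, `0 < s < v_*`, of the development are
mapped to the axis of the extension (`IsIsometricEmbedding.mem_axis`): the embedding is open there,
and the double null coordinates would be an open map off the axis, but the development only covers
`u ≤ v`. Straight timelike segments in `ℝ × ℝ³` join a fixed `(s₀, 0)` to all later `(s, 0)`, and
these to one point with `u = v_* < v`, so that the points `(s, 0)` stay in a causal
diamond as `s → v_*`. As the diamond is compact, they accumulate at an axis point `x₀`, at which
`u = v = a := U(v_*) = V(v_*)` (`IsIsometricEmbedding.exists_axis_limit`). By the local model of the
action at `x₀`, the foliation covers a triangle `{a - d < u < v < a + d}` and the segment of the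
diagonal below it (`IsDoubleNullFoliation.exists_triangle_subset`).

*The radius vanishes linearly.* The equation for `∂_u∂_v r²` makes `Q(x, y) = r²(x, y)` an almost
additive function of the interval `[x, y]`, up to an error quadratic in the lengths; the equation
for `∂_u∂_v log Ω²`, integrated over the rectangle `[x₀, x₁] × [x₂, x₃]`, says that the cross ratio
`Q(x₀, x₂) Q(x₁, x₃) / (Q(x₀, x₃) Q(x₁, x₂))` is close to `1` as soon as `Q` is large compared with
the square of the length. For an additive function of intervals this is false, so `Q` is not large:
`r² ≤ C (v - u)²` (`le_sq_length_of_cross_ratio`, `radius_sq_le`).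

*No incoming dust.* Near the axis the incoming dust is `du μ(dv)` for a measure `μ` on the line. By
the constraint equation, `∂_v(Ω⁻² ∂_v r) = -4π r⁻¹ Ω⁻² du μ(dv)`, and `r⁻¹ ≥ c / (v - u)` is not
integrable in `u` up to the axis, while the left hand side, tested against suitable functions that
do not vanish near the axis in the limit, stays bounded because `r ≤ C (v - u)`. Hence `μ` vanishes
near `a` (`measure_Ioo_eq_zero`, `IsWeakSolution.exists_measure_Ioo_eq_zero`).

*There is dust.* In the development `τ̄` does not depend on `u`, so that it is positive for
`v_* < v < v_* + δ₁`. Its transform under the bi-Lipschitz change of coordinates charges every box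
`(a - d, a) × (a, a + d)` (`IsTransformedDust.measure_ne_zero`), which contradicts the vanishing of
`μ` near `a`.
-/

namespace NullDust

/-! ### Distributional derivatives of continuous functions -/

/-- A continuous function whose distributional derivative vanishes on an interval is constant. -/
theorem eq_of_integral_mul_deriv_eq_zero {k : ℝ → ℝ} (hk : Continuous k) {α β : ℝ}
    (H : ∀ A : ℝ → ℝ, ContDiff ℝ ∞ A → HasCompactSupport A → tsupport A ⊆ Ioo α β →
      ∫ t, k t * deriv A t = 0) {x y : ℝ} (hx : α < x) (hxy : x ≤ y) (hy : y < β) :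
    k y = k x := by
  let φ : ℕ → ContDiffBump (0 : ℝ) := fun n =>
    ⟨1 / (n + 1) / 2, 1 / (n + 1), by positivity, half_lt_self (by positivity)⟩
  have hφ : Tendsto (fun n => (φ n).rOut) atTop (𝓝 0) := tendsto_one_div_add_atTop_nhds_zero_nat
  have lim := fun z => ContDiffBump.convolution_tendsto_right_of_continuous
    (μ := (volume : Measure ℝ)) hφ hk z
  refine tendsto_nhds_unique (lim y) ((lim x).congr' ?_)
  have hev : ∀ᶠ n in atTop, (φ n).rOut < min (x - α) (β - y) :=
    hφ.eventually_lt_const (lt_min (by linarith) (by linarith))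
  filter_upwards [hev] with n hn
  obtain ⟨hn1, hn2⟩ := lt_min_iff.1 hn
  have hder : ∀ z, HasDerivAt
      (convolution ((φ n).normed volume) k (ContinuousLinearMap.lsmul ℝ ℝ) volume)
      ((convolution (deriv ((φ n).normed volume)) k (ContinuousLinearMap.lsmul ℝ ℝ) volume) z) z :=
    fun z => HasCompactSupport.hasDerivAt_convolution_left _ (φ n).hasCompactSupport_normed
      (φ n).contDiff_normed hk.locallyIntegrable z
  symm
  refine constant_of_has_deriv_right_zero
    (fun z _ => (hder z).continuousAt.continuousWithinAt) (fun z hz => ?_) y ⟨hxy, le_rfl⟩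
  have hz0 : (convolution (deriv ((φ n).normed volume)) k
      (ContinuousLinearMap.lsmul ℝ ℝ) volume) z = 0 := by
    rw [convolution_eq_swap]
    have hsub : (fun t => (φ n).normed volume (z - t)) = (φ n).normed volume ∘ (fun t => z - t) :=
      rfl
    have := H (fun t => (φ n).normed volume (z - t))
      ((φ n).contDiff_normed.comp (contDiff_const.sub contDiff_id))
      ((φ n).hasCompactSupport_normed.comp_homeomorph (Homeomorph.subLeft z)) (by
        have h1 := tsupport_comp_subset_preimage ((φ n).normed volume)
          (f := fun t => z - t) (by fun_prop)
        intro t ht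
        have h2 := h1 ht
        rw [mem_preimage, (φ n).tsupport_normed_eq, mem_closedBall_zero_iff, Real.norm_eq_abs,
          abs_le] at h2
        constructor <;> linarith [hz.1, hz.2, h2.1, h2.2])
    have h3 : ∀ t, k t * deriv (fun t => (φ n).normed volume (z - t)) t =
        -(ContinuousLinearMap.lsmul ℝ ℝ) (deriv ((φ n).normed volume) (z - t)) (k t) := by
      intro t
      rw [deriv_comp_const_sub]
      simp [mul_comm]
    simp_rw [h3, integral_neg] at this
    linarith
  have := (hder z).hasDerivWithinAt (s := Ici z)
  rwa [hz0] at this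

/-- If the continuous function `h` is minus the distributional derivative of the continuous
function `f`, the fundamental theorem of calculus holds. -/
theorem sub_eq_neg_integral_of_weak_deriv {f h : ℝ → ℝ} (hf : Continuous f) (hh : Continuous h)
    {α β : ℝ}
    (H : ∀ A : ℝ → ℝ, ContDiff ℝ ∞ A → HasCompactSupport A → tsupport A ⊆ Ioo α β →
      ∫ t, f t * deriv A t = ∫ t, h t * A t) {x y : ℝ} (hx : α < x) (hxy : x ≤ y) (hy : y < β) :
    f y - f x = -∫ t in x..y, h t := by
  let P : ℝ → ℝ := fun t => ∫ s in x..t, h s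
  have hP : ∀ t, HasDerivAt P (h t) t := fun t =>
    intervalIntegral.integral_hasDerivAt_right (hh.intervalIntegrable _ _)
      (hh.stronglyMeasurableAtFilter _ _) hh.continuousAt
  have hPc : Continuous P := continuous_iff_continuousAt.2 fun t => (hP t).continuousAt
  have key := eq_of_integral_mul_deriv_eq_zero (k := fun t => f t + P t) (hf.add hPc)
    (α := α) (β := β) (fun A hA hAc hAs => by
      have hA' : Continuous (deriv A) := hA.continuous_deriv (by simp)
      have hA'c : HasCompactSupport (deriv A) := hAc.deriv
      have i1 : Integrable fun t => f t * deriv A t :=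
        (hf.mul hA').integrable_of_hasCompactSupport hA'c.mul_left
      have i2 : Integrable fun t => P t * deriv A t :=
        (hPc.mul hA').integrable_of_hasCompactSupport hA'c.mul_left
      have i3 : Integrable fun t => h t * A t :=
        (hh.mul hA.continuous).integrable_of_hasCompactSupport hAc.mul_left
      have i4 : Integrable fun t => P t * A t :=
        (hPc.mul hA.continuous).integrable_of_hasCompactSupport hAc.mul_left
      have ibp := integral_mul_deriv_eq_deriv_mul_of_integrable (u := P) (v := A) (u' := h)
        (v' := deriv A) (fun t _ => hP t) (fun t _ => (hA.differentiable (by simp) t).hasDerivAt)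
        i2 i3 i4
      simp_rw [add_mul]
      rw [integral_add i1 i2, H A hA hAc hAs, ibp]
      ring) hx hxy hy
  simp only [P, intervalIntegral.integral_same] at key
  linarith

theorem pv_mul (A B : ℝ → ℝ) (hA : ContDiff ℝ ∞ A) (hB : ContDiff ℝ ∞ B) :
    pv (fun p => A p.1 * B p.2) = fun p => A p.1 * deriv B p.2 := by
  funext p
  have h1 : HasFDerivAt (fun p : ℝ × ℝ => A p.1) (deriv A p.1 • ContinuousLinearMap.fst ℝ ℝ ℝ) p :=
    ((hA.differentiable (by simp) p.1).hasDerivAt.hasFDerivAt.comp p hasFDerivAt_fst).congr_fderiv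
      (by ext <;> simp)
  have h2 : HasFDerivAt (fun p : ℝ × ℝ => B p.2) (deriv B p.2 • ContinuousLinearMap.snd ℝ ℝ ℝ) p :=
    ((hB.differentiable (by simp) p.2).hasDerivAt.hasFDerivAt.comp p hasFDerivAt_snd).congr_fderiv
      (by ext <;> simp)
  have h3 := (h1.mul h2).fderiv
  simp only [Pi.mul_def] at h3
  rw [pv, h3]
  simp

theorem pu_mul (A B : ℝ → ℝ) (hA : ContDiff ℝ ∞ A) (hB : ContDiff ℝ ∞ B) :
    pu (fun p => A p.1 * B p.2) = fun p => deriv A p.1 * B p.2 := by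
  funext p
  have h1 : HasFDerivAt (fun p : ℝ × ℝ => A p.1) (deriv A p.1 • ContinuousLinearMap.fst ℝ ℝ ℝ) p :=
    ((hA.differentiable (by simp) p.1).hasDerivAt.hasFDerivAt.comp p hasFDerivAt_fst).congr_fderiv
      (by ext <;> simp)
  have h2 : HasFDerivAt (fun p : ℝ × ℝ => B p.2) (deriv B p.2 • ContinuousLinearMap.snd ℝ ℝ ℝ) p :=
    ((hB.differentiable (by simp) p.2).hasDerivAt.hasFDerivAt.comp p hasFDerivAt_snd).congr_fderiv
      (by ext <;> simp)
  have h3 := (h1.mul h2).fderiv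
  simp only [Pi.mul_def] at h3
  rw [pu, h3]
  simp [mul_comm]

theorem hasCompactSupport_prod_mul {A B : ℝ → ℝ} (hA : HasCompactSupport A)
    (hB : HasCompactSupport B) : HasCompactSupport fun p : ℝ × ℝ => A p.1 * B p.2 :=
  HasCompactSupport.intro (hA.prod hB) fun {q} hp => by
    by_cases h : q.1 ∈ tsupport A
    · rw [image_eq_zero_of_notMem_tsupport (f := B) fun h' => hp ⟨h, h'⟩, mul_zero]
    · rw [image_eq_zero_of_notMem_tsupport h, zero_mul]

theorem tsupport_prod_mul_subset (A B : ℝ → ℝ) :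
    tsupport (fun p : ℝ × ℝ => A p.1 * B p.2) ⊆ tsupport A ×ˢ tsupport B :=
  closure_minimal (fun _ hp => ⟨subset_tsupport _ (left_ne_zero_of_mul hp),
    subset_tsupport _ (right_ne_zero_of_mul hp)⟩)
    ((isClosed_tsupport A).prod (isClosed_tsupport B))

theorem isTestFunction_mul {O : Set (ℝ × ℝ)} {A B : ℝ → ℝ} {α β γ δ : ℝ}
    (hO : Ioo α β ×ˢ Ioo γ δ ⊆ O) (hA : ContDiff ℝ ∞ A) (hAc : HasCompactSupport A)
    (hAs : tsupport A ⊆ Ioo α β) (hB : ContDiff ℝ ∞ B) (hBc : HasCompactSupport B)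
    (hBs : tsupport B ⊆ Ioo γ δ) : IsTestFunction O fun p => A p.1 * B p.2 :=
  ⟨(hA.comp contDiff_fst).mul (hB.comp contDiff_snd), hasCompactSupport_prod_mul hAc hBc,
    (tsupport_prod_mul_subset A B).trans ((prod_mono hAs hBs).trans hO)⟩

theorem continuous_integral_mul_of_hasCompactSupport {F : ℝ × ℝ → ℝ} {B : ℝ → ℝ}
    (hF : Continuous F) (hB : Continuous B) (hBc : HasCompactSupport B) :
    Continuous fun u => ∫ v, F (u, v) * B v := by
  rw [← continuousOn_univ]
  refine continuousOn_integral_of_compact_support (k := tsupport B) hBc ?_ ?_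
  · have : Continuous (Function.uncurry fun u v => F (u, v) * B v) := by
      unfold Function.uncurry
      fun_prop
    exact this.continuousOn
  · intro p x _ hx
    rw [image_eq_zero_of_notMem_tsupport hx, mul_zero]

theorem integral_mul_prod_mul {F : ℝ × ℝ → ℝ} {A B : ℝ → ℝ} (hF : Continuous F)
    (hA : Continuous A) (hAc : HasCompactSupport A) (hB : Continuous B)
    (hBc : HasCompactSupport B) :
    ∫ p : ℝ × ℝ, F p * (A p.1 * B p.2) = ∫ u, (∫ v, F (u, v) * B v) * A u := by
  have hi : Integrable fun p : ℝ × ℝ => F p * (A p.1 * B p.2) :=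
    (hF.mul ((hA.comp continuous_fst).mul (hB.comp continuous_snd))).integrable_of_hasCompactSupport
      (hasCompactSupport_prod_mul hAc hBc).mul_left
  rw [Measure.volume_eq_prod] at hi ⊢
  rw [integral_prod _ hi]
  congr 1
  funext u
  rw [← integral_mul_const]
  congr 1
  funext v
  ring

/-- If `∂_u∂_v F = H` in the sense of distributions on a rectangle, for continuous `F` and `H`, then
the second differences of `F` are the integrals of `H`. -/
theorem second_difference_eq_integral {F H : ℝ × ℝ → ℝ} (hF : Continuous F) (hH : Continuous H)
    {O : Set (ℝ × ℝ)} {α β γ δ : ℝ} (hO : Ioo α β ×ˢ Ioo γ δ ⊆ O)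
    (hweak : ∀ φ, IsTestFunction O φ → ∫ p, F p * pu (pv φ) p = ∫ p, H p * φ p)
    {x₁ x₂ y₁ y₂ : ℝ} (hx₁ : α < x₁) (hx : x₁ ≤ x₂) (hx₂ : x₂ < β) (hy₁ : γ < y₁) (hy : y₁ ≤ y₂)
    (hy₂ : y₂ < δ) :
    F (x₂, y₂) - F (x₁, y₂) - F (x₂, y₁) + F (x₁, y₁) =
      ∫ y in y₁..y₂, ∫ x in x₁..x₂, H (x, y) := by
  have hHsw : Continuous fun p : ℝ × ℝ => H (p.2, p.1) := by fun_prop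
  have step : ∀ B : ℝ → ℝ, ContDiff ℝ ∞ B → HasCompactSupport B → tsupport B ⊆ Ioo γ δ →
      ∫ t, (F (x₂, t) - F (x₁, t)) * deriv B t = ∫ t, (-∫ s in x₁..x₂, H (s, t)) * B t := by
    intro B hB hBc hBs
    have hB' : Continuous (deriv B) := hB.continuous_deriv (by simp)
    have h1 := sub_eq_neg_integral_of_weak_deriv (α := α) (β := β)
      (continuous_integral_mul_of_hasCompactSupport hF hB' hBc.deriv)
      (continuous_integral_mul_of_hasCompactSupport hH hB.continuous hBc)
      (fun A hA hAc hAs => by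
        have h2 := hweak _ (isTestFunction_mul hO hA hAc hAs hB hBc hBs)
        rw [pv_mul A B hA hB, pu_mul A (deriv B) hA (hB.deriv')] at h2
        rwa [integral_mul_prod_mul hF (hA.continuous_deriv (by simp)) hAc.deriv hB' hBc.deriv,
          integral_mul_prod_mul hH hA.continuous hAc hB.continuous hBc] at h2) hx₁ hx hx₂
    have i : ∀ u, Integrable fun v => F (u, v) * deriv B v := fun u =>
      Continuous.integrable_of_hasCompactSupport (by fun_prop) hBc.deriv.mul_left
    have h3 : ∫ t, (F (x₂, t) - F (x₁, t)) * deriv B t =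
        (∫ t, F (x₂, t) * deriv B t) - ∫ t, F (x₁, t) * deriv B t := by
      rw [← integral_sub (i _) (i _)]
      simp_rw [sub_mul]
    rw [h3, h1]
    simp_rw [neg_mul, integral_neg]
    congr 1
    simp_rw [← intervalIntegral.integral_mul_const]
    rw [intervalIntegral.integral_of_le hx]
    simp_rw [intervalIntegral.integral_of_le hx]
    rw [integral_integral_swap]
    have hc : Continuous (Function.uncurry fun u v => H (u, v) * B v) := by
      have := hB.continuous
      unfold Function.uncurry
      fun_prop
    rw [← integrableOn_univ]
    have hz : IntegrableOn (Function.uncurry fun u v => H (u, v) * B v) (Ioc x₁ x₂ ×ˢ tsupport B)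
        (volume.prod volume) :=
      (hc.continuousOn.integrableOn_compact (isCompact_Icc.prod hBc)).mono_set
        (prod_mono Ioc_subset_Icc_self subset_rfl)
    have h4 : IntegrableOn (Function.uncurry fun u v => H (u, v) * B v) (Ioc x₁ x₂ ×ˢ univ)
        (volume.prod volume) :=
      hz.of_forall_sdiff_eq_zero (measurableSet_Ioc.prod MeasurableSet.univ) (by
        rintro ⟨u, v⟩ ⟨h5, h6⟩
        have : v ∉ tsupport B := fun h7 => h6 ⟨h5.1, h7⟩
        simp [Function.uncurry, image_eq_zero_of_notMem_tsupport this])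
    rw [IntegrableOn, ← Measure.prod_restrict, Measure.restrict_univ] at h4
    rwa [integrableOn_univ]
  have h := sub_eq_neg_integral_of_weak_deriv (f := fun t => F (x₂, t) - F (x₁, t))
    (h := fun t => -∫ s in x₁..x₂, H (s, t)) (by fun_prop)
    (intervalIntegral.continuous_parametric_intervalIntegral_of_continuous'
      (f := fun t s => H (s, t)) hHsw x₁ x₂).neg step hy₁ hy hy₂
  simp only [intervalIntegral.integral_neg, neg_neg] at h
  linarith

theorem tsupport_pv_subset (φ : ℝ × ℝ → ℝ) : tsupport (pv φ) ⊆ tsupport φ := by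
  refine (closure_mono fun q hq => ?_).trans (tsupport_fderiv_subset ℝ (f := φ))
  intro h0
  exact hq (by simp [pv, h0])

/-- A version of `second_difference_eq_integral` for functions that are continuous only near the
rectangle. -/
theorem second_difference_eq_integral_of_continuousOn {F H : ℝ × ℝ → ℝ} {O : Set (ℝ × ℝ)}
    (hF : ContinuousOn F O) (hH : ContinuousOn H O) {α β γ δ : ℝ}
    (hO : Icc α β ×ˢ Icc γ δ ⊆ O)
    (hweak : ∀ φ, IsTestFunction O φ → ∫ p, F p * pu (pv φ) p = ∫ p, H p * φ p)
    {x₁ x₂ y₁ y₂ : ℝ} (hx₁ : α < x₁) (hx : x₁ ≤ x₂) (hx₂ : x₂ < β) (hy₁ : γ < y₁) (hy : y₁ ≤ y₂)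
    (hy₂ : y₂ < δ) :
    F (x₂, y₂) - F (x₁, y₂) - F (x₂, y₁) + F (x₁, y₁) =
      ∫ y in y₁..y₂, ∫ x in x₁..x₂, H (x, y) := by
  have hαβ : α ≤ β := by linarith
  have hγδ : γ ≤ δ := by linarith
  -- the retraction of the plane onto the closed rectangle makes the functions globally continuous
  let ρ : ℝ × ℝ → ℝ × ℝ := fun p => (max α (min β p.1), max γ (min δ p.2))
  have hρ : Continuous ρ := by fun_prop
  have hρm : ∀ p, ρ p ∈ O := fun p => hO
    ⟨⟨le_max_left _ _, max_le hαβ (min_le_left _ _)⟩,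
      ⟨le_max_left _ _, max_le hγδ (min_le_left _ _)⟩⟩
  have hρe : ∀ p ∈ Icc α β ×ˢ Icc γ δ, ρ p = p := by
    rintro ⟨a, b⟩ ⟨⟨h1, h2⟩, h3, h4⟩
    simp only at h1 h2 h3 h4
    simp [ρ, h1, h2, h3, h4]
  have key := second_difference_eq_integral (F := F ∘ ρ) (H := H ∘ ρ)
    (hF.comp_continuous hρ hρm) (hH.comp_continuous hρ hρm)
    (O := Ioo α β ×ˢ Ioo γ δ) subset_rfl (fun φ hφ => by
      have hsub : Ioo α β ×ˢ Ioo γ δ ⊆ Icc α β ×ˢ Icc γ δ :=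
        prod_mono Ioo_subset_Icc_self Ioo_subset_Icc_self
      have h1 := hweak φ ⟨hφ.1, hφ.2.1, hφ.2.2.trans (hsub.trans hO)⟩
      have e : ∀ p ∈ tsupport φ, ρ p = p := fun p hp => hρe p (hsub (hφ.2.2 hp))
      have h2 : ∀ p, (F ∘ ρ) p * pu (pv φ) p = F p * pu (pv φ) p := by
        intro p
        by_cases hp : p ∈ tsupport φ
        · rw [Function.comp_apply, e p hp]
        · have h4 : fderiv ℝ (pv φ) p = 0 :=
            image_eq_zero_of_notMem_tsupport
              (fun h => hp (tsupport_pv_subset φ (tsupport_fderiv_subset ℝ (f := pv φ) h)))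
          simp [pu, h4]
      have h5 : ∀ p, (H ∘ ρ) p * φ p = H p * φ p := by
        intro p
        by_cases hp : p ∈ tsupport φ
        · rw [Function.comp_apply, e p hp]
        · rw [image_eq_zero_of_notMem_tsupport hp, mul_zero, mul_zero]
      simp_rw [h2, h5, h1]) hx₁ hx hx₂ hy₁ hy hy₂
  simp only [Function.comp_apply] at key
  have m : ∀ x ∈ Icc x₁ x₂, ∀ y ∈ Icc y₁ y₂, ρ (x, y) = (x, y) := fun x hx y hy =>
    hρe _ ⟨⟨by linarith [hx.1], by linarith [hx.2]⟩, by linarith [hy.1], by linarith [hy.2]⟩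
  rw [m x₂ ⟨hx, le_rfl⟩ y₂ ⟨hy, le_rfl⟩, m x₁ ⟨le_rfl, hx⟩ y₂ ⟨hy, le_rfl⟩,
    m x₂ ⟨hx, le_rfl⟩ y₁ ⟨le_rfl, hy⟩, m x₁ ⟨le_rfl, hx⟩ y₁ ⟨le_rfl, hy⟩] at key
  rw [key]
  refine intervalIntegral.integral_congr fun y hy' => ?_
  rw [uIcc_of_le hy] at hy'
  refine intervalIntegral.integral_congr fun x hx' => ?_
  rw [uIcc_of_le hx] at hx'
  simp only [m x hx' y hy']

/-! ### The area radius vanishes linearly on the axis -/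

/-- The open triangle `{A < u < v < B}` above a segment of the diagonal. -/
def triangle (A B : ℝ) : Set (ℝ × ℝ) := {p | A < p.1 ∧ p.1 < p.2 ∧ p.2 < B}

theorem isOpen_triangle (A B : ℝ) : IsOpen (triangle A B) :=
  (isOpen_lt continuous_const continuous_fst).inter
    ((isOpen_lt continuous_fst continuous_snd).inter (isOpen_lt continuous_snd continuous_const))

theorem norm_integral_integral_le {H : ℝ × ℝ → ℝ} {C x₁ x₂ y₁ y₂ : ℝ} (hx : x₁ ≤ x₂) (hy : y₁ ≤ y₂)
    (hC : ∀ x ∈ Icc x₁ x₂, ∀ y ∈ Icc y₁ y₂, |H (x, y)| ≤ C) :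
    |∫ y in y₁..y₂, ∫ x in x₁..x₂, H (x, y)| ≤ C * (x₂ - x₁) * (y₂ - y₁) := by
  have h1 := intervalIntegral.norm_integral_le_of_norm_le_const (a := y₁) (b := y₂)
    (f := fun y => ∫ x in x₁..x₂, H (x, y)) (C := C * (x₂ - x₁)) (fun y hy' => by
      rw [uIoc_of_le hy] at hy'
      have h2 := intervalIntegral.norm_integral_le_of_norm_le_const (a := x₁) (b := x₂)
        (f := fun x => H (x, y)) (C := C) (fun x hx' => by
          rw [uIoc_of_le hx] at hx'
          exact hC x ⟨hx'.1.le, hx'.2⟩ y ⟨hy'.1.le, hy'.2⟩)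
      rwa [abs_of_nonneg (sub_nonneg.2 hx)] at h2)
  rwa [abs_of_nonneg (sub_nonneg.2 hy)] at h1

/-- A function `Q` of intervals that is superadditive with defect at most `C` times the product of
the lengths, and that satisfies the Einstein equation for `log Ω²` in integrated form, with a nearly
constant conformal factor, is bounded by the square of the length. Dividing an interval into three
parts, the first and the last of which carry a third of the value `N` of `Q`, makes the cross ratio
of the four values `Q` close to `4/3` if `N` is much larger than the square of the length, whereas
the equation makes it close to `1`. -/
theorem le_sq_length_of_cross_ratio {Q : ℝ → ℝ → ℝ} {A B M : ℝ} (hM : 0 < M)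
    (hQc : Continuous fun p : ℝ × ℝ => Q p.1 p.2)
    (hQ0 : ∀ x, A < x → x < B → Q x x = 0) (hQpos : ∀ x y, A < x → x < y → y < B → 0 < Q x y)
    (hsup : ∀ x y z, A < x → x ≤ y → y ≤ z → z < B → Q x y + Q y z ≤ Q x z)
    (hsub : ∀ x y z, A < x → x ≤ y → y ≤ z → z < B →
      Q x z ≤ Q x y + Q y z + 3 / 4 * M * (y - x) * (z - y))
    (hcross : ∀ x₀ x₁ x₂ x₃, A < x₀ → x₀ < x₁ → x₁ < x₂ → x₂ < x₃ → x₃ < B →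
      Real.log (Q x₀ x₂) + Real.log (Q x₁ x₃) - Real.log (Q x₀ x₃) - Real.log (Q x₁ x₂) ≤
        3 / 4 * M * (x₃ - x₀) ^ 2 / Q x₁ x₂ + 1 / 20) {x₀ x₃ : ℝ} (hx₀ : A < x₀) (hx : x₀ ≤ x₃)
    (hx₃ : x₃ < B) : Q x₀ x₃ ≤ 45 * M * (x₃ - x₀) ^ 2 := by
  by_contra! hN
  set N := Q x₀ x₃ with hNdef
  set L := x₃ - x₀ with hL
  have hL0 : 0 ≤ L := sub_nonneg.2 hx
  have hNpos : 0 < N := lt_of_le_of_lt (by positivity) hN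
  have hκ : 3 / 4 * M * L ^ 2 ≤ N / 60 := by linarith
  obtain ⟨x₁, ⟨h01, h13⟩, hx₁⟩ : ∃ x₁ ∈ Icc x₀ x₃, Q x₀ x₁ = N / 3 := by
    refine intermediate_value_Icc hx (f := fun t => Q x₀ t) ?_ ?_
    · exact (hQc.comp (Continuous.prodMk_right x₀)).continuousOn
    · simp only [hQ0 x₀ hx₀ (by linarith)]
      exact ⟨by positivity, by linarith⟩
  obtain ⟨x₂, ⟨h02, h23⟩, hx₂⟩ : ∃ x₂ ∈ Icc x₀ x₃, Q x₂ x₃ = N / 3 := by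
    refine intermediate_value_Icc' hx (f := fun t => Q t x₃) ?_ ?_
    · exact (hQc.comp (Continuous.prodMk_left x₃)).continuousOn
    · simp only [hQ0 x₃ (by linarith) hx₃]
      exact ⟨by positivity, by linarith⟩
  have nonneg : ∀ x y, A < x → x ≤ y → y < B → 0 ≤ Q x y := fun x y h1 h2 h3 => by
    rcases h2.eq_or_lt with rfl | h2
    · exact (hQ0 x h1 h3).ge
    · exact (hQpos x y h1 h2 h3).le
  have bound : ∀ a b, 0 ≤ a → a ≤ L → 0 ≤ b → b ≤ L → 3 / 4 * M * a * b ≤ N / 60 := by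
    intro a b ha ha' hb hb'
    have : a * b ≤ L * L := mul_le_mul ha' hb' hb hL0
    nlinarith
  have h12 : x₁ < x₂ := by
    by_contra! h21
    have h1 := hsub x₀ x₁ x₃ hx₀ h01 h13 hx₃
    have h2 := hsup x₂ x₁ x₃ (by linarith) h21 h13 hx₃
    have h3 := nonneg x₂ x₁ (by linarith) h21 (by linarith)
    have h4 := bound (x₁ - x₀) (x₃ - x₁) (by linarith) (by linarith) (by linarith) (by linarith)
    linarith
  have h01' : x₀ < x₁ := h01.lt_of_ne fun h => by
    rw [← h, hQ0 x₀ hx₀ (by linarith)] at hx₁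
    linarith
  have h23' : x₂ < x₃ := h23.lt_of_ne fun h => by
    rw [h, hQ0 x₃ (by linarith) hx₃] at hx₂
    linarith
  set m := Q x₁ x₂ with hm
  have e1 := hsub x₀ x₁ x₃ hx₀ h01 h13 hx₃
  have e2 := hsub x₁ x₂ x₃ (by linarith) h12.le h23 hx₃
  have b1 := bound (x₁ - x₀) (x₃ - x₁) (by linarith) (by linarith) (by linarith) (by linarith)
  have b2 := bound (x₂ - x₁) (x₃ - x₂) (by linarith) (by linarith) (by linarith) (by linarith)
  have s1 := hsup x₀ x₁ x₂ hx₀ h01 h12.le (by linarith)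
  have s2 := hsup x₁ x₂ x₃ (by linarith) h12.le h23 hx₃
  have s3 := hsup x₀ x₁ x₃ hx₀ h01 h13 hx₃
  have hml : 3 / 10 * N ≤ m := by linarith
  have hmu : m ≤ N / 3 := by linarith
  have hmpos : 0 < m := by linarith
  have q1 : 19 / 30 * N ≤ Q x₀ x₂ := by linarith
  have q2 : 19 / 30 * N ≤ Q x₁ x₃ := by linarith
  have key := hcross x₀ x₁ x₂ x₃ hx₀ h01' h12 h23' hx₃
  have rhs : 3 / 4 * M * L ^ 2 / m ≤ 1 / 18 := by
    rw [div_le_iff₀ hmpos]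
    linarith
  have l1 : Real.log (19 / 30 * N) ≤ Real.log (Q x₀ x₂) := Real.log_le_log (by positivity) q1
  have l2 : Real.log (19 / 30 * N) ≤ Real.log (Q x₁ x₃) := Real.log_le_log (by positivity) q2
  have l3 : Real.log m ≤ Real.log (N / 3) := Real.log_le_log hmpos hmu
  rw [Real.log_mul (by norm_num) hNpos.ne'] at l1 l2
  rw [Real.log_div hNpos.ne' (by norm_num)] at l3
  have l4 : (2 : ℝ) * Real.log (19 / 30) + Real.log 3 = Real.log (361 / 300) := by
    rw [show (361 / 300 : ℝ) = (19 / 30) * (19 / 30) * 3 by norm_num,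
      Real.log_mul (by norm_num) (by norm_num), Real.log_mul (by norm_num) (by norm_num)]
    ring
  -- the contradiction is `log (361 / 300) > 1 / 18 + 1 / 20`
  have l5 := Real.one_sub_inv_le_log_of_pos (x := 361 / 300) (by norm_num)
  norm_num at l5
  linarith

/-- Near a segment of the axis on which `Ω²` is continuous and positive, `r² ≤ C (v - u)²`. -/
theorem radius_sq_le {Λ A B m M : ℝ} {r W : ℝ × ℝ → ℝ} (hr : Continuous r) (hW : Continuous W)
    (hm : 0 < m) (hmW : ∀ p, m ≤ W p) (hWM : ∀ p, W p ≤ M)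
    (hosc : Real.log M - Real.log m ≤ 1 / 100) (hΛ : ∀ p, |Λ * r p ^ 2| ≤ 1 / 2)
    (hpos : ∀ p ∈ triangle A B, 0 < r p) (hdiag : ∀ x, A < x → x < B → r (x, x) = 0)
    (eq_r : ∀ φ, IsTestFunction (triangle A B) φ →
      ∫ p, r p ^ 2 * pu (pv φ) p = ∫ p, -(1 / 2) * (1 - Λ * r p ^ 2) * W p * φ p)
    (eq_W : ∀ φ, IsTestFunction (triangle A B) φ →
      ∫ p, (Real.log (W p) + Real.log (r p)) * pu (pv φ) p =
        ∫ p, (W p / (2 * r p ^ 2) + 1 / (2 * r p ^ 2) * (-(1 / 2) * (1 - Λ * r p ^ 2) * W p)) * φ p)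
    {x y : ℝ} (hx : A < x) (hxy : x ≤ y) (hy : y < B) :
    r (x, y) ^ 2 ≤ 45 * M * (y - x) ^ 2 := by
  have hM : 0 < M := hm.trans_le ((hmW 0).trans (hWM 0))
  have hWpos : ∀ p, 0 < W p := fun p => hm.trans_le (hmW p)
  have rect : ∀ {x₀ x₁ x₂ x₃ : ℝ}, A < x₀ → x₁ < x₂ → x₃ < B →
      Icc ((A + x₀) / 2) ((2 * x₁ + x₂) / 3) ×ˢ Icc ((x₁ + 2 * x₂) / 3) ((x₃ + B) / 2) ⊆
        triangle A B := by
    rintro x₀ x₁ x₂ x₃ h0 h12 h3 ⟨a, b⟩ ⟨⟨h4, h5⟩, h6, h7⟩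
    simp only at h4 h5 h6 h7
    exact ⟨by simp only; linarith, by simp only; linarith, by simp only; linarith⟩
  have dd : ∀ x₀ x₁ x₂ x₃, A < x₀ → x₀ ≤ x₁ → x₁ < x₂ → x₂ ≤ x₃ → x₃ < B →
      0 ≤ r (x₀, x₃) ^ 2 - r (x₁, x₃) ^ 2 + r (x₁, x₂) ^ 2 - r (x₀, x₂) ^ 2 ∧
      r (x₀, x₃) ^ 2 - r (x₁, x₃) ^ 2 + r (x₁, x₂) ^ 2 - r (x₀, x₂) ^ 2 ≤
        3 / 4 * M * (x₁ - x₀) * (x₃ - x₂) := by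
    intro x₀ x₁ x₂ x₃ h0 h01 h12 h23 h3
    have h := second_difference_eq_integral_of_continuousOn (O := triangle A B)
      (F := fun p => r p ^ 2) (H := fun p => -(1 / 2) * (1 - Λ * r p ^ 2) * W p)
      (by fun_prop) (by fun_prop) (rect h0 h12 h3) eq_r (x₁ := x₀) (x₂ := x₁) (y₁ := x₂) (y₂ := x₃)
      (by linarith) h01 (by linarith) (by linarith) h23 (by linarith)
    have hb : ∀ p, -(3 / 4 * M) ≤ -(1 / 2) * (1 - Λ * r p ^ 2) * W p ∧
        -(1 / 2) * (1 - Λ * r p ^ 2) * W p ≤ 0 := by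
      intro p
      obtain ⟨h4, h5⟩ := abs_le.1 (hΛ p)
      have h6 := hWpos p
      have h7 := hWM p
      constructor
      · nlinarith
      · nlinarith
    have h8 := norm_integral_integral_le (H := fun p => -(1 / 2) * (1 - Λ * r p ^ 2) * W p)
      (C := 3 / 4 * M) h01 h23 fun a _ b _ => abs_le.2 ⟨(hb _).1, (hb _).2.trans (by positivity)⟩
    have h9 : ∫ y in x₂..x₃, ∫ x in x₀..x₁, -(1 / 2) * (1 - Λ * r (x, y) ^ 2) * W (x, y) ≤ 0 := by
      have := intervalIntegral.integral_nonneg (μ := volume) h23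
        (f := fun y => -∫ x in x₀..x₁, -(1 / 2) * (1 - Λ * r (x, y) ^ 2) * W (x, y)) fun y _ => by
          have := intervalIntegral.integral_nonneg (μ := volume) h01
            (f := fun x => -(-(1 / 2) * (1 - Λ * r (x, y) ^ 2) * W (x, y)))
            fun x _ => neg_nonneg.2 (hb _).2
          rwa [intervalIntegral.integral_neg] at this
      rw [intervalIntegral.integral_neg] at this
      linarith
    rw [abs_le] at h8
    constructor <;> linarith [h8.1]
  have lim : ∀ x y z, A < x → x < y → y ≤ z → z < B →
      0 ≤ r (x, z) ^ 2 - r (y, z) ^ 2 + r (y, y) ^ 2 - r (x, y) ^ 2 ∧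
      r (x, z) ^ 2 - r (y, z) ^ 2 + r (y, y) ^ 2 - r (x, y) ^ 2 ≤
        3 / 4 * M * (y - x) * (z - y) := by
    intro x y z h0 h1 h2 h3
    have ev : ∀ᶠ t in 𝓝[<] y, t ∈ Ioo x y := Ioo_mem_nhdsLT h1
    have t1 : Tendsto (fun t => r (x, z) ^ 2 - r (t, z) ^ 2 + r (t, y) ^ 2 - r (x, y) ^ 2) (𝓝[<] y)
        (𝓝 (r (x, z) ^ 2 - r (y, z) ^ 2 + r (y, y) ^ 2 - r (x, y) ^ 2)) := by
      have : Continuous fun t => r (x, z) ^ 2 - r (t, z) ^ 2 + r (t, y) ^ 2 - r (x, y) ^ 2 := by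
        fun_prop
      exact (this.tendsto y).mono_left nhdsWithin_le_nhds
    constructor
    · refine ge_of_tendsto t1 (ev.mono fun t ht => ?_)
      exact (dd x t y z h0 ht.1.le ht.2 h2 h3).1
    · refine le_of_tendsto t1 (ev.mono fun t ht => ?_)
      refine (dd x t y z h0 ht.1.le ht.2 h2 h3).2.trans ?_
      have := ht.2.le
      have := sub_nonneg.2 h2
      gcongr
  refine le_sq_length_of_cross_ratio (Q := fun x y => r (x, y) ^ 2) hM (by fun_prop)
    (fun x h1 h2 => by simp [hdiag x h1 h2])
    (fun x y h1 h2 h3 => pow_pos (hpos _ ⟨h1, h2, h3⟩) 2) ?_ ?_ ?_ hx hxy hy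
  · intro x y z h0 h1 h2 h3
    rcases h1.eq_or_lt with rfl | h1
    · simp [hdiag x h0 (by linarith)]
    · have := (lim x y z h0 h1 h2 h3).1
      simp only [hdiag y (by linarith) (by linarith)] at this
      linarith
  · intro x y z h0 h1 h2 h3
    rcases h1.eq_or_lt with rfl | h1
    · simp [hdiag x h0 (by linarith)]
    · have := (lim x y z h0 h1 h2 h3).2
      simp only [hdiag y (by linarith) (by linarith)] at this
      linarith
  · intro x₀ x₁ x₂ x₃ h0 h01 h12 h23 h3
    have hne : ∀ p ∈ triangle A B, r p ≠ 0 := fun p hp => (hpos p hp).ne'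
    have h := second_difference_eq_integral_of_continuousOn (O := triangle A B)
      (F := fun p => Real.log (W p) + Real.log (r p))
      (H := fun p => W p / (2 * r p ^ 2) +
        1 / (2 * r p ^ 2) * (-(1 / 2) * (1 - Λ * r p ^ 2) * W p))
      ((hW.continuousOn.log fun p _ => (hWpos p).ne').add (hr.continuousOn.log hne))
      (by
        have h2 : ContinuousOn (fun p => 2 * r p ^ 2) (triangle A B) := by fun_prop
        have h2' : ∀ p ∈ triangle A B, 2 * r p ^ 2 ≠ 0 := fun p hp => by
          have := hne p hp
          positivity
        exact (hW.continuousOn.div h2 h2').add ((continuousOn_const.div h2 h2').mul (by fun_prop)))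
      (rect h0 h12 h3) eq_W (x₁ := x₀) (x₂ := x₁) (y₁ := x₂) (y₂ := x₃)
      (by linarith) h01.le (by linarith) (by linarith) h23.le (by linarith)
    have mono : ∀ x ∈ Icc x₀ x₁, ∀ y ∈ Icc x₂ x₃, r (x₁, x₂) ^ 2 ≤ r (x, y) ^ 2 := by
      intro x hx y hy
      have e1 : r (x₁, x₂) ^ 2 ≤ r (x₁, y) ^ 2 := by
        have := (lim x₁ x₂ y (by linarith) h12 hy.1 (by linarith [hy.2])).1
        simp only [hdiag x₂ (by linarith) (by linarith)] at this
        nlinarith [sq_nonneg (r (x₂, y))]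
      rcases hx.2.eq_or_lt with rfl | hx'
      · exact e1
      · have := (lim x x₁ y (by linarith [hx.1]) hx' (by linarith [hy.1]) (by linarith [hy.2])).1
        simp only [hdiag x₁ (by linarith) (by linarith)] at this
        nlinarith [sq_nonneg (r (x, x₁))]
    have hq : 0 < r (x₁, x₂) ^ 2 := pow_pos (hpos _ ⟨by simp only; linarith, h12, by
      simp only; linarith⟩) 2
    have h8 := norm_integral_integral_le
      (H := fun p => W p / (2 * r p ^ 2) + 1 / (2 * r p ^ 2) * (-(1 / 2) * (1 - Λ * r p ^ 2) * W p))
      (C := 3 / 8 * M / r (x₁, x₂) ^ 2) h01.le h23.le (by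
        intro x hx y hy
        have e := mono x hx y hy
        set R := r (x, y) ^ 2 with hR
        have hRpos : 0 < R := hq.trans_le e
        have e2 : W (x, y) / (2 * R) + 1 / (2 * R) * (-(1 / 2) * (1 - Λ * R) * W (x, y)) =
            (1 + Λ * R) * W (x, y) / 4 / R := by
          field_simp
          ring
        obtain ⟨h4, h5⟩ := abs_le.1 (hΛ (x, y))
        have h6 := hWpos (x, y)
        have h7 := hWM (x, y)
        rw [e2, abs_of_nonneg (div_nonneg (by nlinarith) hRpos.le)]
        refine div_le_div₀ (by positivity) ?_ hq e
        nlinarith)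
    have two : ∀ p ∈ triangle A B, Real.log (r p ^ 2) = 2 * Real.log (r p) := fun p _ => by
      rw [Real.log_pow]
      norm_num
    rw [two (x₀, x₂) ⟨h0, by simp only; linarith, by simp only; linarith⟩,
      two (x₁, x₃) ⟨by simp only; linarith, by simp only; linarith, h3⟩,
      two (x₀, x₃) ⟨h0, by simp only; linarith, h3⟩,
      two (x₁, x₂) ⟨by simp only; linarith, h12, by simp only; linarith⟩]
    have lw : ∀ p, Real.log m ≤ Real.log (W p) ∧ Real.log (W p) ≤ Real.log M := fun p =>
      ⟨Real.log_le_log hm (hmW p), Real.log_le_log (hWpos p) (hWM p)⟩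
    have h10 := (abs_le.1 h8).2
    rw [← h] at h10
    have h11 : 3 / 8 * M / r (x₁, x₂) ^ 2 * (x₁ - x₀) * (x₃ - x₂) ≤
        3 / 8 * M * (x₃ - x₀) ^ 2 / r (x₁, x₂) ^ 2 := by
      have : (x₁ - x₀) * (x₃ - x₂) ≤ (x₃ - x₀) ^ 2 := by nlinarith
      calc _ = 3 / 8 * M / r (x₁, x₂) ^ 2 * ((x₁ - x₀) * (x₃ - x₂)) := by ring
        _ ≤ 3 / 8 * M / r (x₁, x₂) ^ 2 * (x₃ - x₀) ^ 2 := by gcongr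
        _ = _ := by ring
    have h12 : 3 / 4 * M * (x₃ - x₀) ^ 2 / r (x₁, x₂) ^ 2 =
      2 * (3 / 8 * M * (x₃ - x₀) ^ 2 / r (x₁, x₂) ^ 2) := by ring
    rw [h12]
    linarith [lw (x₀, x₂), lw (x₁, x₃), lw (x₀, x₃), lw (x₁, x₂)]

/-! ### The constraint equation tested against functions of low regularity -/

theorem deriv_eq_zero_of_notMem_tsupport {Φ G : ℝ × ℝ → ℝ}
    (hd : ∀ p : ℝ × ℝ, HasDerivAt (fun s => Φ (p.1, s)) (G p) p.2) {p : ℝ × ℝ}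
    (hp : p ∉ tsupport Φ) : G p = 0 := by
  have h1 : Φ =ᶠ[𝓝 p] 0 := notMem_tsupport_iff_eventuallyEq.1 hp
  have h2 : (fun s => Φ (p.1, s)) =ᶠ[𝓝 p.2] fun _ => 0 :=
    (Continuous.tendsto (f := fun s : ℝ => (p.1, s)) (by fun_prop) p.2).eventually h1
  exact (hd p).unique ((hasDerivAt_const p.2 (0 : ℝ)).congr_of_eventuallyEq h2)

theorem pv_eq_of_hasDerivAt {f : ℝ × ℝ → ℝ} {p : ℝ × ℝ} {c : ℝ} (hf : DifferentiableAt ℝ f p)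
    (h : HasDerivAt (fun s => f (p.1, s)) c p.2) : pv f p = c := by
  have h1 : HasDerivAt (fun s : ℝ => ((p.1, s) : ℝ × ℝ)) (0, 1) p.2 :=
    (hasDerivAt_const _ _).prodMk (hasDerivAt_id _)
  exact (hf.hasFDerivAt.comp_hasDerivAt p.2 h1).unique h

/-- A compactly supported continuous function with a continuous `v`-derivative is a limit of test
functions, boundedly and together with the `v`-derivatives. -/
theorem exists_testFunction_approx {Φ G : ℝ × ℝ → ℝ} {O : Set (ℝ × ℝ)} (hO : IsOpen O)
    (hΦ : Continuous Φ) (hG : Continuous G)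
    (hd : ∀ p : ℝ × ℝ, HasDerivAt (fun s => Φ (p.1, s)) (G p) p.2)
    (hc : HasCompactSupport Φ) (hs : tsupport Φ ⊆ O) :
    ∃ K, IsCompact K ∧ K ⊆ O ∧ ∃ (φ : ℕ → ℝ × ℝ → ℝ) (C : ℝ), ∀ n, IsTestFunction O (φ n) ∧
      tsupport (φ n) ⊆ K ∧ (∀ p, |φ n p| ≤ C) ∧ (∀ p, |pv (φ n) p| ≤ C) ∧
      (∀ p, Tendsto (fun n => φ n p) atTop (𝓝 (Φ p))) ∧
      ∀ p, Tendsto (fun n => pv (φ n) p) atTop (𝓝 (G p)) := by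
  have hGc : HasCompactSupport G :=
    HasCompactSupport.intro hc fun _ hp => deriv_eq_zero_of_notMem_tsupport hd hp
  obtain ⟨ε, hε, hεO⟩ := hc.isCompact.exists_cthickening_subset_open hO hs
  obtain ⟨C₁, hC₁⟩ := hc.exists_bound_of_continuous hΦ
  obtain ⟨C₂, hC₂⟩ := hGc.exists_bound_of_continuous hG
  let b : ℕ → ContDiffBump (0 : ℝ × ℝ) := fun n =>
    ⟨ε / (n + 1) / 2, ε / (n + 1), by positivity, half_lt_self (by positivity)⟩
  have hb : Tendsto (fun n => (b n).rOut) atTop (𝓝 0) := by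
    have := (tendsto_one_div_add_atTop_nhds_zero_nat (𝕜 := ℝ)).const_mul ε
    simpa [b, div_eq_mul_inv] using this
  have hbε : ∀ n, (b n).rOut ≤ ε := fun n =>
    div_le_self hε.le (by linarith [n.cast_nonneg (α := ℝ)])
  let φ : ℕ → ℝ × ℝ → ℝ := fun n =>
    convolution ((b n).normed volume) Φ (ContinuousLinearMap.lsmul ℝ ℝ) volume
  let γ : ℕ → ℝ × ℝ → ℝ := fun n =>
    convolution ((b n).normed volume) G (ContinuousLinearMap.lsmul ℝ ℝ) volume
  have hφs : ∀ n, ContDiff ℝ ∞ (φ n) := fun n =>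
    (b n).hasCompactSupport_normed.contDiff_convolution_left _ (b n).contDiff_normed
      hΦ.locallyIntegrable
  have hpv : ∀ n p, pv (φ n) p = γ n p := by
    intro n p
    refine pv_eq_of_hasDerivAt ((hφs n).differentiable (by simp) p) ?_
    refine (hasDerivAt_integral_of_dominated_loc_of_deriv_le (μ := volume)
      (F := fun s t => (b n).normed volume t • Φ ((p.1, s) - t))
      (F' := fun s t => (b n).normed volume t • G ((p.1, s) - t))
      (bound := fun t => (b n).normed volume t * C₂) (x₀ := p.2) univ_mem ?_ ?_ ?_ ?_ ?_ ?_).2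
    · have := (b n).continuous_normed (μ := volume)
      exact Eventually.of_forall fun s => Continuous.aestronglyMeasurable (by fun_prop)
    · have := (b n).continuous_normed (μ := volume)
      exact Continuous.integrable_of_hasCompactSupport (by fun_prop)
        (b n).hasCompactSupport_normed.smul_right
    · have := (b n).continuous_normed (μ := volume)
      exact Continuous.aestronglyMeasurable (by fun_prop)
    · refine Eventually.of_forall fun t s _ => ?_
      rw [norm_smul, Real.norm_of_nonneg ((b n).nonneg_normed t)]
      exact mul_le_mul_of_nonneg_left (hC₂ _) ((b n).nonneg_normed t)
    · exact (b n).integrable_normed.mul_const _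
    · refine Eventually.of_forall fun t s _ => ?_
      have h1 := (hd ((p.1, s) - t)).comp_sub_const s t.2
      exact h1.const_smul ((b n).normed volume t)
  have hbound : ∀ (f : ℝ × ℝ → ℝ) (C : ℝ), Continuous f → (∀ p, ‖f p‖ ≤ C) → ∀ n p,
      |convolution ((b n).normed volume) f (ContinuousLinearMap.lsmul ℝ ℝ) volume p| ≤ 3 * C := by
    intro f C hf hC n p
    have h1 := (b n).dist_normed_convolution_le (μ := volume) (g := f) (x₀ := p) (ε := 2 * C)
      hf.aestronglyMeasurable (fun x _ => by
        have := norm_sub_le (f x) (f p)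
        rw [dist_eq_norm]
        linarith [hC x, hC p])
    rw [Real.dist_eq] at h1
    have h2 := hC p
    rw [Real.norm_eq_abs] at h2
    have h3 := abs_sub_abs_le_abs_sub
      (convolution ((b n).normed volume) f (ContinuousLinearMap.lsmul ℝ ℝ) volume p) (f p)
    linarith
  have hsub : ∀ n, tsupport (φ n) ⊆ Metric.cthickening ε (tsupport Φ) := by
    intro n
    refine closure_minimal (fun p hp => ?_) Metric.isClosed_cthickening
    obtain ⟨x, hx, y, hy, rfl⟩ := support_convolution_subset _ hp
    rw [(b n).support_normed_eq, mem_ball_zero_iff] at hx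
    refine Metric.mem_cthickening_of_dist_le _ y ε _ (subset_tsupport _ hy) ?_
    simp only [dist_eq_norm, add_sub_cancel_right]
    exact hx.le.trans (hbε n)
  have hcomp : IsCompact (Metric.cthickening ε (tsupport Φ)) := hc.isCompact.cthickening
  refine ⟨_, hcomp, hεO, φ, max (3 * C₁) (3 * C₂), fun n => ⟨⟨hφs n, ?_, (hsub n).trans hεO⟩,
    hsub n, fun p => (hbound Φ C₁ hΦ hC₁ n p).trans (le_max_left _ _), fun p => ?_, fun p => ?_,
    fun p => ?_⟩⟩
  · exact hcomp.of_isClosed_subset (isClosed_tsupport _) (hsub n)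
  · rw [hpv]
    exact (hbound G C₂ hG hC₂ n p).trans (le_max_right _ _)
  · exact ContDiffBump.convolution_tendsto_right_of_continuous hb hΦ p
  · simp_rw [hpv]
    exact ContDiffBump.convolution_tendsto_right_of_continuous hb hG p

theorem tendsto_integral_mul_of_bounded_of_compact {K : Set (ℝ × ℝ)} (hK : IsCompact K)
    {ν : Measure (ℝ × ℝ)} (hν : ν K < ⊤) {f : ℝ × ℝ → ℝ} (hf : ContinuousOn f K)
    {φ : ℕ → ℝ × ℝ → ℝ} {Φ : ℝ × ℝ → ℝ} {C : ℝ} (hφ : ∀ n, Continuous (φ n))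
    (hs : ∀ n, tsupport (φ n) ⊆ K) (hC : ∀ n p, |φ n p| ≤ C)
    (hlim : ∀ p, Tendsto (fun n => φ n p) atTop (𝓝 (Φ p))) :
    Tendsto (fun n => ∫ p, f p * φ n p ∂ν) atTop (𝓝 (∫ p, f p * Φ p ∂ν)) := by
  obtain ⟨c, hc⟩ := hK.exists_bound_of_continuousOn hf
  have hind : ∀ n, (fun p => f p * φ n p) = K.indicator fun p => f p * φ n p := fun n =>
    (indicator_eq_self.2 fun p hp => hs n (subset_tsupport _ (right_ne_zero_of_mul hp))).symm
  refine tendsto_integral_of_dominated_convergence (K.indicator fun _ => c * C) (fun n => ?_) ?_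
    (fun n => Eventually.of_forall fun p => ?_) (Eventually.of_forall fun p =>
      (hlim p).const_mul (f p))
  · rw [hind, aestronglyMeasurable_indicator_iff hK.measurableSet]
    exact (hf.mul (hφ n).continuousOn).aestronglyMeasurable hK.measurableSet
  · rw [integrable_indicator_iff hK.measurableSet]
    exact integrableOn_const hν.ne
  · by_cases hp : p ∈ K
    · rw [indicator_of_mem hp, norm_mul]
      exact mul_le_mul (hc p hp) (hC n p) (norm_nonneg _) ((norm_nonneg _).trans (hc p hp))
    · rw [indicator_of_notMem hp,
        image_eq_zero_of_notMem_tsupport (fun h => hp (hs n h)), mul_zero, norm_zero]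

/-- The constraint equation `∂_v(Ω⁻² ∂_v r) = -4π r⁻¹ Ω⁻² σ`, integrated twice: the function `ψ` is
a test function for `∂_v r`, and its primitive `Φ` with respect to `Ω² dv` is one for the equation.
Both need to be differentiable only in `v`. -/
theorem weakConstraint_of_primitive {O : Set (ℝ × ℝ)} (hO : IsOpen O) {r W : ℝ × ℝ → ℝ}
    (hr : ContinuousOn r O) (hr0 : ∀ p ∈ O, r p ≠ 0) (hW : ContinuousOn W O)
    (hW0 : ∀ p, W p ≠ 0) {μ₁ μ₂ σ : Measure (ℝ × ℝ)} (h₁ : IsRadonOn O μ₁) (h₂ : IsRadonOn O μ₂)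
    (hσ : IsRadonOn O σ)
    (hr_v : ∀ φ, IsTestFunction O φ → ∫ p, r p * pv φ p = -(∫ p, φ p ∂μ₁ - ∫ p, φ p ∂μ₂))
    (hcon : ∀ φ, IsTestFunction O φ →
      ∫ p, (W p)⁻¹ * pv φ p ∂μ₁ - ∫ p, (W p)⁻¹ * pv φ p ∂μ₂ =
        4 * Real.pi * ∫ p, (r p)⁻¹ * (W p)⁻¹ * φ p ∂σ)
    {ψ ψ' Φ : ℝ × ℝ → ℝ} (hψ : Continuous ψ) (hψ' : Continuous ψ') (hΦ : Continuous Φ)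
    (hWψ : Continuous fun p => W p * ψ p)
    (hdψ : ∀ p : ℝ × ℝ, HasDerivAt (fun s => ψ (p.1, s)) (ψ' p) p.2)
    (hdΦ : ∀ p : ℝ × ℝ, HasDerivAt (fun s => Φ (p.1, s)) (W p * ψ p) p.2)
    (hcψ : HasCompactSupport ψ) (hsψ : tsupport ψ ⊆ O) (hcΦ : HasCompactSupport Φ)
    (hsΦ : tsupport Φ ⊆ O) :
    -∫ p, r p * ψ' p = 4 * Real.pi * ∫ p, (r p)⁻¹ * (W p)⁻¹ * Φ p ∂σ := by
  have hWi : ContinuousOn (fun p => (W p)⁻¹) O := hW.inv₀ fun p _ => hW0 p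
  have hri : ContinuousOn (fun p => (r p)⁻¹ * (W p)⁻¹) O := (hr.inv₀ hr0).mul hWi
  have pvc : ∀ {φ}, IsTestFunction O φ → Continuous (pv φ) := fun h =>
    (h.1.continuous_fderiv (by simp)).clm_apply continuous_const
  have A : ∫ p, r p * ψ' p = -(∫ p, ψ p ∂μ₁ - ∫ p, ψ p ∂μ₂) := by
    obtain ⟨K, hK, hKO, φ, C, H⟩ := exists_testFunction_approx hO hψ hψ' hdψ hcψ hsψ
    have t1 := tendsto_integral_mul_of_bounded_of_compact hK (ν := volume) hK.measure_lt_top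
      (hr.mono hKO) (fun n => pvc (H n).1)
      (fun n => (tsupport_pv_subset _).trans (H n).2.1) (fun n => (H n).2.2.2.1)
      (H 0).2.2.2.2.2
    have t2 := fun ν (hν : IsRadonOn O ν) => tendsto_integral_mul_of_bounded_of_compact hK
      (hν K hKO hK) (f := fun _ => 1) continuousOn_const (fun n => (H n).1.1.continuous)
      (fun n => (H n).2.1) (fun n => (H n).2.2.1) (H 0).2.2.2.2.1
    simp only [one_mul] at t2
    refine tendsto_nhds_unique t1 ?_
    simp_rw [fun n => hr_v _ (H n).1]
    exact ((t2 μ₁ h₁).sub (t2 μ₂ h₂)).neg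
  have B : ∫ p, ψ p ∂μ₁ - ∫ p, ψ p ∂μ₂ = 4 * Real.pi * ∫ p, (r p)⁻¹ * (W p)⁻¹ * Φ p ∂σ := by
    obtain ⟨K, hK, hKO, φ, C, H⟩ := exists_testFunction_approx hO hΦ hWψ hdΦ hcΦ hsΦ
    have t1 := tendsto_integral_mul_of_bounded_of_compact hK (hσ K hKO hK) (hri.mono hKO)
      (fun n => (H n).1.1.continuous) (fun n => (H n).2.1) (fun n => (H n).2.2.1)
      (H 0).2.2.2.2.1
    have t2 := fun ν (hν : IsRadonOn O ν) => tendsto_integral_mul_of_bounded_of_compact hK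
      (hν K hKO hK) (hWi.mono hKO) (fun n => pvc (H n).1)
      (fun n => (tsupport_pv_subset _).trans (H n).2.1) (fun n => (H n).2.2.2.1)
      (H 0).2.2.2.2.2
    simp_rw [inv_mul_cancel_left₀ (hW0 _)] at t2
    refine tendsto_nhds_unique ((t2 μ₁ h₁).sub (t2 μ₂ h₂)) ?_
    simp_rw [fun n => hcon _ (H n).1]
    exact t1.const_mul _
  linarith

/-! ### No incoming dust reaches the axis -/

/-- A cut-off function, equal to `1` on `[a, b]` and supported in `[a - h, b + h]`. -/
theorem exists_cutoff {a b h : ℝ} (hab : a < b) (hh : 0 < h) :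
    ∃ α : ℝ → ℝ, ContDiff ℝ ∞ α ∧ (∀ x, 0 ≤ α x) ∧ (∀ x, α x ≤ 1) ∧ (∀ x ∈ Icc a b, α x = 1) ∧
      ∀ x, α x ≠ 0 → a - h < x ∧ x < b + h := by
  let f : ContDiffBump ((a + b) / 2) := ⟨(b - a) / 2, (b - a) / 2 + h, by linarith, by linarith⟩
  refine ⟨f, f.contDiff, fun x => f.nonneg, fun x => f.le_one, fun x hx => ?_, fun x hx => ?_⟩
  · refine f.one_of_mem_closedBall ?_
    rw [Metric.mem_closedBall, Real.dist_eq, abs_le]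
    constructor <;> simp only [f] <;> linarith [hx.1, hx.2]
  · have : x ∈ Function.support f := hx
    rw [f.support_eq, Metric.mem_ball, Real.dist_eq, abs_lt] at this
    simp only [f] at this
    constructor <;> linarith [this.1, this.2]

theorem deriv_eq_zero_of_forall_mem_eq_zero {β : ℝ → ℝ} {a b : ℝ}
    (h : ∀ x, β x ≠ 0 → a < x ∧ x < b) {x : ℝ} (hx : x < a ∨ b < x) : deriv β x = 0 := by
  have : β =ᶠ[𝓝 x] fun _ => 0 := by
    rcases hx with hx | hx
    · filter_upwards [eventually_lt_nhds hx] with y hy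
      by_contra hne
      linarith [(h y hne).1]
    · filter_upwards [eventually_gt_nhds hx] with y hy
      by_contra hne
      linarith [(h y hne).2]
  rw [this.deriv_eq, deriv_const]

theorem integral_rescale (β : ℝ → ℝ) {η : ℝ} (hη : 0 < η) (u a v : ℝ) :
    ∫ s in a..v, η⁻¹ * β ((s - u) / η) = ∫ x in ((a - u) / η)..((v - u) / η), β x := by
  rw [intervalIntegral.integral_const_mul,
    intervalIntegral.integral_comp_sub_right (fun s => β (s / η)) u,
    intervalIntegral.inv_mul_integral_comp_div]

/-- The compact region swept out by the segments `{u} × [u + η, c]`, `u ∈ [a, b]`. -/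
def strip (a b c η : ℝ) : Set (ℝ × ℝ) := {p | a ≤ p.1 ∧ p.1 ≤ b ∧ p.1 + η ≤ p.2 ∧ p.2 ≤ c}

theorem isCompact_strip {a b c η : ℝ} (hη : 0 ≤ η) : IsCompact (strip a b c η) := by
  refine (isCompact_Icc (a := (a, a)) (b := (b, c))).of_isClosed_subset ?_ ?_
  · exact (isClosed_le continuous_const continuous_fst).inter
      ((isClosed_le continuous_fst continuous_const).inter
        ((isClosed_le (by fun_prop) continuous_snd).inter
          (isClosed_le continuous_snd continuous_const)))
  · rintro ⟨x, y⟩ ⟨h1, h2, h3, h4⟩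
    simp only at h1 h2 h3 h4
    exact ⟨⟨h1, by simp only; linarith⟩, h2, h4⟩

/-- The functions `ψ` and `Φ = ∫ Ω² ψ dv` with which the constraint equation is tested: `ψ` is
`1/η` times a bump on `η < v - u < 2η`, corrected at a fixed distance from the axis so as to make
`∫ Ω² ψ dv` vanish. The constants `C` and `κ` do not depend on `η`. -/
theorem exists_test_pair {A B m M : ℝ} {W : ℝ × ℝ → ℝ} (hW : Continuous W) (hm : 0 < m)
    (hmW : ∀ p, m ≤ W p) (hWM : ∀ p, W p ≤ M) {a b h : ℝ} (hab : a < b) (hh : 0 < h)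
    (hA : A < a - 2 * h) (hB : b + 4 * h < B) :
    ∃ C κ : ℝ, 0 ≤ C ∧ 0 < κ ∧ ∀ η, 0 < η → 2 * η ≤ h → ∃ ψ ψ' Φ : ℝ × ℝ → ℝ,
      Continuous ψ ∧ Continuous ψ' ∧ Continuous Φ ∧
      (∀ p : ℝ × ℝ, HasDerivAt (fun s => ψ (p.1, s)) (ψ' p) p.2) ∧
      (∀ p : ℝ × ℝ, HasDerivAt (fun s => Φ (p.1, s)) (W p * ψ p) p.2) ∧
      (∀ p ∉ strip (a - 2 * h) (b + h) (b + 4 * h) η, ψ p = 0 ∧ Φ p = 0) ∧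
      (∀ p, 0 ≤ Φ p) ∧
      (∀ u v, (u + η ≤ v → u + 2 * η < v) → |ψ' (u, v)| ≤ C) ∧
      (∀ u v, |ψ' (u, v)| ≤ C * η⁻¹ ^ 2 + C) ∧
      ∀ u w, a - h ≤ u → u + 2 * η ≤ w → w ≤ b → κ ≤ Φ (u, w) := by
  have hM : 0 < M := hm.trans_le ((hmW 0).trans (hWM 0))
  have hWpos : ∀ p, 0 < W p := fun p => hm.trans_le (hmW p)
  obtain ⟨α, hα, hα0, hα1, hαone, hαs⟩ := exists_cutoff (a := a - h) (b := b) (by linarith) hh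
  obtain ⟨β, hβ, hβ0, -, hβone, hβs⟩ := exists_cutoff (a := (4 / 3 : ℝ)) (b := 5 / 3) (h := 1 / 3)
    (by norm_num) (by norm_num)
  obtain ⟨χ, hχ, hχ0, -, hχone, hχs⟩ := exists_cutoff (a := b + 5 / 2 * h) (b := b + 7 / 2 * h)
    (h := h / 2) (by linarith) (by linarith)
  have hβs' : ∀ x, β x ≠ 0 → 1 < x ∧ x < 2 := fun x hx => by
    have := hβs x hx
    constructor <;> linarith [this.1, this.2]
  have hχs' : ∀ x, χ x ≠ 0 → b + 2 * h < x ∧ x < b + 4 * h := fun x hx => by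
    have := hχs x hx
    constructor <;> linarith [this.1, this.2]
  have hαs' : ∀ x, α x ≠ 0 → a - 2 * h < x ∧ x < b + h := fun x hx => by
    have := hαs x hx
    constructor <;> linarith [this.1, this.2]
  have hαc := hα.continuous
  have hβc := hβ.continuous
  have hχc := hχ.continuous
  have hβi : ∀ x y, IntervalIntegrable β volume x y := fun x y => hβc.intervalIntegrable _ _
  have hχi : ∀ x y, IntervalIntegrable χ volume x y := fun x y => hχc.intervalIntegrable _ _
  set bβ := ∫ x in (1 : ℝ)..2, β x with hbβ
  have bβpos : 0 < bβ := by
    refine intervalIntegral.integral_pos (by norm_num) hβc.continuousOn (fun x _ => hβ0 x)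
      ⟨3 / 2, by constructor <;> norm_num, ?_⟩
    rw [hβone _ (by constructor <;> norm_num)]
    exact one_pos
  set bχ := ∫ x in A..B, χ x with hbχ
  have bχpos : 0 < bχ := by
    refine intervalIntegral.integral_pos (by linarith) hχc.continuousOn (fun x _ => hχ0 x)
      ⟨b + 3 * h, by constructor <;> linarith, ?_⟩
    rw [hχone _ (by constructor <;> linarith)]
    exact one_pos
  have hβle : ∀ x y, x ≤ y → ∫ t in x..y, β t ≤ bβ := by
    intro x y hxy
    have h1 : ∫ t in (min x 1)..(max y 2), β t = bβ := by
      rw [← intervalIntegral.integral_add_adjacent_intervals (hβi (min x 1) 1) (hβi 1 (max y 2)),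
        ← intervalIntegral.integral_add_adjacent_intervals (hβi 1 2) (hβi 2 (max y 2))]
      have z1 : ∫ t in (min x 1)..1, β t = 0 := by
        rw [intervalIntegral.integral_of_le (min_le_right _ _)]
        refine setIntegral_eq_zero_of_forall_eq_zero fun t ht => ?_
        by_contra hne
        linarith [(hβs' t hne).1, ht.2]
      have z2 : ∫ t in 2..(max y 2), β t = 0 := by
        rw [intervalIntegral.integral_of_le (le_max_right _ _)]
        refine setIntegral_eq_zero_of_forall_eq_zero fun t ht => ?_
        by_contra hne
        linarith [(hβs' t hne).2, ht.1]
      rw [z1, z2]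
      ring
    rw [← h1]
    exact intervalIntegral.integral_mono_interval (min_le_left _ _) hxy (le_max_left _ _)
      (Eventually.of_forall hβ0) (hβi _ _)
  obtain ⟨D₁, hD₁⟩ : ∃ D, ∀ x, |deriv β x| ≤ D := by
    obtain ⟨D, hD⟩ := (isCompact_Icc (a := (1 : ℝ)) (b := 2)).exists_bound_of_continuousOn
      (hβ.continuous_deriv (by simp)).continuousOn
    refine ⟨D, fun x => ?_⟩
    by_cases hx : x ∈ Icc (1 : ℝ) 2
    · exact hD x hx
    · rw [deriv_eq_zero_of_forall_mem_eq_zero hβs' (by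
        by_contra! h'
        exact hx ⟨h'.1, h'.2⟩), abs_zero]
      exact (norm_nonneg _).trans (hD 1 (by norm_num))
  obtain ⟨D₂, hD₂⟩ : ∃ D, ∀ x, |deriv χ x| ≤ D := by
    obtain ⟨D, hD⟩ := (isCompact_Icc (a := b + 2 * h) (b := b + 4 * h)).exists_bound_of_continuousOn
      (hχ.continuous_deriv (by simp)).continuousOn
    refine ⟨D, fun x => ?_⟩
    by_cases hx : x ∈ Icc (b + 2 * h) (b + 4 * h)
    · exact hD x hx
    · rw [deriv_eq_zero_of_forall_mem_eq_zero hχs' (by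
        by_contra! h'
        exact hx ⟨h'.1, h'.2⟩), abs_zero]
      exact (norm_nonneg _).trans (hD (b + 3 * h) (by constructor <;> linarith))
  have hD₁0 : 0 ≤ D₁ := (abs_nonneg _).trans (hD₁ 0)
  have hD₂0 : 0 ≤ D₂ := (abs_nonneg _).trans (hD₂ 0)
  set Cc := M * bβ / (m * bχ) with hCc
  have hCc0 : 0 ≤ Cc := by positivity
  refine ⟨D₁ + Cc * D₂, m * bβ, by positivity, by positivity, fun η hη hηh => ?_⟩
  let I : ℝ → ℝ := fun u => ∫ s in A..B, W (u, s) * (η⁻¹ * β ((s - u) / η))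
  let J : ℝ → ℝ := fun u => ∫ s in A..B, W (u, s) * χ s
  have hIc : Continuous I := by
    refine intervalIntegral.continuous_parametric_intervalIntegral_of_continuous' ?_ A B
    unfold Function.uncurry
    fun_prop
  have hJc : Continuous J := by
    refine intervalIntegral.continuous_parametric_intervalIntegral_of_continuous' ?_ A B
    unfold Function.uncurry
    fun_prop
  have hIle : ∀ u, I u ≤ M * bβ := by
    intro u
    have h1 : I u ≤ ∫ s in A..B, M * (η⁻¹ * β ((s - u) / η)) := by
      refine intervalIntegral.integral_mono_on (by linarith)
        (Continuous.intervalIntegrable (by fun_prop) _ _)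
        (Continuous.intervalIntegrable (by fun_prop) _ _) fun s _ => ?_
      have := hβ0 ((s - u) / η)
      have := hWM (u, s)
      gcongr
    rw [intervalIntegral.integral_const_mul, integral_rescale β hη] at h1
    exact h1.trans (mul_le_mul_of_nonneg_left (hβle _ _ (by gcongr; linarith)) hM.le)
  have hI0 : ∀ u, 0 ≤ I u := fun u => intervalIntegral.integral_nonneg (by linarith) fun s _ =>
    mul_nonneg (hWpos _).le (mul_nonneg (by positivity) (hβ0 _))
  have hJge : ∀ u, m * bχ ≤ J u := by
    intro u
    rw [hbχ, ← intervalIntegral.integral_const_mul]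
    refine intervalIntegral.integral_mono_on (by linarith)
      (Continuous.intervalIntegrable (by fun_prop) _ _)
      (Continuous.intervalIntegrable (by fun_prop) _ _) fun s _ => ?_
    have := hχ0 s
    have := hmW (u, s)
    gcongr
  have hJpos : ∀ u, 0 < J u := fun u => (by positivity : 0 < m * bχ).trans_le (hJge u)
  let c : ℝ → ℝ := fun u => I u / J u
  have hcc : Continuous c := hIc.div hJc fun u => (hJpos u).ne'
  have hc0 : ∀ u, 0 ≤ c u := fun u => div_nonneg (hI0 u) (hJpos u).le
  have hcle : ∀ u, c u ≤ Cc := fun u =>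
    div_le_div₀ (by positivity) (hIle u) (by positivity) (hJge u)
  let G : ℝ × ℝ → ℝ := fun p => η⁻¹ * β ((p.2 - p.1) / η) - c p.1 * χ p.2
  have hGc : Continuous G := by fun_prop
  let E : ℝ × ℝ → ℝ := fun p => ∫ s in A..p.2, W (p.1, s) * G (p.1, s)
  have hWG : ∀ u, Continuous fun s => W (u, s) * G (u, s) := fun u => by fun_prop
  have hEc : Continuous E := by
    refine intervalIntegral.continuous_parametric_intervalIntegral_of_continuous
      (f := fun (p : ℝ × ℝ) s => W (p.1, s) * G (p.1, s)) ?_ continuous_snd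
    unfold Function.uncurry
    fun_prop
  have hEB : ∀ u, E (u, B) = 0 := by
    intro u
    have h1 : E (u, B) = I u - c u * J u := by
      simp only [E, G, I, J]
      rw [← intervalIntegral.integral_const_mul, ← intervalIntegral.integral_sub
        (Continuous.intervalIntegrable (by fun_prop) _ _)
        (Continuous.intervalIntegrable (by fun_prop) _ _)]
      refine intervalIntegral.integral_congr fun s _ => ?_
      ring
    rw [h1, div_mul_cancel₀ _ (hJpos u).ne', sub_self]
  have hEsub : ∀ u v, E (u, v) = -∫ s in v..B, W (u, s) * G (u, s) := by
    intro u v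
    have h1 := hEB u
    simp only [E] at h1 ⊢
    rw [← intervalIntegral.integral_add_adjacent_intervals
      ((hWG u).intervalIntegrable A v) ((hWG u).intervalIntegrable v B)] at h1
    linarith
  have hβz : ∀ u s, s ≤ u + η ∨ u + 2 * η ≤ s → β ((s - u) / η) = 0 := by
    intro u s hs
    by_contra hne
    obtain ⟨h1, h2⟩ := hβs' _ hne
    rw [lt_div_iff₀ hη] at h1
    rw [div_lt_iff₀ hη] at h2
    rcases hs with hs | hs <;> linarith
  have hχz : ∀ s, s ≤ b + 2 * h ∨ b + 4 * h ≤ s → χ s = 0 := by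
    intro s hs
    by_contra hne
    have := hχs' s hne
    rcases hs with hs | hs <;> linarith [this.1, this.2]
  -- below the support of `G` the primitive `E` vanishes
  have hElow : ∀ u v, A < u → u < b + h → v ≤ u + η → E (u, v) = 0 := by
    intro u v h1 h2 h3
    refine intervalIntegral.integral_zero_ae (Eventually.of_forall fun s hs => ?_)
    have hs' : s ≤ u + η := hs.2.trans (max_le (by linarith) h3)
    simp only [G]
    rw [hβz u s (Or.inl hs'), hχz s (Or.inl (by linarith))]
    ring
  have hEhigh : ∀ u v, u < b + h → b + 4 * h ≤ v → E (u, v) = 0 := by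
    intro u v h2 h3
    rw [hEsub, neg_eq_zero]
    refine intervalIntegral.integral_zero_ae (Eventually.of_forall fun s hs => ?_)
    have hs' : b + 4 * h ≤ s := (le_min h3 hB.le).trans hs.1.le
    simp only [G]
    rw [hβz u s (Or.inr (by linarith)), hχz s (Or.inr hs')]
    ring
  have hEmid : ∀ u v, v ≤ b + 2 * h → A ≤ v →
      E (u, v) = ∫ s in A..v, W (u, s) * (η⁻¹ * β ((s - u) / η)) := by
    intro u v h1 h2
    refine intervalIntegral.integral_congr fun s hs => ?_
    rw [uIcc_of_le h2] at hs
    simp only [G]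
    rw [hχz s (Or.inl (hs.2.trans h1))]
    ring
  have hE0 : ∀ u v, A < u → u < b + h → 0 ≤ E (u, v) := by
    intro u v h1 h2
    rcases le_or_gt v (u + η) with h3 | h3
    · exact (hElow u v h1 h2 h3).ge
    rcases le_or_gt v (b + 2 * h) with h4 | h4
    · rw [hEmid u v h4 (by linarith)]
      exact intervalIntegral.integral_nonneg (by linarith) fun s _ =>
        mul_nonneg (hWpos _).le (mul_nonneg (by positivity) (hβ0 _))
    rcases le_or_gt (b + 4 * h) v with h5 | h5
    · exact (hEhigh u v h2 h5).ge
    rw [hEsub, ← intervalIntegral.integral_neg]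
    refine intervalIntegral.integral_nonneg (by linarith) fun s hs => ?_
    simp only [G]
    rw [hβz u s (Or.inr (by linarith [hs.1])), mul_zero, zero_sub, mul_neg, neg_neg]
    exact mul_nonneg (hWpos _).le (mul_nonneg (hc0 u) (hχ0 s))
  have hβ' : Continuous (deriv β) := hβ.continuous_deriv (by simp)
  have hχ' : Continuous (deriv χ) := hχ.continuous_deriv (by simp)
  refine ⟨fun p => α p.1 * G p, fun p => α p.1 * (η⁻¹ * (deriv β ((p.2 - p.1) / η) * η⁻¹) -
    c p.1 * deriv χ p.2), fun p => α p.1 * E p, by fun_prop, by fun_prop, by fun_prop,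
    fun p => ?_, fun p => ?_, fun p hp => ?_, fun p => ?_, fun u v huv => ?_, fun u v => ?_,
    fun u w hu huw hw => ?_⟩
  · have h1 : HasDerivAt (fun s => (s - p.1) / η) η⁻¹ p.2 := by
      simpa using ((hasDerivAt_id p.2).sub_const p.1).div_const η
    have h2 := (hβ.differentiable (by simp) ((p.2 - p.1) / η)).hasDerivAt.comp p.2 h1
    have h3 := (hχ.differentiable (by simp) p.2).hasDerivAt
    exact ((h2.const_mul η⁻¹).sub (h3.const_mul (c p.1))).const_mul (α p.1)
  · have h1 : HasDerivAt (fun v => E (p.1, v)) (W p * G p) p.2 :=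
      intervalIntegral.integral_hasDerivAt_right ((hWG p.1).intervalIntegrable _ _)
        ((hWG p.1).stronglyMeasurableAtFilter _ _) (hWG p.1).continuousAt
    exact (h1.const_mul (α p.1)).congr_deriv (by ring)
  · by_cases hα' : α p.1 = 0
    · simp [hα']
    obtain ⟨h1, h2⟩ := hαs' _ hα'
    have h3 : p.2 < p.1 + η ∨ b + 4 * h < p.2 := by
      by_contra! h3
      exact hp ⟨h1.le, h2.le, h3.1, h3.2⟩
    constructor
    · have hG : G p = 0 := by
        simp only [G]
        rcases h3 with h3 | h3
        · rw [hβz _ _ (Or.inl h3.le), hχz _ (Or.inl (by linarith))]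
          ring
        · rw [hβz _ _ (Or.inr (by linarith)), hχz _ (Or.inr h3.le)]
          ring
      simp only [hG, mul_zero]
    · have hE : E p = 0 := by
        rcases h3 with h3 | h3
        · exact hElow p.1 p.2 (by linarith) h2 h3.le
        · exact hEhigh p.1 p.2 h2 h3.le
      simp only [hE, mul_zero]
  · by_cases hα' : α p.1 = 0
    · simp [hα']
    obtain ⟨h1, h2⟩ := hαs' _ hα'
    exact mul_nonneg (hα0 _) (hE0 p.1 p.2 (by linarith) h2)
  · have hz : deriv β ((v - u) / η) = 0 := by
      refine deriv_eq_zero_of_forall_mem_eq_zero hβs' ?_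
      by_cases h1 : u + η ≤ v
      · right
        rw [lt_div_iff₀ hη]
        linarith [huv h1]
      · left
        rw [div_lt_iff₀ hη]
        linarith
    simp only [hz, zero_mul, mul_zero, zero_sub, mul_neg, abs_neg]
    rw [abs_mul, abs_mul, abs_of_nonneg (hα0 u), abs_of_nonneg (hc0 u)]
    have h1 : c u * |deriv χ v| ≤ Cc * D₂ := mul_le_mul (hcle u) (hD₂ v) (abs_nonneg _) hCc0
    have h2 : 0 ≤ c u * |deriv χ v| := mul_nonneg (hc0 u) (abs_nonneg _)
    nlinarith [hα0 u, hα1 u]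
  · simp only
    rw [abs_mul, abs_of_nonneg (hα0 u)]
    have h1 : |c u * deriv χ v| ≤ Cc * D₂ := by
      rw [abs_mul, abs_of_nonneg (hc0 u)]
      exact mul_le_mul (hcle u) (hD₂ v) (abs_nonneg _) hCc0
    have h2 : |η⁻¹ * (deriv β ((v - u) / η) * η⁻¹)| ≤ D₁ * η⁻¹ ^ 2 := by
      rw [abs_mul, abs_mul, abs_of_nonneg (inv_nonneg.2 hη.le)]
      calc _ = |deriv β ((v - u) / η)| * η⁻¹ ^ 2 := by ring
        _ ≤ _ := by gcongr; exact hD₁ _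
    have h3 := abs_sub (η⁻¹ * (deriv β ((v - u) / η) * η⁻¹)) (c u * deriv χ v)
    have h4 : 0 ≤ Cc * D₂ * η⁻¹ ^ 2 := by positivity
    have h5 := abs_nonneg (η⁻¹ * (deriv β ((v - u) / η) * η⁻¹) - c u * deriv χ v)
    nlinarith [hα0 u, hα1 u]
  · have e1 : α u = 1 := hαone u ⟨hu, by linarith⟩
    have e2 : m * bβ ≤ E (u, w) := by
      rw [hEmid u w (by linarith) (by linarith)]
      have h1 : ∫ s in A..w, m * (η⁻¹ * β ((s - u) / η)) ≤
          ∫ s in A..w, W (u, s) * (η⁻¹ * β ((s - u) / η)) := by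
        refine intervalIntegral.integral_mono_on (by linarith)
          (Continuous.intervalIntegrable (by fun_prop) _ _)
          (Continuous.intervalIntegrable (by fun_prop) _ _) fun s _ => ?_
        have := hβ0 ((s - u) / η)
        have := hmW (u, s)
        gcongr
      refine le_trans ?_ h1
      rw [intervalIntegral.integral_const_mul, integral_rescale β hη]
      refine mul_le_mul_of_nonneg_left ?_ hm.le
      refine intervalIntegral.integral_mono_interval ?_ (by norm_num) ?_
        (Eventually.of_forall hβ0) (hβi _ _)
      · rw [div_le_iff₀ hη]
        linarith
      · rw [le_div_iff₀ hη]
        linarith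
    simp only [e1, one_mul]
    exact e2

theorem strip_subset_triangle {A B a b c η : ℝ} (hA : A < a) (hB : c < B) (hη : 0 < η) :
    strip a b c η ⊆ triangle A B := by
  rintro ⟨x, y⟩ ⟨h1, _, h3, h4⟩
  simp only at h1 h3 h4
  exact ⟨by simp only; linarith, by simp only; linarith, by simp only; linarith⟩

/-- Near a segment of the axis on which `r ≤ c (v - u)`, the constraint equation forces the incoming
dust to vanish: the test functions of `exists_test_pair` bound the integral of `μ(dv) du / (v - u)`
over `v - u > 2η` uniformly in `η`, but it grows like `log (1/η)` if `μ` does not vanish. -/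
theorem measure_Ioo_eq_zero {A B m M c : ℝ} {r W : ℝ × ℝ → ℝ} (hr : Continuous r)
    (hW : Continuous W) (hm : 0 < m) (hmW : ∀ p, m ≤ W p) (hWM : ∀ p, W p ≤ M) (hc : 0 < c)
    (hpos : ∀ p ∈ triangle A B, 0 < r p) (hle : ∀ p ∈ triangle A B, r p ≤ c * (p.2 - p.1))
    {μ₁ μ₂ : Measure (ℝ × ℝ)} {μ : Measure ℝ} [IsFiniteMeasure μ]
    (h₁ : IsRadonOn (triangle A B) μ₁) (h₂ : IsRadonOn (triangle A B) μ₂)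
    (hr_v : ∀ φ, IsTestFunction (triangle A B) φ →
      ∫ p, r p * pv φ p = -(∫ p, φ p ∂μ₁ - ∫ p, φ p ∂μ₂))
    (hcon : ∀ φ, IsTestFunction (triangle A B) φ →
      ∫ p, (W p)⁻¹ * pv φ p ∂μ₁ - ∫ p, (W p)⁻¹ * pv φ p ∂μ₂ =
        4 * Real.pi * ∫ p, (r p)⁻¹ * (W p)⁻¹ * φ p ∂((volume : Measure ℝ).prod μ))
    {a b : ℝ} (hA : A < a) (hab : a < b) (hB : b < B) : μ (Ioo a b) = 0 := by
  have hM : 0 < M := hm.trans_le ((hmW 0).trans (hWM 0))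
  have hWpos : ∀ p, 0 < W p := fun p => hm.trans_le (hmW p)
  obtain ⟨h, hh, hhA, hhB⟩ : ∃ h, 0 < h ∧ A < a - 2 * h ∧ b + 4 * h < B :=
    ⟨min (a - A) (B - b) / 8, by
      have : 0 < min (a - A) (B - b) := lt_min (by linarith) (by linarith)
      positivity, by linarith [min_le_left (a - A) (B - b)],
      by linarith [min_le_right (a - A) (B - b)]⟩
  obtain ⟨C, κ, hC, hκ, H⟩ := exists_test_pair hW hm hmW hWM hab hh hhA hhB
  set L := (2 * c * C + (B - A) * (c * (B - A) * (2 * C))) * (B - A) with hL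
  have hσ : IsRadonOn (triangle A B) ((volume : Measure ℝ).prod μ) :=
    fun K _ hK => hK.measure_lt_top
  have hind : ∀ x y k : ℝ, Integrable ((Icc x y).indicator fun _ => k) (volume : Measure ℝ) :=
    fun x y k => (integrable_indicator_iff measurableSet_Icc).2 (integrableOn_const (by simp))
  -- the estimate at scale `η`
  have main : ∀ η, 0 < η → 2 * η ≤ h →
      4 * Real.pi * (κ / (c * M) * Real.log (h / (2 * η)) * μ.real (Ioo a b)) ≤ L := by
    intro η hη hηh
    obtain ⟨ψ, ψ', Φ, hψ, hψ', hΦ, hdψ, hdΦ, hz, hΦ0, hb₁, hb₂, hΦκ⟩ := H η hη hηh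
    have hK := isCompact_strip (a := a - 2 * h) (b := b + h) (c := b + 4 * h) hη.le
    have hKS : strip (a - 2 * h) (b + h) (b + 4 * h) η ⊆ triangle A B :=
      strip_subset_triangle hhA hhB hη
    have hsψ : tsupport ψ ⊆ strip (a - 2 * h) (b + h) (b + 4 * h) η :=
      closure_minimal (fun p hp => by
        by_contra h'
        exact hp (hz p h').1) hK.isClosed
    have hsΦ : tsupport Φ ⊆ strip (a - 2 * h) (b + h) (b + 4 * h) η :=
      closure_minimal (fun p hp => by
        by_contra h'
        exact hp (hz p h').2) hK.isClosed
    have key := weakConstraint_of_primitive (isOpen_triangle A B) hr.continuousOn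
      (fun p hp => (hpos p hp).ne') hW.continuousOn (fun p => (hWpos p).ne') h₁ h₂ hσ hr_v hcon
      hψ hψ' hΦ (hW.mul hψ) hdψ hdΦ (hK.of_isClosed_subset (isClosed_tsupport _) hsψ)
      (hsψ.trans hKS) (hK.of_isClosed_subset (isClosed_tsupport _) hsΦ) (hsΦ.trans hKS)
    have hψ'z : ∀ p ∉ strip (a - 2 * h) (b + h) (b + 4 * h) η, ψ' p = 0 := fun p hp =>
      deriv_eq_zero_of_notMem_tsupport hdψ fun h' => hp (hsψ h')
    have lhs : |∫ p, r p * ψ' p| ≤ L := by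
      have hi : Integrable fun p => r p * ψ' p :=
        (hr.mul hψ').integrable_of_hasCompactSupport
          (HasCompactSupport.intro hK fun p hp => hψ'z p hp).mul_left
      rw [Measure.volume_eq_prod] at hi ⊢
      rw [integral_prod _ hi]
      have inner : ∀ u, |∫ v, r (u, v) * ψ' (u, v)| ≤
          (Icc A B).indicator (fun _ => 2 * c * C + (B - A) * (c * (B - A) * (2 * C))) u := by
        intro u
        by_cases hu : u ∈ Icc A B
        · rw [indicator_of_mem hu]
          have hg : Integrable fun v => (Icc (u + η) (u + 2 * η)).indicator
              (fun _ => 2 * c * η * (C * η⁻¹ ^ 2)) v + (Icc A B).indicator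
              (fun _ => c * (B - A) * (2 * C)) v :=
            (hind _ _ _).add (hind _ _ _)
          have h3 := norm_integral_le_of_norm_le (f := fun v => r (u, v) * ψ' (u, v)) hg
            (Eventually.of_forall fun v => by
              by_cases hp : (u, v) ∈ strip (a - 2 * h) (b + h) (b + 4 * h) η
              · have hS := hKS hp
                have hr0 := hpos _ hS
                have hr1 := hle _ hS
                obtain ⟨g1, g2, g3⟩ := hS
                simp only at g1 g2 g3 hr1
                rw [indicator_of_mem (s := Icc A B) ⟨by linarith, by linarith⟩, norm_mul,
                  Real.norm_of_nonneg hr0.le]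
                have hr2 : r (u, v) ≤ c * (B - A) :=
                  hr1.trans (mul_le_mul_of_nonneg_left (by linarith) hc.le)
                have p1 : 0 ≤ c * (B - A) := mul_nonneg hc.le (by linarith)
                by_cases hv : v ∈ Icc (u + η) (u + 2 * η)
                · rw [indicator_of_mem hv]
                  have hr3 : r (u, v) ≤ 2 * c * η := by nlinarith [hv.2]
                  calc r (u, v) * ‖ψ' (u, v)‖ ≤ r (u, v) * (C * η⁻¹ ^ 2 + C) :=
                        mul_le_mul_of_nonneg_left (hb₂ u v) hr0.le
                    _ = r (u, v) * (C * η⁻¹ ^ 2) + r (u, v) * C := by ring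
                    _ ≤ 2 * c * η * (C * η⁻¹ ^ 2) + c * (B - A) * C := by gcongr
                    _ ≤ _ := by nlinarith [mul_nonneg p1 hC]
                · rw [indicator_of_notMem hv, zero_add]
                  have h5 := hb₁ u v fun h6 => by
                    by_contra! h7
                    exact hv ⟨h6, h7⟩
                  calc r (u, v) * ‖ψ' (u, v)‖ ≤ c * (B - A) * C :=
                        mul_le_mul hr2 h5 (norm_nonneg _) p1
                    _ ≤ _ := by nlinarith [mul_nonneg p1 hC]
              · rw [hψ'z _ hp, mul_zero, norm_zero]
                have : 0 ≤ c * (B - A) := mul_nonneg hc.le (by linarith)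
                exact add_nonneg (indicator_nonneg (fun _ _ => by positivity) _)
                  (indicator_nonneg (fun _ _ => by positivity) _))
          refine h3.trans (le_of_eq ?_)
          rw [integral_add (hind _ _ _) (hind _ _ _), integral_indicator_const _ measurableSet_Icc,
            integral_indicator_const _ measurableSet_Icc, Real.volume_real_Icc_of_le (by linarith),
            Real.volume_real_Icc_of_le (by linarith), smul_eq_mul, smul_eq_mul]
          field_simp
          ring
        · rw [indicator_of_notMem hu]
          have : ∀ v, r (u, v) * ψ' (u, v) = 0 := fun v => by
            rw [hψ'z (u, v) fun hp => hu ?_, mul_zero]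
            have hS := hKS hp
            exact ⟨hS.1.le, (hS.2.1.trans hS.2.2).le⟩
          simp [this]
      have h6 := norm_integral_le_of_norm_le
        (f := fun u => ∫ v, r (u, v) * ψ' (u, v)) (hind A B _) (Eventually.of_forall inner)
      rw [integral_indicator_const _ measurableSet_Icc, Real.volume_real_Icc_of_le (by linarith),
        smul_eq_mul] at h6
      rw [hL, mul_comm]
      exact h6
    let f : ℝ × ℝ → ℝ := fun p => (r p)⁻¹ * (W p)⁻¹ * Φ p
    have hfz : ∀ p ∉ strip (a - 2 * h) (b + h) (b + 4 * h) η, f p = 0 := fun p hp => by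
      simp only [f, (hz p hp).2, mul_zero]
    have hf0 : ∀ p, 0 ≤ f p := fun p => by
      by_cases hp : p ∈ strip (a - 2 * h) (b + h) (b + 4 * h) η
      · have := hpos p (hKS hp)
        have := hWpos p
        have := hΦ0 p
        positivity
      · exact (hfz p hp).ge
    have hfc : Continuous f := by
      rw [continuous_iff_continuousAt]
      intro p
      by_cases hp : p ∈ triangle A B
      · exact ((hr.continuousAt.inv₀ (hpos p hp).ne').mul
          (hW.continuousAt.inv₀ (hWpos p).ne')).mul hΦ.continuousAt
      · have h3 : f =ᶠ[𝓝 p] fun _ => 0 := by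
          filter_upwards [hK.isClosed.isOpen_compl.mem_nhds fun h' => hp (hKS h')] with q hq
          exact hfz q hq
        exact continuousAt_const.congr h3.symm
    have hfi : ∀ (ν : Measure (ℝ × ℝ)) [IsFiniteMeasureOnCompacts ν], Integrable f ν := fun ν _ =>
      hfc.integrable_of_hasCompactSupport (HasCompactSupport.intro hK hfz)
    have rhs : κ / (c * M) * Real.log (h / (2 * η)) * μ.real (Ioo a b) ≤
        ∫ p, f p ∂((volume : Measure ℝ).prod μ) := by
      have hfi' := hfi ((volume : Measure ℝ).prod μ)
      rw [integral_prod_symm _ hfi', mul_comm, ← smul_eq_mul, ← setIntegral_const]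
      refine (setIntegral_mono_on (integrableOn_const (by simp))
        hfi'.integral_prod_right.integrableOn measurableSet_Ioo fun w hw => ?_).trans
        (setIntegral_le_integral hfi'.integral_prod_right (Eventually.of_forall fun w =>
          integral_nonneg fun u => hf0 _))
      have hw1 := hw.1
      have hw2 := hw.2
      have hfw : Integrable fun u => f (u, w) := by
        refine Continuous.integrable_of_hasCompactSupport (by fun_prop)
          (HasCompactSupport.intro (isCompact_Icc (a := A) (b := B)) fun u hu =>
            hfz _ fun hp => hu ?_)
        have hS := hKS hp
        exact ⟨hS.1.le, (hS.2.1.trans hS.2.2).le⟩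
      have hlow : ∫ u in (a - h)..(w - 2 * η), κ / (c * M) * (w - u)⁻¹ ≤ ∫ u, f (u, w) := by
        rw [intervalIntegral.integral_of_le (by linarith), ← integral_Icc_eq_integral_Ioc]
        refine (setIntegral_mono_on ?_ hfw.integrableOn measurableSet_Icc fun u hu => ?_).trans
          (setIntegral_le_integral hfw (Eventually.of_forall fun u => hf0 _))
        · refine ContinuousOn.integrableOn_Icc (continuousOn_const.mul (ContinuousOn.inv₀
            (by fun_prop) fun u hu => ?_))
          linarith [hu.2]
        · have h7 := hΦκ u w hu.1 (by linarith [hu.2]) hw2.le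
          have hS : (u, w) ∈ triangle A B :=
            ⟨by simp only; linarith [hu.1], by simp only; linarith [hu.2], by simp only; linarith⟩
          have h8 := hle _ hS
          have h9 := hpos _ hS
          have h10 := hWM (u, w)
          have h11 := hWpos (u, w)
          have h12 : 0 < w - u := by linarith [hu.2]
          simp only at h8
          calc κ / (c * M) * (w - u)⁻¹ = (c * (w - u))⁻¹ * M⁻¹ * κ := by
                field_simp
            _ ≤ (r (u, w))⁻¹ * (W (u, w))⁻¹ * Φ (u, w) := by gcongr
      refine le_trans ?_ hlow
      rw [intervalIntegral.integral_const_mul,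
        intervalIntegral.integral_comp_sub_left (fun x => x⁻¹) w,
        integral_inv_of_pos (by linarith) (by linarith)]
      refine mul_le_mul_of_nonneg_left (Real.log_le_log (by positivity) ?_) (by positivity)
      rw [sub_sub_cancel]
      gcongr
      linarith
    have hL' := (abs_le.1 lhs).1
    calc _ ≤ 4 * Real.pi * ∫ p, f p ∂((volume : Measure ℝ).prod μ) := by
          have := Real.pi_pos
          gcongr
      _ = -∫ p, r p * ψ' p := key.symm
      _ ≤ L := by linarith
  by_contra hne
  have hμ : 0 < μ.real (Ioo a b) :=
    (ENNReal.toReal_pos hne (measure_ne_top _ _))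
  set X := 4 * Real.pi * (κ / (c * M)) * μ.real (Ioo a b) with hX
  have hXpos : 0 < X := by
    have := Real.pi_pos
    positivity
  have hL0 : 0 ≤ L := by
    have : 0 ≤ B - A := by linarith
    positivity
  -- at the scale `η` with `log (h / 2η) = (L + 1) / X` the estimate fails
  have := main (h / 2 * Real.exp (-((L + 1) / X))) (by positivity) (by
    have : Real.exp (-((L + 1) / X)) ≤ 1 := Real.exp_le_one_iff.2 (by
      have : 0 ≤ (L + 1) / X := by positivity
      linarith)
    nlinarith)
  rw [show h / (2 * (h / 2 * Real.exp (-((L + 1) / X)))) = Real.exp ((L + 1) / X) by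
    rw [Real.exp_neg]
    field_simp, Real.log_exp] at this
  have h2 : 4 * Real.pi * (κ / (c * M) * ((L + 1) / X) * μ.real (Ioo a b)) = L + 1 := by
    calc _ = X * ((L + 1) / X) := by rw [hX]; ring
      _ = L + 1 := by field_simp
  linarith

theorem triangle_mono {A B A' B' : ℝ} (hA : A' ≤ A) (hB : B ≤ B') :
    triangle A B ⊆ triangle A' B' := fun _ hp => ⟨hA.trans_lt hp.1, hp.2.1, hp.2.2.trans_le hB⟩

theorem triangle_subset_ball (a d : ℝ) : triangle (a - d) (a + d) ⊆ Metric.ball (a, a) d := by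
  rintro ⟨x, y⟩ ⟨h1, h2, h3⟩
  simp only at h1 h2 h3
  rw [← ball_prod_same, Real.ball_eq_Ioo]
  exact ⟨⟨h1, by linarith⟩, by linarith, h3⟩

/-- In a weak solution with `r = 0` on a segment of the axis `{u = v}` and with continuous, positive
`Ω²` up to the axis, there is no incoming dust near that segment. -/
theorem IsWeakSolution.exists_measure_Ioo_eq_zero {Λ : ℝ} {D Γ : Set (ℝ × ℝ)} {r W : ℝ × ℝ → ℝ}
    {τ τb : Measure (ℝ × ℝ)} (hsol : IsWeakSolution Λ D r W τ τb) {a d : ℝ} (hd : 0 < d)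
    (hD : triangle (a - d) (a + d) ⊆ D) (hΓ : ∀ w ∈ Ioo (a - d) (a + d), (w, w) ∈ Γ)
    (hrc : ContinuousOn r (D ∪ Γ)) (hWc : ContinuousOn W (D ∪ Γ)) (hr0 : ∀ p ∈ Γ, r p = 0)
    (hW0 : ∀ p ∈ D ∪ Γ, W p ≠ 0) {μ : Measure ℝ} [IsFiniteMeasure μ]
    (hτb : τb.restrict (D ∩ Metric.ball (a, a) d) =
      ((volume : Measure ℝ).prod μ).restrict (D ∩ Metric.ball (a, a) d)) :
    ∃ d' > 0, d' ≤ d ∧ μ (Ioo (a - d') (a + d')) = 0 := by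
  have haΓ : (a, a) ∈ Γ := hΓ a ⟨by linarith, by linarith⟩
  have haD : (a, a) ∈ D ∪ Γ := Or.inr haΓ
  set w₀ := W (a, a) with hw₀
  have hw₀pos : 0 < w₀ := by
    refine lt_of_le_of_ne ?_ (hW0 _ haD).symm
    have h1 : Tendsto (fun t : ℝ => (a - t, a + t)) (𝓝[>] 0) (𝓝[D ∪ Γ] (a, a)) := by
      refine tendsto_nhdsWithin_iff.2 ⟨?_, ?_⟩
      · have : Continuous fun t : ℝ => (a - t, a + t) := by fun_prop
        have h2 := this.tendsto 0
        simp only [sub_zero, add_zero] at h2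
        exact h2.mono_left nhdsWithin_le_nhds
      · filter_upwards [Ioo_mem_nhdsGT hd] with t ht
        exact Or.inl (hD ⟨by simp only; linarith [ht.2], by simp only; linarith [ht.1],
          by simp only; linarith [ht.2]⟩)
    refine ge_of_tendsto ((hWc _ haD).tendsto.comp h1) ?_
    filter_upwards [Ioo_mem_nhdsGT hd] with t ht
    exact (hsol.W_pos _ (hD ⟨by simp only; linarith [ht.2], by simp only; linarith [ht.1],
      by simp only; linarith [ht.2]⟩)).le
  set m := w₀ * Real.exp (-(1 / 200)) with hm
  set M := w₀ * Real.exp (1 / 200) with hM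
  have hmpos : 0 < m := by positivity
  have hMpos : 0 < M := by positivity
  have hmw : m < w₀ := by
    have : Real.exp (-(1 / 200)) < 1 := Real.exp_lt_one_iff.2 (by norm_num)
    nlinarith
  have hwM : w₀ < M := by
    have : 1 < Real.exp (1 / 200) := Real.one_lt_exp_iff.2 (by norm_num)
    nlinarith
  have hosc : Real.log M - Real.log m ≤ 1 / 100 := by
    rw [hM, hm, Real.log_mul hw₀pos.ne' (Real.exp_pos _).ne', Real.log_mul hw₀pos.ne'
      (Real.exp_pos _).ne', Real.log_exp, Real.log_exp]
    linarith
  obtain ⟨ρ, hρ, hball⟩ : ∃ ρ > 0, ∀ p ∈ D ∪ Γ, p ∈ Metric.ball (a, a) ρ →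
      (m ≤ W p ∧ W p ≤ M) ∧ |Λ * r p ^ 2| ≤ 1 / 2 := by
    have e1 : ∀ᶠ p in 𝓝[D ∪ Γ] (a, a), W p ∈ Ioo m M :=
      (hWc _ haD).tendsto (Ioo_mem_nhds hmw hwM)
    have e2 : ∀ᶠ p in 𝓝[D ∪ Γ] (a, a), |Λ * r p ^ 2| < 1 / 2 := by
      have : ContinuousWithinAt (fun p => |Λ * r p ^ 2|) (D ∪ Γ) (a, a) :=
        (((hrc _ haD).pow 2).const_mul Λ).abs
      refine this.tendsto.eventually_lt_const ?_
      simp [hr0 _ haΓ]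
    obtain ⟨ρ, hρ, h⟩ := Metric.mem_nhdsWithin_iff.1 (e1.and e2)
    exact ⟨ρ, hρ, fun p hp hpb => ⟨⟨(h ⟨hpb, hp⟩).1.1.le, (h ⟨hpb, hp⟩).1.2.le⟩,
      (h ⟨hpb, hp⟩).2.le⟩⟩
  obtain ⟨e, he, heρ, hed⟩ : ∃ e, 0 < e ∧ e < ρ ∧ e < d :=
    ⟨min ρ d / 2, by positivity, by linarith [min_le_left ρ d], by linarith [min_le_right ρ d]⟩
  -- a retraction of the plane onto the closed triangle
  let k : ℝ → ℝ := fun x => max (a - e) (min (a + e) x)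
  let R : ℝ × ℝ → ℝ × ℝ := fun p => (k p.1, max (k p.1) (k p.2))
  have hk1 : ∀ x, a - e ≤ k x := fun x => le_max_left _ _
  have hk2 : ∀ x, k x ≤ a + e := fun x => max_le (by linarith) (min_le_left _ _)
  have hkid : ∀ x, a - e ≤ x → x ≤ a + e → k x = x := fun x h1 h2 => by simp [k, h1, h2]
  have hRc : Continuous R := by fun_prop
  have hRm : ∀ p, R p ∈ D ∪ Γ := by
    intro p
    rcases (le_max_left (k p.1) (k p.2)).eq_or_lt with h | h
    · right
      have : R p = (k p.1, k p.1) := Prod.ext rfl h.symm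
      rw [this]
      exact hΓ _ ⟨by linarith [hk1 p.1], by linarith [hk2 p.1]⟩
    · left
      exact hD ⟨by simp only [R]; linarith [hk1 p.1], h,
        by simp only [R]; exact max_lt (by linarith [hk2 p.1]) (by linarith [hk2 p.2])⟩
  have hRb : ∀ p, R p ∈ Metric.ball (a, a) ρ := by
    intro p
    rw [← ball_prod_same, Real.ball_eq_Ioo]
    refine ⟨⟨by linarith [hk1 p.1], by linarith [hk2 p.1]⟩, ?_, ?_⟩
    · exact lt_of_lt_of_le (by linarith [hk1 p.1]) (le_max_left _ _)
    · exact max_lt (by linarith [hk2 p.1]) (by linarith [hk2 p.2])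
  set T := triangle (a - e) (a + e) with hT
  have hTd : T ⊆ triangle (a - d) (a + d) := triangle_mono (by linarith) (by linarith)
  have hTD : T ⊆ D := hTd.trans hD
  have hRid : ∀ p ∈ T, R p = p := by
    rintro ⟨x, y⟩ ⟨h1, h2, h3⟩
    simp only at h1 h2 h3
    simp only [R]
    rw [hkid x h1.le (by linarith), hkid y (by linarith) h3.le, max_eq_right h2.le]
  have hr' : Continuous (r ∘ R) := hrc.comp_continuous hRc hRm
  have hW' : Continuous (W ∘ R) := hWc.comp_continuous hRc hRm
  have test : ∀ {φ}, IsTestFunction T φ → IsTestFunction D φ := fun h =>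
    ⟨h.1, h.2.1, h.2.2.trans hTD⟩
  have z0 : ∀ {φ}, IsTestFunction T φ → ∀ p ∉ T, φ p = 0 := fun h p hp =>
    image_eq_zero_of_notMem_tsupport fun h' => hp (h.2.2 h')
  have z1 : ∀ {φ}, IsTestFunction T φ → ∀ p ∉ T, pv φ p = 0 := fun h p hp =>
    image_eq_zero_of_notMem_tsupport fun h' => hp (h.2.2 (tsupport_pv_subset _ h'))
  have s2 : ∀ φ, tsupport (pu (pv φ)) ⊆ tsupport φ := fun φ => by
    refine (closure_mono fun q hq => ?_).trans ((tsupport_fderiv_subset ℝ (f := pv φ)).trans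
      (tsupport_pv_subset φ))
    intro h0
    exact hq (by simp [pu, h0])
  have z2 : ∀ {φ}, IsTestFunction T φ → ∀ p ∉ T, pu (pv φ) p = 0 := fun h p hp =>
    image_eq_zero_of_notMem_tsupport fun h' => hp (h.2.2 (s2 _ h'))
  -- integrals over `D` against functions supported in the triangle are integrals over the plane
  have full : ∀ (ν : Measure (ℝ × ℝ)) (f g : ℝ × ℝ → ℝ), (∀ p ∉ T, f p = 0) →
      (∀ p ∉ T, g p = 0) → (∀ p, R p = p → f p = g p) →
      ∫ p in D, f p ∂ν = ∫ p, g p ∂ν := by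
    intro ν f g hf hg hfg
    rw [setIntegral_eq_integral_of_forall_compl_eq_zero fun p hp => hf p fun h => hp (hTD h)]
    congr 1
    funext p
    by_cases hp : p ∈ T
    · exact hfg p (hRid p hp)
    · rw [hf p hp, hg p hp]
  have hpos : ∀ p ∈ T, 0 < (r ∘ R) p := fun p hp => by
    rw [Function.comp_apply, hRid p hp]
    exact hsol.r_pos p (hTD hp)
  have hsq : ∀ {x y : ℝ}, a - e < x → x ≤ y → y < a + e →
      (r ∘ R) (x, y) ^ 2 ≤ 45 * M * (y - x) ^ 2 := by
    refine fun {x y} h1 h2 h3 => radius_sq_le (Λ := Λ) hr' hW' hmpos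
      (fun p => (hball _ (hRm p) (hRb p)).1.1) (fun p => (hball _ (hRm p) (hRb p)).1.2) hosc
      (fun p => (hball _ (hRm p) (hRb p)).2) hpos ?_ ?_ ?_ h1 h2 h3
    · intro x h1 h2
      have : R (x, x) = (x, x) := by
        simp only [R]
        rw [hkid x h1.le h2.le, max_self]
      rw [Function.comp_apply, this]
      exact hr0 _ (hΓ x ⟨by linarith, by linarith⟩)
    · intro φ hφ
      have h1 := hsol.eq_r φ (test hφ)
      rwa [full volume _ (fun p => (r ∘ R) p ^ 2 * pu (pv φ) p)
          (fun p hp => by simp [z2 hφ p hp]) (fun p hp => by simp [z2 hφ p hp])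
          (fun p hp => by simp [hp]),
        full volume _ (fun p => -(1 / 2) * (1 - Λ * (r ∘ R) p ^ 2) * (W ∘ R) p * φ p)
          (fun p hp => by simp [z0 hφ p hp]) (fun p hp => by simp [z0 hφ p hp])
          (fun p hp => by simp [hp])] at h1
    · intro φ hφ
      have h1 := hsol.eq_W φ (test hφ)
      rw [full volume _ (fun p => Real.log ((W ∘ R) p) * pu (pv φ) p)
          (fun p hp => by simp [z2 hφ p hp]) (fun p hp => by simp [z2 hφ p hp])
          (fun p hp => by simp [hp]),
        full volume (fun p => Real.log (r p) * pu (pv φ) p)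
          (fun p => Real.log ((r ∘ R) p) * pu (pv φ) p)
          (fun p hp => by simp [z2 hφ p hp]) (fun p hp => by simp [z2 hφ p hp])
          (fun p hp => by simp [hp]),
        full volume _ (fun p => ((W ∘ R) p / (2 * (r ∘ R) p ^ 2) +
            1 / (2 * (r ∘ R) p ^ 2) * (-(1 / 2) * (1 - Λ * (r ∘ R) p ^ 2) * (W ∘ R) p)) * φ p)
          (fun p hp => by simp [z0 hφ p hp]) (fun p hp => by simp [z0 hφ p hp])
          (fun p hp => by simp [hp])] at h1
      have hc : Continuous (pu (pv φ)) := by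
        have e1 : ContDiff ℝ ∞ (pv φ) :=
          (hφ.1.fderiv_right (m := ∞) (by simp)).clm_apply contDiff_const
        exact (e1.continuous_fderiv (by simp)).clm_apply continuous_const
      have int : ∀ f : ℝ × ℝ → ℝ, ContinuousOn f T →
          Integrable fun p => f p * pu (pv φ) p := fun f hf => by
        have := ((hf.mono hφ.2.2).mul hc.continuousOn).integrableOn_compact (μ := volume) hφ.2.1
        refine this.integrable_of_forall_notMem_eq_zero fun p hp => ?_
        rw [Pi.mul_apply, image_eq_zero_of_notMem_tsupport fun h' => hp (s2 φ h'), mul_zero]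
      have i1 := int (fun p => Real.log ((W ∘ R) p)) (hW'.continuousOn.log fun p hp => by
        exact (hmpos.trans_le (hball _ (hRm p) (hRb p)).1.1).ne')
      have i2 := int (fun p => Real.log ((r ∘ R) p)) (hr'.continuousOn.log fun p hp =>
        (hpos p hp).ne')
      simp_rw [add_mul (Real.log ((W ∘ R) _))]
      rw [integral_add i1 i2, h1]
      ring
  obtain ⟨μ₁, μ₂, ⟨hμ₁, hμ₂, hder⟩, hcon⟩ := hsol.eq_vv
  have hc : 0 < Real.sqrt (45 * M) := Real.sqrt_pos.2 (by positivity)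
  refine ⟨e / 2, by positivity, by linarith, measure_Ioo_eq_zero (A := a - e) (B := a + e) hr' hW'
    hmpos (fun p => (hball _ (hRm p) (hRb p)).1.1) (fun p => (hball _ (hRm p) (hRb p)).1.2) hc hpos
    ?_ (fun K hK => hμ₁ K (hK.trans hTD)) (fun K hK => hμ₂ K (hK.trans hTD)) ?_ ?_
    (by linarith) (by linarith) (by linarith)⟩
  · rintro ⟨x, y⟩ hp
    refine le_of_sq_le_sq ?_ (mul_nonneg hc.le (sub_nonneg.2 hp.2.1.le))
    rw [mul_pow, Real.sq_sqrt (by positivity)]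
    exact hsq hp.1 hp.2.1.le hp.2.2
  · intro φ hφ
    have h1 := hder φ (test hφ)
    rwa [full volume _ (fun p => (r ∘ R) p * pv φ p)
        (fun p hp => by simp [z1 hφ p hp]) (fun p hp => by simp [z1 hφ p hp])
        (fun p hp => by simp [hp]),
      full μ₁ φ φ (z0 hφ) (z0 hφ) (fun _ _ => rfl),
      full μ₂ φ φ (z0 hφ) (z0 hφ) (fun _ _ => rfl)] at h1
  · intro φ hφ
    have h1 := hcon φ (test hφ)
    rw [full μ₁ _ (fun p => ((W ∘ R) p)⁻¹ * pv φ p)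
        (fun p hp => by simp [z1 hφ p hp]) (fun p hp => by simp [z1 hφ p hp])
        (fun p hp => by simp [hp]),
      full μ₂ _ (fun p => ((W ∘ R) p)⁻¹ * pv φ p)
        (fun p hp => by simp [z1 hφ p hp]) (fun p hp => by simp [z1 hφ p hp])
        (fun p hp => by simp [hp]),
      full τb _ (fun p => ((r ∘ R) p)⁻¹ * ((W ∘ R) p)⁻¹ * φ p)
        (fun p hp => by simp [z0 hφ p hp]) (fun p hp => by simp [z0 hφ p hp])
        (fun p hp => by simp [hp])] at h1
    have hsub : ∀ p ∉ D ∩ Metric.ball (a, a) d,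
        ((r ∘ R) p)⁻¹ * ((W ∘ R) p)⁻¹ * φ p = 0 := fun p hp => by
      rw [z0 hφ p fun h => hp ⟨hTD h, triangle_subset_ball a d (hTd h)⟩, mul_zero]
    rw [← setIntegral_eq_integral_of_forall_compl_eq_zero hsub, hτb,
      setIntegral_eq_integral_of_forall_compl_eq_zero hsub] at h1
    linarith

/-! ### The embedded development: axis and causal curves -/

section Geometry

variable {M : Type*} [TopologicalSpace M] [ChartedSpace E4 M] [IsManifold 𝓘(ℝ, E4) 1 M]

/-- Two timelike vectors are never orthogonal. -/
theorem LorentzMetric.ne_zero_of_timelike (g : LorentzMetric M) {x : M}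
    {X Y : TangentSpace 𝓘(ℝ, E4) x} (hX : g.val x X X < 0) (hY : g.val x Y Y < 0) :
    g.val x X Y ≠ 0 := by
  obtain ⟨b, hb⟩ := g.signature x
  have key : ∀ X Y : TangentSpace 𝓘(ℝ, E4) x, g.val x X Y =
      -(b.repr X 0 * b.repr Y 0) + b.repr X 1 * b.repr Y 1 + b.repr X 2 * b.repr Y 2 +
        b.repr X 3 * b.repr Y 3 := by
    intro X Y
    have h1 : g.val x X Y =
        g.val x (∑ i, b.repr X i • b i) (∑ i, b.repr Y i • b i) := by
      rw [b.sum_repr, b.sum_repr]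
    rw [h1]
    simp only [Fin.sum_univ_four, map_add, map_smul, add_apply, smul_apply, hb, smul_eq_mul]
    simp only [Fin.reduceEq, if_true, if_false]
    ring
  rw [key] at hX hY
  rw [key]
  intro h0
  generalize b.repr X 0 = x0, b.repr X 1 = x1, b.repr X 2 = x2, b.repr X 3 = x3,
    b.repr Y 0 = y0, b.repr Y 1 = y1, b.repr Y 2 = y2, b.repr Y 3 = y3 at *
  have e1 : x0 * y0 = x1 * y1 + x2 * y2 + x3 * y3 := by linarith
  have cs : (x1 * y1 + x2 * y2 + x3 * y3) ^ 2 ≤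
      (x1 * x1 + x2 * x2 + x3 * x3) * (y1 * y1 + y2 * y2 + y3 * y3) := by
    nlinarith [sq_nonneg (x1 * y2 - x2 * y1), sq_nonneg (x1 * y3 - x3 * y1),
      sq_nonneg (x2 * y3 - x3 * y2)]
  have l1 : (x1 * x1 + x2 * x2 + x3 * x3) * (y1 * y1 + y2 * y2 + y3 * y3) < x0 * x0 * (y0 * y0) :=
    mul_lt_mul'' (by linarith) (by linarith)
      (by linarith [mul_self_nonneg x1, mul_self_nonneg x2, mul_self_nonneg x3])
      (by linarith [mul_self_nonneg y1, mul_self_nonneg y2, mul_self_nonneg y3])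
  rw [← e1] at cs
  nlinarith

/-- If `L` maps the timelike vectors `(T, κ e)`, `|κ| < T`, to timelike vectors and `(1, 0)` to a
future directed one, then it maps all of them to future directed ones. -/
theorem futureCausal_of_timelike_cone (g : LorentzMetric M) (O : TimeOrientation g) {x : M}
    (L : ℝ × E3 →L[ℝ] TangentSpace 𝓘(ℝ, E4) x) {e : E3}
    (h : ∀ T κ : ℝ, |κ| < T → g.val x (L (T, κ • e)) (L (T, κ • e)) < 0)
    (h0 : g.val x (L (1, 0)) (O.field x) < 0) {T κ : ℝ} (hκ : |κ| < T) :
    FutureCausal g O x (L (T, κ • e)) := by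
  have hq := h T κ hκ
  refine ⟨fun hz => ?_, hq.le, ?_⟩
  · rw [hz] at hq
    simp at hq
  by_contra! h1
  set f0 := g.val x (L (1, 0)) (O.field x) with hf0
  set f1 := g.val x (L (T, κ • e)) (O.field x) with hf1
  -- some vector on the segment from `(1, 0)` to `(T, κ e)` would be orthogonal to the time
  -- orientation
  set s := -f0 / (f1 - f0) with hs
  have hd : 0 < f1 - f0 := by linarith
  have hs0 : 0 < s := div_pos (by linarith) hd
  have hs1 : s ≤ 1 := by
    rw [hs, div_le_one hd]
    linarith
  have hvec : ((1 - s) + s * T, (s * κ) • e) = (1 - s) • ((1, 0) : ℝ × E3) + s • (T, κ • e) := by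
    ext1 <;> simp [mul_smul]
  have hz : g.val x (L ((1 - s) + s * T, (s * κ) • e)) (O.field x) = 0 := by
    rw [hvec]
    simp only [map_add, map_smul, add_apply, smul_apply,
      smul_eq_mul]
    rw [← hf0, ← hf1, hs]
    field_simp
    ring
  refine g.ne_zero_of_timelike (h _ _ ?_) (O.timelike x) hz
  rw [abs_mul, abs_of_pos hs0]
  nlinarith

/-- A `C¹` map from `ℝ × ℝ³` with injective derivative is open. -/
theorem map_nhds_eq_of_mfderiv_injective {i : ℝ × E3 → M} {p : ℝ × E3}
    (hi : ContMDiffAt 𝓘(ℝ, ℝ × E3) 𝓘(ℝ, E4) 1 i p)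
    (hinj : ∀ X : ℝ × E3, mfderiv 𝓘(ℝ, ℝ × E3) 𝓘(ℝ, E4) i p X = 0 → X = 0) :
    map i (𝓝 p) = 𝓝 (i p) := by
  set φ := extChartAt 𝓘(ℝ, E4) (i p) with hφ
  have h1 : ContMDiffAt 𝓘(ℝ, ℝ × E3) 𝓘(ℝ, E4) 1 (φ ∘ i) p :=
    (contMDiffAt_extChartAt (n := 1)).comp p hi
  have h2 : ContDiffAt ℝ 1 (φ ∘ i) p := contMDiffAt_iff_contDiffAt.1 h1
  have h3 : fderiv ℝ (φ ∘ i) p =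
      (mfderiv 𝓘(ℝ, E4) 𝓘(ℝ, E4) φ (i p)).comp (mfderiv 𝓘(ℝ, ℝ × E3) 𝓘(ℝ, E4) i p) := by
    rw [← mfderiv_eq_fderiv]
    exact mfderiv_comp p ((contMDiffAt_extChartAt (n := 1)).mdifferentiableAt (by simp))
      (hi.mdifferentiableAt (by simp))
  have h4 : Function.Injective (mfderiv 𝓘(ℝ, E4) 𝓘(ℝ, E4) φ (i p)) :=
    (isInvertible_mfderiv_extChartAt (mem_extChartAt_source (I := 𝓘(ℝ, E4)) (i p))).injective
  have h5 : Function.Injective (fderiv ℝ (φ ∘ i) p) := by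
    rw [injective_iff_map_eq_zero]
    intro X hX
    rw [h3] at hX
    exact hinj X (h4 (hX.trans (map_zero _).symm))
  have h6 : Function.Surjective (fderiv ℝ (φ ∘ i) p) := by
    have hdim : Module.finrank ℝ (ℝ × E3) = Module.finrank ℝ E4 := by simp
    exact (LinearMap.injective_iff_surjective_of_finrank_eq_finrank hdim
      (f := (fderiv ℝ (φ ∘ i) p).toLinearMap)).1 h5
  have h7 : map (φ ∘ i) (𝓝 p) = 𝓝 ((φ ∘ i) p) :=
    (h2.hasStrictFDerivAt (by simp)).map_nhds_eq_of_surj (LinearMap.range_eq_top.2 h6)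
  have h8 : map φ.symm (𝓝 (φ (i p))) = 𝓝 (i p) := by
    have := map_extChartAt_symm_nhdsWithin_range (I := 𝓘(ℝ, E4)) (i p)
    rwa [ModelWithCorners.range_eq_univ, nhdsWithin_univ] at this
  rw [← h8]
  change map i (𝓝 p) = map φ.symm (𝓝 ((φ ∘ i) p))
  rw [← h7, Filter.map_map]
  refine Filter.map_congr ?_
  filter_upwards [hi.continuousAt.preimage_mem_nhds
    (extChartAt_source_mem_nhds (I := 𝓘(ℝ, E4)) (i p))] with q hq
  exact (φ.left_inv hq).symm

theorem continuousOn_pullback_metric (g : LorentzMetric M) {i : ℝ × E3 → M} {O : Set (ℝ × E3)}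
    (hO : IsOpen O) (hi : ContMDiffOn 𝓘(ℝ, ℝ × E3) 𝓘(ℝ, E4) 1 i O) (X : ℝ × E3) :
    ContinuousOn (fun p => g.val (i p) (mfderivWithin 𝓘(ℝ, ℝ × E3) 𝓘(ℝ, E4) i O p X)
      (mfderivWithin 𝓘(ℝ, ℝ × E3) 𝓘(ℝ, E4) i O p X)) O := by
  have h1 := hi.continuousOn_tangentMapWithin le_rfl hO.uniqueMDiffOn
  have h2 : Continuous fun p : ℝ × E3 => (⟨p, X⟩ : TangentBundle 𝓘(ℝ, ℝ × E3) (ℝ × E3)) := by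
    have h3 : Continuous fun p : ℝ × E3 =>
        (tangentBundleModelSpaceHomeomorph 𝓘(ℝ, ℝ × E3)).symm (p, X) :=
      (tangentBundleModelSpaceHomeomorph 𝓘(ℝ, ℝ × E3)).symm.continuous.comp (by fun_prop)
    exact h3
  have h4 : ContinuousOn (fun p => (Bundle.TotalSpace.mk' E4 (i p)
      (mfderivWithin 𝓘(ℝ, ℝ × E3) 𝓘(ℝ, E4) i O p X) : TangentBundle 𝓘(ℝ, E4) M)) O :=
    h1.comp h2.continuousOn fun p hp => hp
  have h5 : ContinuousOn (fun p => Bundle.TotalSpace.mk' ℝ (E := Bundle.Trivial M ℝ) (i p)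
      (g.val (i p) (mfderivWithin 𝓘(ℝ, ℝ × E3) 𝓘(ℝ, E4) i O p X)
      (mfderivWithin 𝓘(ℝ, ℝ × E3) 𝓘(ℝ, E4) i O p X))) O :=
    (g.continuous.comp_continuousOn hi.continuousOn).clm_bundle_apply₂ (F₁ := E4) (F₂ := E4) h4 h4
  intro p hp
  have h6 := h5 p hp
  simp only [FiberBundle.continuousWithinAt_totalSpace] at h6
  exact h6.2

end Geometry

theorem mem_closure_devDomain {vs δ : ℝ} (hvs : 0 < vs) (hδ : 0 < δ) {p : ℝ × ℝ} (h0 : 0 ≤ p.1)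
    (h1 : p.1 ≤ vs) (h2 : p.1 ≤ p.2) (h3 : p.2 ≤ vs + δ) : p ∈ closure (devDomain vs δ) := by
  have hc : Continuous fun t : ℝ => ((1 - t) * p.1 + t * (vs / 2), (1 - t) * p.2 + t * vs) := by
    fun_prop
  have h4 := hc.tendsto 0
  simp only [sub_zero, one_mul, zero_mul, add_zero] at h4
  refine mem_closure_of_tendsto (h4.mono_left (nhdsWithin_le_nhds (s := Ioi 0))) ?_
  filter_upwards [Ioo_mem_nhdsGT one_pos] with t ht
  have ht0 := ht.1
  have ht1 : 0 < 1 - t := by linarith [ht.2]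
  refine ⟨?_, ?_, ?_, ?_⟩ <;> simp only <;> nlinarith [mul_pos ht0 hvs, mul_pos ht0 hδ]

theorem nullCoords_smul {t ρ : ℝ} {e : E3} (hρ : 0 ≤ ρ) (he : ‖e‖ = 1) :
    nullCoords (t, ρ • e) = (t - ρ, t + ρ) := by
  simp [nullCoords, norm_smul, he, abs_of_nonneg hρ]

theorem nullCoords_fst_le_snd (p : ℝ × E3) : (nullCoords p).1 ≤ (nullCoords p).2 := by
  simp only [nullCoords]
  linarith [norm_nonneg p.2]

theorem continuous_nullCoords : Continuous nullCoords := by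
  unfold nullCoords
  fun_prop

/-- A point off the two excluded ends of the axis belongs to the spacetime. -/
theorem mem_devSpacetime {vs δ : ℝ} (hvs : 0 < vs) (hδ : 0 < δ) {p : ℝ × E3}
    (h0 : 0 ≤ (nullCoords p).1) (h1 : (nullCoords p).1 ≤ vs) (h2 : (nullCoords p).2 ≤ vs + δ)
    (h3 : 0 < (nullCoords p).2) (h4 : (nullCoords p).1 < vs ∨ vs < (nullCoords p).2) :
    p ∈ devSpacetime vs δ := by
  refine ⟨mem_closure_devDomain hvs hδ h0 h1 (nullCoords_fst_le_snd p) h2, ?_⟩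
  simp only [mem_insert_iff, mem_singleton_iff, Prod.ext_iff, not_or, not_and_or]
  refine ⟨Or.inr h3.ne', ?_⟩
  rcases h4 with h4 | h4
  · exact Or.inl h4.ne
  · exact Or.inr h4.ne'

/-- An open neighbourhood of the axis in the interior of the spacetime. -/
def axisTube (vs : ℝ) : Set (ℝ × E3) := {p | 0 < (nullCoords p).1 ∧ (nullCoords p).2 < vs}

theorem isOpen_axisTube (vs : ℝ) : IsOpen (axisTube vs) :=
  (isOpen_lt continuous_const (continuous_fst.comp continuous_nullCoords)).inter
    (isOpen_lt (continuous_snd.comp continuous_nullCoords) continuous_const)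

theorem axisTube_subset {vs δ : ℝ} (hvs : 0 < vs) (hδ : 0 < δ) :
    axisTube vs ⊆ devSpacetime vs δ := fun p hp => by
  have h := nullCoords_fst_le_snd p
  exact mem_devSpacetime hvs hδ hp.1.le (h.trans hp.2.le) (hp.2.le.trans (by linarith))
    (hp.1.trans_le h) (Or.inl (h.trans_lt hp.2))

theorem axis_mem_axisTube {vs s : ℝ} (hs : s ∈ Ioo 0 vs) : ((s, 0) : ℝ × E3) ∈ axisTube vs := by
  simpa [axisTube, nullCoords] using hs

theorem devMetric_radial (r W : ℝ × ℝ → ℝ) {t ρ T κ : ℝ} {e : E3} (hρ : 0 < ρ) (he : ‖e‖ = 1) :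
    devMetric r W (t, ρ • e) (T, κ • e) = -(W (t - ρ, t + ρ) * (T - κ) * (T + κ)) := by
  have h1 : inner ℝ (ρ • e) (κ • e) / ‖ρ • e‖ = κ := by
    rw [real_inner_smul_left, real_inner_smul_right, real_inner_self_eq_norm_sq, he, norm_smul, he,
      Real.norm_of_nonneg hρ.le]
    field_simp
  have h2 : ‖κ • e‖ ^ 2 = κ ^ 2 := by
    rw [norm_smul, he, mul_one, Real.norm_eq_abs, sq_abs]
  simp only [devMetric, nullCoords_smul hρ.le he]
  rw [h1, h2]
  ring

theorem exists_unit_smul_eq (ξ : E3) : ∃ e : E3, ‖e‖ = 1 ∧ ‖ξ‖ • e = ξ := by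
  by_cases h : ξ = 0
  · exact ⟨EuclideanSpace.single 0 1, by simp, by simp [h]⟩
  · refine ⟨‖ξ‖⁻¹ • ξ, ?_, ?_⟩
    · rw [norm_smul, norm_inv, norm_norm, inv_mul_cancel₀ (norm_ne_zero_iff.2 h)]
    · rw [smul_smul, mul_inv_cancel₀ (norm_ne_zero_iff.2 h), one_smul]

section Geometry

variable {M : Type*} [TopologicalSpace M] [ChartedSpace E4 M] [IsManifold 𝓘(ℝ, E4) 1 M]

/-- The pulled back metric on the axis is conformal to the Minkowski metric; the value on
`(X⁰, ξ)` is the limit of the values at the points `(s, ρ ξ/‖ξ‖)`, at which the vector is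
radial. -/
theorem pullback_metric_axis {vs δ : ℝ} (hvs : 0 < vs) (hδ : 0 < δ) {r W : ℝ × ℝ → ℝ}
    (hW : ContinuousOn W (closure (devDomain vs δ))) (g : LorentzMetric M) {i : ℝ × E3 → M}
    (hi : ContMDiffOn 𝓘(ℝ, ℝ × E3) 𝓘(ℝ, E4) 1 i (devSpacetime vs δ))
    (hiso : ∀ p ∈ devSpacetime vs δ, p.2 ≠ 0 → ∀ X : ℝ × E3,
      g.val (i p) (mfderivWithin 𝓘(ℝ, ℝ × E3) 𝓘(ℝ, E4) i (devSpacetime vs δ) p X)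
        (mfderivWithin 𝓘(ℝ, ℝ × E3) 𝓘(ℝ, E4) i (devSpacetime vs δ) p X) = devMetric r W p X)
    {s : ℝ} (hs : s ∈ Ioo 0 vs) (X : ℝ × E3) :
    g.val (i (s, 0)) (mfderivWithin 𝓘(ℝ, ℝ × E3) 𝓘(ℝ, E4) i (devSpacetime vs δ) (s, 0) X)
      (mfderivWithin 𝓘(ℝ, ℝ × E3) 𝓘(ℝ, E4) i (devSpacetime vs δ) (s, 0) X) =
      W (s, s) * (‖X.2‖ ^ 2 - X.1 ^ 2) := by
  obtain ⟨e, he, hξ⟩ := exists_unit_smul_eq X.2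
  have hsub := axisTube_subset hvs hδ
  have hO := isOpen_axisTube vs
  have hD : ∀ p ∈ axisTube vs, mfderivWithin 𝓘(ℝ, ℝ × E3) 𝓘(ℝ, E4) i (devSpacetime vs δ) p =
      mfderivWithin 𝓘(ℝ, ℝ × E3) 𝓘(ℝ, E4) i (axisTube vs) p := fun p hp => by
    rw [mfderivWithin_of_mem_nhds (hO.mem_nhds hp), mfderivWithin_of_mem_nhds
      (mem_of_superset (hO.mem_nhds hp) hsub)]
  have hcont := continuousOn_pullback_metric g hO (hi.mono hsub) X
  have h0 := axis_mem_axisTube hs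
  rw [hD _ h0]
  have hpath : Continuous fun ρ : ℝ => (s, ρ • e) := by fun_prop
  have hp0 := hpath.tendsto 0
  simp only [zero_smul] at hp0
  have t1 := ((hcont.continuousAt (hO.mem_nhds h0)).tendsto.comp hp0).mono_left
    (nhdsWithin_le_nhds (s := Ioi 0))
  have hmem : ∀ᶠ ρ in 𝓝[>] (0 : ℝ), (s, ρ • e) ∈ axisTube vs :=
    (hp0.mono_left nhdsWithin_le_nhds).eventually (hO.mem_nhds h0)
  have t2 : Tendsto (fun ρ : ℝ => -(W (s - ρ, s + ρ) * (X.1 - ‖X.2‖) * (X.1 + ‖X.2‖)))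
      (𝓝[>] 0) (𝓝 (-(W (s, s) * (X.1 - ‖X.2‖) * (X.1 + ‖X.2‖)))) := by
    have hw : Tendsto (fun ρ : ℝ => W (s - ρ, s + ρ)) (𝓝[>] 0) (𝓝 (W (s, s))) := by
      have hs' : (s, s) ∈ closure (devDomain vs δ) := by
        have := (hsub h0).1
        simpa [nullCoords] using this
      refine (hW _ hs').tendsto.comp (tendsto_nhdsWithin_iff.2 ⟨?_, ?_⟩)
      · have hc : Continuous fun ρ : ℝ => (s - ρ, s + ρ) := by fun_prop
        have := hc.tendsto 0
        simp only [sub_zero, add_zero] at this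
        exact this.mono_left nhdsWithin_le_nhds
      · filter_upwards [hmem, self_mem_nhdsWithin] with ρ hρ hρ0
        have := (hsub hρ).1
        rwa [nullCoords_smul (le_of_lt hρ0) he] at this
    exact ((hw.mul_const _).mul_const _).neg
  have heq := tendsto_nhds_unique t1 (t2.congr' (by
    filter_upwards [hmem, self_mem_nhdsWithin] with ρ hρ hρ0
    have hρ0' : (0 : ℝ) < ρ := hρ0
    have hne : ρ • e ≠ 0 := smul_ne_zero hρ0'.ne' fun h => by simp [h] at he
    have h1 := hiso _ (hsub hρ) hne X
    rw [hD _ hρ] at h1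
    simp only [Function.comp_apply]
    rw [h1, ← devMetric_radial r W hρ0' he, hξ]))
  rw [heq]
  ring

/-- The `C¹` map `i` of the development into `(M, g)` is isometric (off the axis, where the metric
of the development is given by `devMetric`) and preserves the time orientation. -/
structure IsIsometricEmbedding (vs δ : ℝ) (r W : ℝ × ℝ → ℝ) (g : LorentzMetric M)
    (O : TimeOrientation g) (i : ℝ × E3 → M) : Prop where
  contMDiffOn : ContMDiffOn 𝓘(ℝ, ℝ × E3) 𝓘(ℝ, E4) 1 i (devSpacetime vs δ)
  isometry : ∀ p ∈ devSpacetime vs δ, p.2 ≠ 0 → ∀ X : ℝ × E3,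
    g.val (i p) (mfderivWithin 𝓘(ℝ, ℝ × E3) 𝓘(ℝ, E4) i (devSpacetime vs δ) p X)
      (mfderivWithin 𝓘(ℝ, ℝ × E3) 𝓘(ℝ, E4) i (devSpacetime vs δ) p X) = devMetric r W p X
  future : ∀ p ∈ devSpacetime vs δ,
    g.val (i p) (mfderivWithin 𝓘(ℝ, ℝ × E3) 𝓘(ℝ, E4) i (devSpacetime vs δ) p ((1, 0) : ℝ × E3))
      (O.field (i p)) < 0

variable {vs δ : ℝ} {r W : ℝ × ℝ → ℝ} {g : LorentzMetric M} {O : TimeOrientation g}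
  {i : ℝ × E3 → M}

theorem IsIsometricEmbedding.map_nhds_axis (h : IsIsometricEmbedding vs δ r W g O i) (hvs : 0 < vs)
    (hδ : 0 < δ) (hW : ContinuousOn W (closure (devDomain vs δ)))
    (hWpos : ∀ p ∈ closure (devDomain vs δ), 0 < W p) {s : ℝ} (hs : s ∈ Ioo 0 vs) :
    map i (𝓝 (s, 0)) = 𝓝 (i (s, 0)) := by
  have hn : devSpacetime vs δ ∈ 𝓝 ((s, 0) : ℝ × E3) :=
    mem_of_superset ((isOpen_axisTube vs).mem_nhds (axis_mem_axisTube hs)) (axisTube_subset hvs hδ)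
  refine map_nhds_eq_of_mfderiv_injective (h.contMDiffOn.contMDiffAt hn) fun X hX => ?_
  have hq := pullback_metric_axis hvs hδ hW g h.contMDiffOn h.isometry hs
  rw [mfderivWithin_of_mem_nhds hn] at hq
  have hw : 0 < W (s, s) := hWpos _ (mem_closure_devDomain hvs hδ hs.1.le hs.2.le le_rfl
    (by simp only; linarith [hs.2]))
  set L : ℝ × E3 →L[ℝ] TangentSpace 𝓘(ℝ, E4) (i (s, 0)) :=
    mfderiv 𝓘(ℝ, ℝ × E3) 𝓘(ℝ, E4) i (s, 0) with hL
  have hX' : L X = 0 := hX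
  -- a vector in the kernel is null, and orthogonal to `(1, 0)`
  have e1 := hq X
  have e2 := hq (X + (1, 0))
  have e3 := hq (1, 0)
  change g.val (i (s, 0)) (L X) (L X) = _ at e1
  change g.val (i (s, 0)) (L (X + (1, 0))) (L (X + (1, 0))) = _ at e2
  change g.val (i (s, 0)) (L (1, 0)) (L (1, 0)) = _ at e3
  rw [map_add, hX', zero_add, e3] at e2
  rw [hX', map_zero] at e1
  simp only [Prod.fst_add, Prod.snd_add, add_zero, norm_zero] at e1 e2
  have e4 : ‖X.2‖ ^ 2 - X.1 ^ 2 = 0 := by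
    rcases mul_eq_zero.1 e1.symm with h' | h'
    · exact absurd h' hw.ne'
    · exact h'
  have e5 := mul_left_cancel₀ hw.ne' e2
  have e6 : X.1 = 0 := by nlinarith
  have e7 : X.2 = 0 := by
    rw [e6] at e4
    have : ‖X.2‖ ^ 2 = 0 := by linarith
    exact norm_eq_zero.1 (pow_eq_zero_iff (by norm_num) |>.1 this)
  exact Prod.ext e6 e7

/-- Timelike radial vectors are mapped to future directed causal vectors. -/
theorem IsIsometricEmbedding.futureCausal_radial (h : IsIsometricEmbedding vs δ r W g O i)
    (hvs : 0 < vs) (hδ : 0 < δ) (hW : ContinuousOn W (closure (devDomain vs δ)))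
    (hWpos : ∀ p ∈ closure (devDomain vs δ), 0 < W p) {t ρ T κ : ℝ} {e : E3} (he : ‖e‖ = 1)
    (hρ : 0 ≤ ρ) (hp : (t, ρ • e) ∈ devSpacetime vs δ) (hor : 0 < ρ ∨ t ∈ Ioo 0 vs)
    (hκ : |κ| < T) :
    FutureCausal g O (i (t, ρ • e))
      (mfderivWithin 𝓘(ℝ, ℝ × E3) 𝓘(ℝ, E4) i (devSpacetime vs δ) (t, ρ • e)
        ((T, κ • e) : ℝ × E3)) := by
  refine futureCausal_of_timelike_cone g O
    (mfderivWithin 𝓘(ℝ, ℝ × E3) 𝓘(ℝ, E4) i (devSpacetime vs δ) (t, ρ • e)) ?_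
    (h.future _ hp) hκ
  intro T' κ' hκ'
  have hw := hWpos _ hp.1
  rw [nullCoords_smul hρ he] at hw
  obtain ⟨k1, k2⟩ := abs_lt.1 hκ'
  rcases hρ.eq_or_lt with hρ0 | hρ'
  · have ht : t ∈ Ioo 0 vs := hor.resolve_left (by rw [← hρ0]; exact lt_irrefl _)
    have hz : ρ • e = 0 := by rw [← hρ0, zero_smul]
    have h1 := pullback_metric_axis hvs hδ hW g h.contMDiffOn h.isometry ht (T', κ' • e)
    rw [← hρ0, sub_zero, add_zero] at hw
    rw [hz]
    refine h1.trans_lt ?_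
    rw [norm_smul, he, mul_one, Real.norm_eq_abs, sq_abs]
    exact mul_neg_of_pos_of_neg hw (by nlinarith)
  · have hne : ρ • e ≠ 0 := smul_ne_zero hρ'.ne' fun h' => by simp [h'] at he
    refine (h.isometry _ hp hne (T', κ' • e)).trans_lt ?_
    rw [devMetric_radial r W hρ' he, neg_lt_zero]
    exact mul_pos (mul_pos hw (by linarith)) (by linarith)

/-- Straight timelike radial segments from the axis are causal curves. -/
theorem IsIsometricEmbedding.causalStep (h : IsIsometricEmbedding vs δ r W g O i)
    (hvs : 0 < vs) (hδ : 0 < δ) (hW : ContinuousOn W (closure (devDomain vs δ)))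
    (hWpos : ∀ p ∈ closure (devDomain vs δ), 0 < W p) {t T κ : ℝ} {e : E3} (he : ‖e‖ = 1)
    (ht : 0 < t) (hκ : 0 ≤ κ) (hκT : κ < T) (h1 : t + T - κ ≤ vs) (h2 : t + T + κ ≤ vs + δ)
    (h3 : t + T - κ < vs ∨ 0 < κ) :
    CausalStep g O (i (t, 0)) (i (t + T, κ • e)) := by
  let l : ℝ → ℝ × E3 := fun s => (t + s * T, (s * κ) • e)
  have hl : ∀ s, HasDerivAt l (T, κ • e) s := fun s => by
    have d1 : HasDerivAt (fun s : ℝ => t + s * T) T s := by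
      simpa using ((hasDerivAt_id s).mul_const T).const_add t
    have d2 : HasDerivAt (fun s : ℝ => (s * κ) • e) (κ • e) s := by
      have := ((hasDerivAt_id s).mul_const κ).smul_const e
      simpa using this
    exact d1.prodMk d2
  have hlc : ContDiff ℝ 1 l := by fun_prop
  have hmem : ∀ s ∈ Icc (0 : ℝ) 1, l s ∈ devSpacetime vs δ := by
    intro s hs
    have hsk : 0 ≤ s * κ := mul_nonneg hs.1 hκ
    have hc : nullCoords (l s) = (t + s * T - s * κ, t + s * T + s * κ) :=
      nullCoords_smul hsk he
    have m1 : 0 ≤ s * (T - κ) := mul_nonneg hs.1 (by linarith)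
    have m2 : s * (T - κ) ≤ T - κ := mul_le_of_le_one_left (by linarith) hs.2
    have m3 : s * (T + κ) ≤ T + κ := mul_le_of_le_one_left (by linarith) hs.2
    refine mem_devSpacetime hvs hδ ?_ ?_ ?_ ?_ ?_ <;> rw [hc] <;> simp only
    · linarith
    · linarith
    · linarith
    · nlinarith
    · rcases hs.2.eq_or_lt with rfl | hs1
      · rcases h3 with h3 | h3
        · left; linarith
        · by_cases h4 : t + T - κ < vs
          · left; linarith
          · right; linarith
      · left
        have : s * (T - κ) < T - κ := mul_lt_of_lt_one_left (by linarith) hs1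
        linarith
  refine ⟨i ∘ l, ?_, by simp [l], by simp [l], fun s hs => ?_⟩
  · exact h.contMDiffOn.comp (contMDiff_iff_contDiff.2 hlc).contMDiffOn hmem
  · have d1 : HasMFDerivWithinAt 𝓘(ℝ, ℝ × E3) 𝓘(ℝ, E4) i (devSpacetime vs δ) (l s)
        (mfderivWithin 𝓘(ℝ, ℝ × E3) 𝓘(ℝ, E4) i (devSpacetime vs δ) (l s)) :=
      (h.contMDiffOn.mdifferentiableOn (by simp) _ (hmem s hs)).hasMFDerivWithinAt
    have d2 : HasMFDerivWithinAt 𝓘(ℝ, ℝ) 𝓘(ℝ, ℝ × E3) l (Icc 0 1) s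
        (ContinuousLinearMap.toSpanSingleton ℝ ((T, κ • e) : ℝ × E3)) :=
      (hl s).hasFDerivAt.hasFDerivWithinAt.hasMFDerivWithinAt
    have d3 := (d1.comp s d2 hmem).mfderivWithin
      ((uniqueDiffOn_Icc zero_lt_one s hs).uniqueMDiffWithinAt)
    rw [d3]
    have key := h.futureCausal_radial hvs hδ hW hWpos (t := t + s * T) (ρ := s * κ) (T := T)
      (κ := κ) he (mul_nonneg hs.1 hκ) (hmem s hs) (by
        rcases hs.1.eq_or_lt with rfl | hs0
        · right
          constructor <;> linarith
        rcases hκ.eq_or_lt with rfl | hκ0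
        · right
          have : s * T ≤ T := mul_le_of_le_one_left (by linarith) hs.2
          have : 0 ≤ s * T := mul_nonneg hs.1 (by linarith)
          have : t + T < vs := by
            rcases h3 with h3 | h3
            · linarith
            · exact absurd h3 (lt_irrefl _)
          constructor <;> linarith
        · exact Or.inl (mul_pos hs0 hκ0)) (by rwa [abs_of_nonneg hκ])
    have e1 : (ContinuousLinearMap.toSpanSingleton ℝ ((T, κ • e) : ℝ × E3)) (1 : ℝ) =
        (T, κ • e) := by
      simp
    have e2 : ((mfderivWithin 𝓘(ℝ, ℝ × E3) 𝓘(ℝ, E4) i (devSpacetime vs δ) (l s)).comp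
        (ContinuousLinearMap.toSpanSingleton ℝ ((T, κ • e) : ℝ × E3))) (1 : ℝ) =
        mfderivWithin 𝓘(ℝ, ℝ × E3) 𝓘(ℝ, E4) i (devSpacetime vs δ) (l s)
          ((T, κ • e) : ℝ × E3) := congrArg _ e1
    exact e2 ▸ key

end Geometry

/-! ### The double null foliation near the axis -/

theorem LocallyBiLipschitzOn.continuousOn {f : ℝ → ℝ} {s : Set ℝ} (h : LocallyBiLipschitzOn f s) :
    ContinuousOn f s := by
  intro x hx
  obtain ⟨t, ht, K, hK, H⟩ := h x hx
  have hxt : x ∈ t := mem_of_mem_nhdsWithin hx ht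
  rw [ContinuousWithinAt, tendsto_iff_dist_tendsto_zero]
  have h1 : Tendsto (fun y => K * |y - x|) (𝓝[s] x) (𝓝 0) := by
    have : Continuous fun y => K * |y - x| := by fun_prop
    have h2 := this.tendsto x
    simp only [sub_self, abs_zero, mul_zero] at h2
    exact h2.mono_left nhdsWithin_le_nhds
  refine tendsto_of_tendsto_of_tendsto_of_le_of_le' tendsto_const_nhds h1
    (Eventually.of_forall fun _ => dist_nonneg) ?_
  filter_upwards [ht] with y hy
  exact (H y hy x hxt).2

theorem convex_triangle (A B : ℝ) : Convex ℝ (triangle A B) := by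
  have h1 : Convex ℝ {p : ℝ × ℝ | A < p.1} :=
    (convex_Ioi A).linear_preimage (LinearMap.fst ℝ ℝ ℝ)
  have h2 : Convex ℝ {p : ℝ × ℝ | p.2 < B} :=
    (convex_Iio B).linear_preimage (LinearMap.snd ℝ ℝ ℝ)
  have h3 : Convex ℝ {p : ℝ × ℝ | p.1 < p.2} := by
    have := (convex_Ioi (0 : ℝ)).linear_preimage (LinearMap.snd ℝ ℝ ℝ - LinearMap.fst ℝ ℝ ℝ)
    have e : {p : ℝ × ℝ | p.1 < p.2} =
        ⇑(LinearMap.snd ℝ ℝ ℝ - LinearMap.fst ℝ ℝ ℝ) ⁻¹' Ioi 0 := by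
      ext p
      simp
    rw [e]
    exact this
  exact h1.inter (h3.inter h2)

/-- A diagonal matrix with two entries `-1` is a rotation. -/
noncomputable def halfTurn (d : Fin 3 → ℝ) (hd : d 0 * d 1 * d 2 = 1) (h : ∀ j, d j * d j = 1) :
    SO3 :=
  ⟨Matrix.diagonal d, by
    rw [Matrix.mem_specialOrthogonalGroup_iff, Matrix.mem_orthogonalGroup_iff,
      Matrix.diagonal_transpose, Matrix.diagonal_mul_diagonal, Matrix.det_diagonal,
      Fin.prod_univ_three]
    refine ⟨?_, hd⟩
    rw [← Matrix.diagonal_one]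
    congr 1
    funext j
    simpa using h j⟩

theorem rotate_zero (a : SO3) : rotate a 0 = 0 := by
  simp [rotate]

/-- Only the origin is fixed by all rotations. -/
theorem eq_zero_of_forall_rotate_eq {x : E3} (h : ∀ a : SO3, rotate a x = x) : x = 0 := by
  have key : ∀ (d : Fin 3 → ℝ), d 0 * d 1 * d 2 = 1 → (∀ j, d j * d j = 1) → ∀ j : Fin 3,
      d j * x j = x j := by
    intro d hd h' j
    have h1 := h (halfTurn d hd h')
    have h2 := congrArg (fun y : E3 => y j) h1
    simpa [rotate, halfTurn, Matrix.mulVec_diagonal] using h2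
  have k1 := key ![-1, -1, 1] (by simp) (by intro j; fin_cases j <;> simp)
  have k2 := key ![1, -1, -1] (by simp) (by intro j; fin_cases j <;> simp)
  have e0 := k1 0
  have e1 := k1 1
  have e2 := k2 2
  simp at e0 e1 e2
  ext j
  fin_cases j
  · show x 0 = 0
    linarith
  · show x 1 = 0
    linarith
  · show x 2 = 0
    linarith

section Geometry

variable {M : Type*} [TopologicalSpace M] [ChartedSpace E4 M] [IsManifold 𝓘(ℝ, E4) 1 M]
  [MulAction SO3 M] {g : LorentzMetric M} {u v : M → ℝ} {θ : M → S2} {r W : ℝ × ℝ → ℝ}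

theorem IsDoubleNullFoliation.isOpen_image (h : IsDoubleNullFoliation g u v θ r W) {N : Set M}
    (hN : IsOpen N) (hNa : N ⊆ (axis M)ᶜ) : IsOpen ((fun x => (u x, v x)) '' N) := by
  obtain ⟨-, ht, -, hmaps, k, hk, hkm, hl, hr⟩ := h.diffeo
  have h1 : IsOpen (offAxisImage u v ×ˢ univ ∩ k ⁻¹' N) :=
    hk.continuousOn.isOpen_inter_preimage ht hN
  have h2 : (fun x => (u x, v x)) '' N = Prod.fst '' (offAxisImage u v ×ˢ univ ∩ k ⁻¹' N) := by
    ext q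
    constructor
    · rintro ⟨x, hx, rfl⟩
      refine ⟨((u x, v x), θ x), ⟨hmaps (hNa hx), ?_⟩, rfl⟩
      rw [mem_preimage, hl (hNa hx)]
      exact hx
    · rintro ⟨y, ⟨hy1, hy2⟩, rfl⟩
      refine ⟨k y, hy2, ?_⟩
      have := hr hy1
      exact congrArg Prod.fst this
  rw [h2]
  exact isOpenMap_fst _ h1

theorem IsDoubleNullFoliation.isClosed_axis (h : IsDoubleNullFoliation g u v θ r W) :
    IsClosed (axis M) := ⟨h.diffeo.1⟩

theorem IsDoubleNullFoliation.eq_of_mem_axis (h : IsDoubleNullFoliation g u v θ r W) {x y : M}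
    (hx : x ∈ axis M) (hu : u x = u y) (hv : v x = v y) : y = x := by
  have h1 := (h.fibers x y).1 ⟨hu, hv⟩
  rw [show MulAction.orbit SO3 x = {x} from hx] at h1
  exact h1

/-- Near a point of the axis that is a limit of points with `u < v`, the image of the foliation
contains a full one-sided neighbourhood, in `{u < v}`, of a segment of the diagonal, and the axis
covers that segment. -/
theorem IsDoubleNullFoliation.exists_triangle_subset (h : IsDoubleNullFoliation g u v θ r W)
    (hsym : IsSphericallySymmetric g) (hdiag : ∀ x ∈ axis M, u x = v x) {x₀ : M}
    (hx₀ : x₀ ∈ axis M) (hne : ∀ N ∈ 𝓝 x₀, ∃ y ∈ N, u y < v y) :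
    ∃ d > 0, triangle (u x₀ - d) (u x₀ + d) ⊆ offAxisImage u v ∧
      ∀ w ∈ Ioo (u x₀ - d) (u x₀ + d), (w, w) ∈ axisImage u v := by
  obtain ⟨V, F, hxV, hVinv, ⟨hVo, -, hF, hFm, k, hk, hkm, hl, hr⟩, heq⟩ :=
    hsym.model_on_axis x₀ hx₀
  have haxis : ∀ p ∈ V, (F p).1 = 0 → p ∈ axis M := by
    intro p hp h0
    have hfix : ∀ a : SO3, a • p = p := fun a => by
      refine hl.injOn (hVinv a p hp) hp (Prod.ext ?_ (heq a p hp).2)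
      rw [(heq a p hp).1, h0, rotate_zero]
    refine Set.Subset.antisymm ?_ (singleton_subset_iff.2 (MulAction.mem_orbit_self p))
    rintro _ ⟨a, rfl⟩
    exact hfix a
  set a := u x₀ with ha
  have hva : v x₀ = a := (hdiag x₀ hx₀).symm
  set z₀ := (F x₀).2 with hz₀
  have hF₀ : F x₀ = (0, z₀) := by
    refine Prod.ext (eq_zero_of_forall_rotate_eq fun b => ?_) rfl
    rw [← (heq b x₀ hxV).1]
    have : b • x₀ ∈ MulAction.orbit SO3 x₀ := MulAction.mem_orbit _ _
    rw [show MulAction.orbit SO3 x₀ = {x₀} from hx₀] at this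
    rw [this]
  have hz₀m : z₀ ∈ Ioo (-1 : ℝ) 1 := (hFm hxV).2
  obtain ⟨η, hη, hη1, hη2⟩ : ∃ η > 0, -1 < z₀ - η ∧ z₀ + η < 1 := by
    refine ⟨min (z₀ + 1) (1 - z₀) / 2, ?_, ?_, ?_⟩
    · have := lt_min (show 0 < z₀ + 1 by linarith [hz₀m.1]) (show 0 < 1 - z₀ by linarith [hz₀m.2])
      positivity
    · linarith [min_le_left (z₀ + 1) (1 - z₀), hz₀m.1]
    · linarith [min_le_right (z₀ + 1) (1 - z₀), hz₀m.2]
  have hzB : ∀ z ∈ Icc (z₀ - η) (z₀ + η), ((0, z) : E3 × ℝ) ∈ Metric.ball 0 1 ×ˢ Ioo (-1) 1 :=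
    fun z hz => ⟨Metric.mem_ball_self one_pos, by linarith [hz.1], by linarith [hz.2]⟩
  have hkax : ∀ z ∈ Icc (z₀ - η) (z₀ + η), k (0, z) ∈ axis M := fun z hz =>
    haxis _ (hkm (hzB z hz)) (by rw [hr (hzB z hz)])
  have hk0 : k (0, z₀) = x₀ := by rw [← hF₀, hl hxV]
  -- the axis covers an interval of the diagonal
  obtain ⟨d₁, hd₁, hax⟩ : ∃ d > 0, ∀ w ∈ Ioo (a - d) (a + d), (w, w) ∈ axisImage u v := by
    let f : ℝ → ℝ := fun z => u (k (0, z))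
    have hfc : ContinuousOn f (Icc (z₀ - η) (z₀ + η)) :=
      h.continuous_u.comp_continuousOn (hk.continuousOn.comp (by fun_prop) hzB)
    have hfi : InjOn f (Icc (z₀ - η) (z₀ + η)) := by
      intro z hz z' hz' hzz
      have h1 : v (k (0, z)) = v (k (0, z')) := by
        rw [← hdiag _ (hkax z hz), ← hdiag _ (hkax z' hz')]
        exact hzz
      have h2 := h.eq_of_mem_axis (hkax z hz) hzz h1
      have h3 := hr.injOn (hzB z' hz') (hzB z hz) h2
      exact (congrArg Prod.snd h3).symm
    have hfz : f z₀ = a := by simp only [f, hk0, ha]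
    have cover : ∀ w ∈ f '' Icc (z₀ - η) (z₀ + η), (w, w) ∈ axisImage u v := by
      rintro _ ⟨z, hz, rfl⟩
      refine ⟨k (0, z), hkax z hz, ?_⟩
      simp only [← hdiag _ (hkax z hz), f]
    have m0 : z₀ ∈ Icc (z₀ - η) (z₀ + η) := ⟨by linarith, by linarith⟩
    have m1 : z₀ - η ∈ Icc (z₀ - η) (z₀ + η) := ⟨le_rfl, by linarith⟩
    have m2 : z₀ + η ∈ Icc (z₀ - η) (z₀ + η) := ⟨by linarith, le_rfl⟩
    rcases hfc.strictMonoOn_of_injOn_Icc' (by linarith) hfi with hm | hm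
    · have l1 := hm m1 m0 (by linarith)
      have l2 := hm m0 m2 (by linarith)
      rw [hfz] at l1 l2
      refine ⟨min (a - f (z₀ - η)) (f (z₀ + η) - a), lt_min (by linarith) (by linarith),
        fun w hw => cover w (intermediate_value_Icc (by linarith) hfc ⟨?_, ?_⟩)⟩
      · linarith [hw.1, min_le_left (a - f (z₀ - η)) (f (z₀ + η) - a)]
      · linarith [hw.2, min_le_right (a - f (z₀ - η)) (f (z₀ + η) - a)]
    · have l1 := hm m1 m0 (by linarith)
      have l2 := hm m0 m2 (by linarith)
      rw [hfz] at l1 l2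
      refine ⟨min (f (z₀ - η) - a) (a - f (z₀ + η)), lt_min (by linarith) (by linarith),
        fun w hw => cover w (intermediate_value_Icc' (by linarith) hfc ⟨?_, ?_⟩)⟩
      · linarith [hw.1, min_le_right (f (z₀ - η) - a) (a - f (z₀ + η))]
      · linarith [hw.2, min_le_left (f (z₀ - η) - a) (a - f (z₀ + η))]
  -- a compact cylinder `K` around the axis and its interior `K'`
  let K : Set (E3 × ℝ) := Metric.closedBall 0 (1 / 2) ×ˢ Icc (z₀ - η) (z₀ + η)
  let K' : Set (E3 × ℝ) := Metric.ball 0 (1 / 2) ×ˢ Ioo (z₀ - η) (z₀ + η)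
  have hKc : IsCompact K := (isCompact_closedBall _ _).prod isCompact_Icc
  have hK'o : IsOpen K' := Metric.isOpen_ball.prod isOpen_Ioo
  have hK'K : K' ⊆ K := prod_mono Metric.ball_subset_closedBall Ioo_subset_Icc_self
  have hKB : K ⊆ Metric.ball 0 1 ×ˢ Ioo (-1) 1 :=
    prod_mono (Metric.closedBall_subset_ball (by norm_num))
      fun z hz => ⟨by linarith [hz.1], by linarith [hz.2]⟩
  have hG : Continuous fun x : M => (u x, v x) := h.continuous_u.prodMk h.continuous_v
  have hGk : ContinuousOn (fun p => (u (k p), v (k p))) (Metric.ball 0 1 ×ˢ Ioo (-1) 1) :=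
    hG.comp_continuousOn hk.continuousOn
  have hC : IsClosed ((fun p => (u (k p), v (k p))) '' K) :=
    (hKc.image_of_continuousOn (hGk.mono hKB)).isClosed
  have hbd : IsClosed ((fun p => (u (k p), v (k p))) '' (K \ K')) :=
    ((hKc.diff hK'o).image_of_continuousOn (hGk.mono (sdiff_subset.trans hKB))).isClosed
  have hnot : (a, a) ∉ (fun p => (u (k p), v (k p))) '' (K \ K') := by
    rintro ⟨p, ⟨hp, hp'⟩, hpa⟩
    obtain ⟨e1, e2⟩ := Prod.ext_iff.1 hpa
    simp only at e1 e2
    have h1 := h.eq_of_mem_axis hx₀ (y := k p) (by rw [e1]) (by rw [e2, hva])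
    have h2 : p = (0, z₀) := by rw [← hr (hKB hp), h1, hF₀]
    refine hp' ?_
    rw [h2]
    exact ⟨Metric.mem_ball_self (by norm_num), by linarith, by linarith⟩
  obtain ⟨d₂, hd₂, hball⟩ := Metric.isOpen_iff.1 hbd.isOpen_compl _ hnot
  refine ⟨min d₁ d₂, lt_min hd₁ hd₂, ?_, fun w hw => hax w
    ⟨by linarith [hw.1, min_le_left d₁ d₂], by linarith [hw.2, min_le_left d₁ d₂]⟩⟩
  set d := min d₁ d₂ with hd
  have hdpos : 0 < d := lt_min hd₁ hd₂
  let N : Set M := (V ∩ F ⁻¹' K') ∩ (axis M)ᶜ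
  have hVK : IsOpen (V ∩ F ⁻¹' K') := hF.continuousOn.isOpen_inter_preimage hVo hK'o
  have hNo : IsOpen N := hVK.inter h.isClosed_axis.isOpen_compl
  have hA := h.isOpen_image hNo inter_subset_right
  -- the triangle is connected and misses the image of the boundary of `K`, and the image of the
  -- interior, off the axis, is open, nonempty in the triangle, and contained in the closed image of
  -- `K`
  have hsub : triangle (a - d) (a + d) ⊆ (fun x => (u x, v x)) '' N := by
    refine (convex_triangle _ _).isPreconnected.subset_left_of_subset_union hA hC.isOpen_compl ?_
      ?_ ?_
    · rw [Set.disjoint_compl_right_iff_subset]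
      rintro _ ⟨x, ⟨⟨hx1, hx2⟩, -⟩, rfl⟩
      exact ⟨F x, hK'K hx2, by simp only [hl hx1]⟩
    · intro q hq
      by_cases hqC : q ∈ (fun p => (u (k p), v (k p))) '' K
      · left
        obtain ⟨p, hp, rfl⟩ := hqC
        have hpK' : p ∈ K' := by
          by_contra hp'
          refine hball ?_ ⟨p, ⟨hp, hp'⟩, rfl⟩
          exact Metric.ball_subset_ball (min_le_right _ _) (triangle_subset_ball a d hq)
        refine ⟨k p, ⟨⟨hkm (hKB hp), ?_⟩, fun hax' => ?_⟩, rfl⟩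
        · rw [mem_preimage, hr (hKB hp)]
          exact hpK'
        · exact hq.2.1.ne (hdiag _ hax')
      · exact Or.inr hqC
    · have hN₀ : (V ∩ F ⁻¹' K') ∩ (fun x => (u x, v x)) ⁻¹' Metric.ball (a, a) d ∈ 𝓝 x₀ := by
        refine (hVK.inter (Metric.isOpen_ball.preimage hG)).mem_nhds ⟨⟨hxV, ?_⟩, ?_⟩
        · rw [mem_preimage, hF₀]
          exact ⟨Metric.mem_ball_self (by norm_num), by linarith, by linarith⟩
        · rw [mem_preimage, hva]
          exact Metric.mem_ball_self hdpos
      obtain ⟨y, ⟨hy1, hy2⟩, hy3⟩ := hne _ hN₀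
      rw [mem_preimage, ← ball_prod_same, Real.ball_eq_Ioo] at hy2
      exact ⟨(u y, v y), ⟨hy2.1.1, hy3, hy2.2.2⟩, y, ⟨hy1, fun hax' => hy3.ne (hdiag _ hax')⟩, rfl⟩
  exact hsub.trans (image_mono inter_subset_right)

variable {O : TimeOrientation g} {vs δ : ℝ} {r₀ W₀ : ℝ × ℝ → ℝ} {i : ℝ × E3 → M} {U V : ℝ → ℝ}

/-- The axis of the development is mapped to the axis: elsewhere `(u, v)` would be an open map, and
the embedding is open at the axis, but the values of `(U(u), V(v))` on the development are those
with `u ≤ v` only. -/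
theorem IsIsometricEmbedding.mem_axis (h : IsIsometricEmbedding vs δ r₀ W₀ g O i) (hvs : 0 < vs)
    (hδ : 0 < δ) (hW : ContinuousOn W₀ (closure (devDomain vs δ)))
    (hWpos : ∀ p ∈ closure (devDomain vs δ), 0 < W₀ p) (hfol : IsDoubleNullFoliation g u v θ r W)
    (hU : StrictMonoOn U (Icc 0 vs)) (hUc : ContinuousOn U (Icc 0 vs))
    (hV : StrictMonoOn V (Ioc 0 (vs + δ))) (hVc : ContinuousOn V (Ioc 0 (vs + δ)))
    (huv : ∀ p ∈ devSpacetime vs δ,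
      u (i p) = U (nullCoords p).1 ∧ v (i p) = V (nullCoords p).2)
    {s : ℝ} (hs : s ∈ Ioo 0 vs) : i (s, 0) ∈ axis M := by
  by_contra hax
  have htube := (isOpen_axisTube vs).mem_nhds (axis_mem_axisTube hs)
  have h1 : i '' axisTube vs ∈ 𝓝 (i (s, 0)) := by
    rw [← h.map_nhds_axis hvs hδ hW hWpos hs]
    exact image_mem_map htube
  have h2 := hfol.isOpen_image (N := interior (i '' axisTube vs) ∩ (axis M)ᶜ)
    (isOpen_interior.inter hfol.isClosed_axis.isOpen_compl) inter_subset_right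
  have h3 : (u (i (s, 0)), v (i (s, 0))) ∈
      (fun x => (u x, v x)) '' (interior (i '' axisTube vs) ∩ (axis M)ᶜ) :=
    ⟨_, ⟨mem_interior_iff_mem_nhds.2 h1, hax⟩, rfl⟩
  have h4 := huv _ (axisTube_subset hvs hδ (axis_mem_axisTube hs))
  simp only [nullCoords, norm_zero, sub_zero, add_zero] at h4
  rw [h4.1, h4.2] at h3
  have hUs : ContinuousAt U s := hUc.continuousAt (Icc_mem_nhds hs.1 hs.2)
  have hVs : ContinuousAt V s :=
    hVc.continuousAt (Ioc_mem_nhds hs.1 (by linarith [hs.2]))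
  have hpath : Tendsto (fun ε : ℝ => (U (s + ε), V (s - ε))) (𝓝[>] 0) (𝓝 (U s, V s)) := by
    have t1 : Tendsto (fun ε : ℝ => s + ε) (𝓝[>] 0) (𝓝 s) := by
      have : Continuous fun ε : ℝ => s + ε := by fun_prop
      simpa using (this.tendsto 0).mono_left (nhdsWithin_le_nhds (s := Ioi 0))
    have t2 : Tendsto (fun ε : ℝ => s - ε) (𝓝[>] 0) (𝓝 s) := by
      have : Continuous fun ε : ℝ => s - ε := by fun_prop
      simpa using (this.tendsto 0).mono_left (nhdsWithin_le_nhds (s := Ioi 0))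
    exact (hUs.tendsto.comp t1).prodMk_nhds (hVs.tendsto.comp t2)
  have hε : 0 < min s (vs - s) := lt_min hs.1 (by linarith [hs.2])
  obtain ⟨ε, ⟨x, ⟨hx, -⟩, hxe⟩, hε1, hε2⟩ :=
    ((hpath.eventually (h2.mem_nhds h3)).and (Ioo_mem_nhdsGT hε)).exists
  obtain ⟨p, hp, rfl⟩ := interior_subset hx
  have h5 := huv p (axisTube_subset hvs hδ hp)
  obtain ⟨e1, e2⟩ := Prod.ext_iff.1 hxe
  simp only at e1 e2
  have hle := nullCoords_fst_le_snd p
  have m1 := min_le_left s (vs - s)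
  have m2 := min_le_right s (vs - s)
  have f1 := hU.injOn ⟨hp.1.le, by linarith [hp.2]⟩ ⟨by linarith, by linarith⟩ (h5.1.symm.trans e1)
  have f2 := hV.injOn ⟨by linarith [hp.1], by linarith [hp.2]⟩ ⟨by linarith, by linarith⟩
    (h5.2.symm.trans e2)
  linarith

/-- Global hyperbolicity attaches the missing end point of the axis of the development: the points
`(s, 0)`, `s → v_*`, stay in a causal diamond. -/
theorem IsIsometricEmbedding.exists_axis_limit (h : IsIsometricEmbedding vs δ r₀ W₀ g O i)
    (hgh : GloballyHyperbolic g O) (hvs : 0 < vs)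
    (hδ : 0 < δ) (hW : ContinuousOn W₀ (closure (devDomain vs δ)))
    (hWpos : ∀ p ∈ closure (devDomain vs δ), 0 < W₀ p) (hfol : IsDoubleNullFoliation g u v θ r W)
    (hdiag : ∀ x ∈ axis M, u x = v x)
    (hU : StrictMonoOn U (Icc 0 vs)) (hUc : ContinuousOn U (Icc 0 vs))
    (hV : StrictMonoOn V (Ioc 0 (vs + δ))) (hVc : ContinuousOn V (Ioc 0 (vs + δ)))
    (huv : ∀ p ∈ devSpacetime vs δ,
      u (i p) = U (nullCoords p).1 ∧ v (i p) = V (nullCoords p).2) :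
    ∃ x₀ ∈ axis M, u x₀ = U vs ∧ v x₀ = V vs ∧ ∀ N ∈ 𝓝 x₀, ∃ y ∈ N, u y < v y := by
  obtain ⟨e, he, -⟩ := exists_unit_smul_eq 0
  have hax := fun s (hs : s ∈ Ioo 0 vs) => h.mem_axis hvs hδ hW hWpos hfol hU hUc hV hVc huv hs
  have huvs : ∀ s ∈ Ioo 0 vs, u (i (s, 0)) = U s ∧ v (i (s, 0)) = V s := fun s hs => by
    have h4 := huv _ (axisTube_subset hvs hδ (axis_mem_axisTube hs))
    simpa only [nullCoords, norm_zero, sub_zero, add_zero] using h4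
  let l : Filter M := map (fun s : ℝ => i (s, 0)) (𝓝[<] vs)
  have hev : ∀ᶠ s in 𝓝[<] vs, s ∈ Ioo (vs / 2) vs := Ioo_mem_nhdsLT (by linarith)
  have hl : l ≤ 𝓟 {x | CausalLE g O (i (vs / 2, 0)) x ∧
      CausalLE g O x (i (vs + δ / 4, (δ / 4) • e))} := by
    rw [le_principal_iff]
    change ∀ᶠ s in 𝓝[<] vs, _
    filter_upwards [hev] with s hs
    constructor
    · refine Relation.ReflTransGen.single ?_
      have := h.causalStep hvs hδ hW hWpos (t := vs / 2) (T := s - vs / 2) (κ := 0) he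
        (by linarith) le_rfl (by linarith [hs.1]) (by linarith [hs.2]) (by linarith [hs.2])
        (Or.inl (by linarith [hs.2]))
      simpa using this
    · refine Relation.ReflTransGen.single ?_
      have := h.causalStep hvs hδ hW hWpos (t := s) (T := vs + δ / 4 - s) (κ := δ / 4) he
        (by linarith [hs.1]) (by linarith) (by linarith [hs.2]) (by linarith) (by linarith)
        (Or.inr (by linarith))
      simpa using this
  obtain ⟨x₀, -, hcl⟩ := (hgh.2 _ _) hl
  refine ⟨x₀, ?_, ?_, ?_, fun N hN => ?_⟩
  · rw [← hfol.isClosed_axis.closure_eq, mem_closure_iff_clusterPt]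
    refine hcl.mono ?_
    rw [le_principal_iff]
    change ∀ᶠ s in 𝓝[<] vs, _
    filter_upwards [hev] with s hs
    exact hax s ⟨by linarith [hs.1], hs.2⟩
  · have t : Tendsto u l (𝓝 (U vs)) := by
      rw [tendsto_map'_iff]
      refine Tendsto.congr' ?_ ((hUc vs ⟨hvs.le, le_rfl⟩).tendsto.mono_left
        (nhdsWithin_le_of_mem
        (mem_of_superset (Ioo_mem_nhdsLT hvs) Ioo_subset_Icc_self)))
      filter_upwards [hev] with s hs
      exact (huvs s ⟨by linarith [hs.1], hs.2⟩).1.symm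
    have := hcl.map hfol.continuous_u.continuousAt t
    exact eq_of_nhds_neBot this
  · have t : Tendsto v l (𝓝 (V vs)) := by
      rw [tendsto_map'_iff]
      refine Tendsto.congr' ?_ ((hVc.continuousAt
        (Ioc_mem_nhds hvs (by linarith))).tendsto.mono_left nhdsWithin_le_nhds)
      filter_upwards [hev] with s hs
      exact (huvs s ⟨by linarith [hs.1], hs.2⟩).2.symm
    have := hcl.map hfol.continuous_v.continuousAt t
    exact eq_of_nhds_neBot this
  · obtain ⟨N', hN'N, hN'o, hxN'⟩ := mem_nhds_iff.1 hN
    have hfr := clusterPt_iff_frequently.1 hcl N' (hN'o.mem_nhds hxN')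
    obtain ⟨s, hsN, hs⟩ := ((frequently_map.1 hfr).and_eventually hev).exists
    have hs' : s ∈ Ioo 0 vs := ⟨by linarith [hs.1], hs.2⟩
    have hic : ContinuousAt i (s, 0) := h.contMDiffOn.continuousOn.continuousAt
      (mem_of_superset ((isOpen_axisTube vs).mem_nhds (axis_mem_axisTube hs'))
        (axisTube_subset hvs hδ))
    have hpath : Tendsto (fun ρ : ℝ => ((s, ρ • e) : ℝ × E3)) (𝓝[>] 0) (𝓝 (s, 0)) := by
      have hc : Continuous fun ρ : ℝ => ((s, ρ • e) : ℝ × E3) := by fun_prop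
      have := hc.tendsto 0
      simp only [zero_smul] at this
      exact this.mono_left nhdsWithin_le_nhds
    obtain ⟨ρ, ⟨hρ1, hρ2⟩, hρ0⟩ := (((hpath.eventually ((isOpen_axisTube vs).mem_nhds
      (axis_mem_axisTube hs'))).and ((hic.tendsto.comp hpath).eventually (hN'o.mem_nhds hsN))).and
      self_mem_nhdsWithin).exists
    have hρ0' : (0 : ℝ) < ρ := hρ0
    refine ⟨_, hN'N hρ2, ?_⟩
    have h5 := huv _ (axisTube_subset hvs hδ hρ1)
    obtain ⟨g1, g2⟩ := hρ1
    rw [nullCoords_smul hρ0'.le he] at h5 g1 g2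
    simp only at h5 g1 g2
    have h6 := huvs s hs'
    have h7 := hdiag _ (hax s hs')
    rw [h6.1, h6.2] at h7
    simp only [Function.comp_apply]
    rw [h5.1, h5.2]
    calc U (s - ρ) < U s := hU ⟨g1.le, by linarith⟩ ⟨hs'.1.le, hs'.2.le⟩ (by linarith)
      _ = V s := h7
      _ < V (s + ρ) := hV ⟨hs'.1, by linarith⟩ ⟨by linarith, by linarith⟩ (by linarith)

end Geometry

/-! ### The dust that reaches the end point of the axis -/

theorem isOpen_devDomain (vs δ : ℝ) : IsOpen (devDomain vs δ) :=
  (isOpen_lt continuous_const continuous_fst).inter <|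
    (isOpen_lt continuous_fst continuous_const).inter <|
      (isOpen_lt continuous_fst continuous_snd).inter (isOpen_lt continuous_snd continuous_const)

/-- The incoming dust is transported from the initial hypersurface along the lines `v = const`. -/
theorem IsSmoothDevelopment.dust_eq_initial {Λ vs δ : ℝ} {r₀ W₀ τ₀ τb₀ : ℝ → ℝ}
    {r W τ τb : ℝ × ℝ → ℝ} (h : IsSmoothDevelopment Λ vs δ r₀ W₀ τ₀ τb₀ r W τ τb) (hvs : 0 < vs)
    (hδ : 0 < δ) {p : ℝ × ℝ} (hp : p ∈ devDomain vs δ) : τb p = τb₀ p.2 := by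
  obtain ⟨u, v⟩ := p
  obtain ⟨h1, h2, h3, h4⟩ := hp
  simp only at h1 h2 h3 h4
  have hmem : ∀ s ∈ Icc 0 u, (s, v) ∈ closure (devDomain vs δ) := fun s hs =>
    mem_closure_devDomain hvs hδ hs.1 (by simp only; linarith [hs.2])
      (by simp only; linarith [hs.2]) h4.le
  have hc : ContinuousOn (fun s => τb (s, v)) (Icc 0 u) :=
    h.smooth_τb.continuousOn.comp (by fun_prop) hmem
  have hd : ∀ s ∈ Ioo 0 u, HasDerivAt (fun s => τb (s, v)) 0 s := by
    intro s hs
    have hs' : (s, v) ∈ devDomain vs δ := ⟨hs.1, by simp only; linarith [hs.2],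
      by simp only; linarith [hs.2], h4⟩
    have hdiff : DifferentiableAt ℝ τb (s, v) :=
      (h.smooth_τb.contDiffAt (mem_of_superset ((isOpen_devDomain vs δ).mem_nhds hs')
        subset_closure)).differentiableAt (by simp)
    have := hdiff.hasFDerivAt.comp_hasDerivAt s ((hasDerivAt_id s).prodMk (hasDerivAt_const s v))
    rwa [show fderiv ℝ τb (s, v) (1, 0) = 0 from h.solution.eq_in _ hs'] at this
  obtain ⟨s, -, hs⟩ := exists_hasDerivAt_eq_slope _ _ h1 hc hd
  have hu : u - 0 ≠ 0 := by simpa using h1.ne'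
  rw [eq_comm, div_eq_zero_iff, or_iff_left hu] at hs
  linarith [(h.initial v ⟨by linarith, h4⟩).2.2.2]

/-- Where a bi-Lipschitz function is differentiable, its derivative is bounded from both sides. -/
theorem deriv_sq_bounds_of_biLipschitz {f : ℝ → ℝ} {s : Set ℝ} {K : ℝ} (hK : 0 < K)
    (h : ∀ y ∈ s, ∀ z ∈ s, K⁻¹ * |y - z| ≤ |f y - f z| ∧ |f y - f z| ≤ K * |y - z|) {x : ℝ}
    (hs : s ∈ 𝓝 x) (hf : DifferentiableAt ℝ f x) : 0 < deriv f x ^ 2 ∧ deriv f x ^ 2 ≤ K ^ 2 := by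
  have hx := mem_of_mem_nhds hs
  have ht := (hasDerivAt_iff_tendsto_slope.1 hf.hasDerivAt).abs
  have hev : ∀ᶠ y in 𝓝[≠] x, K⁻¹ ≤ |slope f x y| ∧ |slope f x y| ≤ K := by
    filter_upwards [mem_nhdsWithin_of_mem_nhds hs, self_mem_nhdsWithin] with y hy hne
    have hpos : 0 < |y - x| := abs_pos.2 (sub_ne_zero.2 hne)
    rw [slope_def_field, abs_div, le_div_iff₀ hpos, div_le_iff₀ hpos]
    exact h y hy x hx
  have l1 := ge_of_tendsto ht (hev.mono fun _ h => h.1)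
  have l2 := le_of_tendsto ht (hev.mono fun _ h => h.2)
  have := inv_pos.2 hK
  refine ⟨by rw [← sq_abs]; nlinarith, ?_⟩
  rw [← sq_abs]
  exact pow_le_pow_left₀ (abs_nonneg _) l2 2

/-- A Lipschitz function is differentiable off a set whose image is null. -/
theorem volume_image_not_differentiableAt {f : ℝ → ℝ} {s : Set ℝ} {K : NNReal} (hs : IsOpen s)
    (h : LipschitzOnWith K f s) : volume (f '' {x ∈ s | ¬ DifferentiableAt ℝ f x}) = 0 := by
  have h0 : volume {x ∈ s | ¬ DifferentiableAt ℝ f x} = 0 := by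
    have := h.ae_differentiableWithinAt_of_mem (μ := volume)
    rw [ae_iff] at this
    refine measure_mono_null ?_ this
    rintro x ⟨hx, hd⟩ H
    exact hd ((H hx).differentiableAt (hs.mem_nhds hx))
  have h1 := (h.mono (sep_subset s fun x => ¬ DifferentiableAt ℝ f x)).hausdorffMeasure_image_le
    zero_le_one
  rw [hausdorffMeasure_real, h0, mul_zero] at h1
  exact le_antisymm h1 zero_le

/-- The transformed incoming dust charges every box with vertex at the end point of the axis, once
the dust is positive immediately after `v = v_*`. The density need not be measurable, so that its
integral is bounded from below by that of a constant, which holds off a null set: there `V'` exists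
and lies between positive bounds. -/
theorem IsTransformedDust.measure_ne_zero {vs δ δ₁ : ℝ} {U V τb₀ : ℝ → ℝ} {τb : ℝ × ℝ → ℝ}
    {τb' : Measure (ℝ × ℝ)}
    (h : IsTransformedDust (devDomain vs δ) U V τb (fun p => deriv V p.2) τb') (hvs : 0 < vs)
    (hδ₁ : 0 < δ₁) (hδ₁δ : δ₁ ≤ δ) (hτb : ∀ p ∈ devDomain vs δ, τb p = τb₀ p.2)
    (hc : ContinuousOn τb₀ (Ioo vs (vs + δ₁))) (hpos : ∀ v ∈ Ioo vs (vs + δ₁), 0 < τb₀ v)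
    (hU : StrictMonoOn U (Icc 0 vs)) (hUc : ContinuousOn U (Icc 0 vs))
    (hV : StrictMonoOn V (Ioc 0 (vs + δ))) (hVL : LocallyBiLipschitzOn V (Ioc 0 (vs + δ)))
    {d : ℝ} (hd : 0 < d) :
    τb' (Ioo (U vs - d) (U vs) ×ˢ Ioo (V vs) (V vs + d)) ≠ 0 := by
  obtain ⟨k, hk, hres⟩ := h
  have hVc := hVL.continuousOn
  have hn : Ioc 0 (vs + δ) ∈ 𝓝 vs := Ioc_mem_nhds hvs (by linarith)
  obtain ⟨t, ht, K, hK, hbi⟩ := hVL vs ⟨hvs, by linarith⟩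
  rw [nhdsWithin_eq_nhds.2 hn] at ht
  have hVev : ∀ᶠ v in 𝓝 vs, V v < V vs + d :=
    (hVc.continuousAt hn).eventually (gt_mem_nhds (by linarith))
  obtain ⟨η, hη, hball⟩ := Metric.mem_nhds_iff.1 (inter_mem ht hVev)
  rw [Real.ball_eq_Ioo] at hball
  -- `Ioo p q` is a range of `v` to the right of `v_*`, in which `V` is bi-Lipschitz
  set m := min η δ₁ with hm
  have hmpos : 0 < m := lt_min hη hδ₁
  have hmη : m ≤ η := min_le_left _ _
  have hmδ : m ≤ δ₁ := min_le_right _ _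
  set p := vs + m / 4 with hp
  set q := vs + m / 2 with hq
  have hpq : p < q := by linarith
  have hJ : ∀ v ∈ Icc p q, v ∈ Ioo vs (vs + δ₁) ∧ v ∈ t ∧ v ∈ Ioc 0 (vs + δ) ∧ V v < V vs + d :=
    fun v hv => ⟨⟨by linarith [hv.1], by linarith [hv.2]⟩,
      (hball ⟨by linarith [hv.1], by linarith [hv.2]⟩).1,
      ⟨by linarith [hv.1], by linarith [hv.2]⟩,
      (hball ⟨by linarith [hv.1], by linarith [hv.2]⟩).2⟩
  obtain ⟨v₁, hv₁, hmin⟩ := isCompact_Icc.exists_isMinOn (nonempty_Icc.2 hpq.le)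
    (hc.mono fun v hv => (hJ v hv).1)
  have hcpos := hpos v₁ (hJ v₁ hv₁).1
  obtain ⟨u₁, hu₁, hu₁d⟩ : ∃ u₁ ∈ Ioo 0 vs, U vs - d < U u₁ := by
    have h1 : ∀ᶠ u in 𝓝[<] vs, U vs - d < U u :=
      ((hUc vs ⟨hvs.le, le_rfl⟩).tendsto.mono_left (nhdsWithin_le_of_mem
        (mem_of_superset (Ioo_mem_nhdsLT hvs) Ioo_subset_Icc_self))).eventually
        (lt_mem_nhds (by linarith))
    obtain ⟨u₁, h2, h3⟩ := (h1.and (Ioo_mem_nhdsLT hvs)).exists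
    exact ⟨u₁, h3, h2⟩
  set P := Ioo (U u₁) (U vs) ×ˢ Ioo (V p) (V q) with hP
  have hPm : MeasurableSet P := measurableSet_Ioo.prod measurableSet_Ioo
  have hUlt : U u₁ < U vs := hU ⟨hu₁.1.le, hu₁.2.le⟩ ⟨hvs.le, le_rfl⟩ hu₁.2
  have hVlt : V p < V q := hV (hJ p ⟨le_rfl, hpq.le⟩).2.2.1 (hJ q ⟨hpq.le, le_rfl⟩).2.2.1 hpq
  have hsub : ∀ z ∈ P, ∃ u ∈ Ioo u₁ vs, ∃ v ∈ Ioo p q, (u, v) ∈ devDomain vs δ ∧ U u = z.1 ∧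
      V v = z.2 := by
    rintro ⟨x, y⟩ ⟨hx, hy⟩
    obtain ⟨u, hu, rfl⟩ := intermediate_value_Ioo hu₁.2.le
      (hUc.mono (Icc_subset_Icc_left hu₁.1.le)) hx
    obtain ⟨v, hv, rfl⟩ := intermediate_value_Ioo hpq.le (hVc.mono fun v hv => (hJ v hv).2.2.1) hy
    exact ⟨u, hu, v, hv, ⟨by simp only; linarith [hu.1, hu₁.1], hu.2,
      by simp only; linarith [hu.2, hv.1], by simp only; linarith [hv.2]⟩, rfl, rfl⟩
  set R := (fun p : ℝ × ℝ => (U p.1, V p.2)) '' devDomain vs δ with hR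
  have hPR : P ⊆ R := fun z hz => by
    obtain ⟨u, -, v, -, hD, h1, h2⟩ := hsub z hz
    exact ⟨(u, v), hD, Prod.ext h1 h2⟩
  have hmass : τb' P = ∫⁻ z in P, ENNReal.ofReal (k z) := by
    have h1 := congrArg (fun ν : Measure (ℝ × ℝ) => ν P) hres
    simp only [Measure.restrict_apply hPm, withDensity_apply _ hPm,
      Measure.restrict_restrict hPm] at h1
    rwa [inter_eq_self_of_subset_left hPR] at h1
  -- the null set of the values `V v` at points `v` at which `V` is not differentiable
  have hLip : LipschitzOnWith ⟨K, hK.le⟩ V (Ioo p q) := LipschitzOnWith.of_dist_le_mul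
    fun y hy z hz => (hbi y (hJ y (Ioo_subset_Icc_self hy)).2.1 z
      (hJ z (Ioo_subset_Icc_self hz)).2.1).2
  set N := V '' {x ∈ Ioo p q | ¬ DifferentiableAt ℝ V x} with hN
  have hN0 : volume N = 0 := volume_image_not_differentiableAt isOpen_Ioo hLip
  have hae : ∀ᵐ z ∂(volume : Measure (ℝ × ℝ)), z.2 ∉ N := by
    rw [ae_iff]
    have : {z : ℝ × ℝ | ¬ z.2 ∉ N} = univ ×ˢ N := by
      ext z
      simp
    rw [this, Measure.volume_eq_prod, Measure.prod_prod, hN0, mul_zero]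
  have hlow : ∫⁻ _ in P, ENNReal.ofReal (τb₀ v₁ / K ^ 2) ≤ ∫⁻ z in P, ENNReal.ofReal (k z) := by
    refine lintegral_mono_ae ?_
    filter_upwards [ae_restrict_of_ae hae, ae_restrict_mem hPm] with z hzN hzP
    obtain ⟨u, -, v, hv, hD, h1, h2⟩ := hsub z hzP
    have hdv : DifferentiableAt ℝ V v := by
      by_contra hcon
      exact hzN ⟨v, ⟨hv, hcon⟩, h2⟩
    obtain ⟨b1, b2⟩ := deriv_sq_bounds_of_biLipschitz hK
      (fun y hy z hz => hbi y (hJ y (Ioo_subset_Icc_self hy)).2.1 z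
        (hJ z (Ioo_subset_Icc_self hz)).2.1) (Ioo_mem_nhds hv.1 hv.2) hdv
    refine ENNReal.ofReal_le_ofReal ?_
    have h3 := hk _ hD
    simp only [h1, h2, hτb _ hD, Prod.mk.eta] at h3
    rw [h3]
    exact div_le_div₀ (hpos v (hJ v (Ioo_subset_Icc_self hv)).1).le
      (hmin (Ioo_subset_Icc_self hv)) b1 b2
  have hPbox : P ⊆ Ioo (U vs - d) (U vs) ×ˢ Ioo (V vs) (V vs + d) := by
    refine prod_mono (Ioo_subset_Ioo_left hu₁d.le) (Ioo_subset_Ioo ?_ ?_)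
    · exact (hV ⟨hvs, by linarith⟩ (hJ p ⟨le_rfl, hpq.le⟩).2.2.1 (by linarith)).le
    · exact (hJ q ⟨hpq.le, le_rfl⟩).2.2.2.le
  refine fun h0 => ne_of_gt ?_ (measure_mono_null hPbox h0)
  rw [hmass]
  refine lt_of_lt_of_le ?_ hlow
  rw [setLIntegral_const, hP, Measure.volume_eq_prod, Measure.prod_prod, Real.volume_Ioo,
    Real.volume_Ioo]
  have e1 : 0 < ENNReal.ofReal (τb₀ v₁ / K ^ 2) := ENNReal.ofReal_pos.2 (by positivity)
  have e2 : 0 < ENNReal.ofReal (U vs - U u₁) := ENNReal.ofReal_pos.2 (by linarith)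
  have e3 : 0 < ENNReal.ofReal (V q - V p) := ENNReal.ofReal_pos.2 (by linarith)
  exact ENNReal.mul_pos e1.ne' (ENNReal.mul_pos e2.ne' e3.ne').ne'

end NullDust

theorem mainTheorem4 (Λ v₀ vs δ δ₁ : ℝ) (r₀ W₀ τ₀ τb₀ : ℝ → ℝ) (r W τ τb : ℝ × ℝ → ℝ)
    (hvs : 0 < vs) (hv₀ : vs < v₀)
    (hdata : NullDust.IsSmoothData v₀ r₀ W₀ τ₀ τb₀)
    (hingoing : ∀ v ∈ Set.Ico 0 v₀, τ₀ v = 0)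
    (htrivial : ∀ v ∈ Set.Icc 0 vs, τb₀ v = 0)
    (htrapped : 0 < Λ → ∀ v ∈ Set.Icc 0 vs, 0 < 1 - 1 / 3 * Λ * r₀ v ^ 2)
    (hδ : 0 < δ) (hδv : δ < v₀ - vs)
    (hdev : NullDust.IsSmoothDevelopment Λ vs δ r₀ W₀ τ₀ τb₀ r W τ τb)
    (hδ₁ : 0 < δ₁) (hδ₁δ : δ₁ ≤ δ)
    (hdust : ∀ v ∈ Set.Ioo vs (vs + δ₁), 0 < τb₀ v)
    {M : Type*} [TopologicalSpace M] [T2Space M] [SecondCountableTopology M]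
    [ChartedSpace NullDust.E4 M] [IsManifold 𝓘(ℝ, NullDust.E4) 1 M]
    [MulAction NullDust.SO3 M] (g : NullDust.LorentzMetric M) (T : NullDust.TimeOrientation g) :
    ¬ (NullDust.GloballyHyperbolic g T ∧ NullDust.IsAdmissible g ∧
        NullDust.IsFutureExtension Λ vs δ r W τ τb g T) := by
  rintro ⟨hgh, ⟨hsym, -, -⟩, i, hi, -, hiso, hT, -, u', v', θ', r', W', hfol, hdiag, τ', τb', hsol,
    hagree, U, V, hU, hUL, hV, hVL, huv, -, hτb⟩
  have hemb : NullDust.IsIsometricEmbedding vs δ r W g T i := ⟨hi, hiso, hT⟩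
  obtain ⟨x₀, hx₀, hu₀, hv₀', hne⟩ := hemb.exists_axis_limit hgh hvs hδ hdev.smooth_W.continuousOn
    hdev.W_pos hfol hdiag hU hUL.continuousOn hV hVL.continuousOn huv
  have huV : U vs = V vs := by rw [← hu₀, hdiag x₀ hx₀, hv₀']
  obtain ⟨d₁, hd₁, hD₁, hΓ₁⟩ := hfol.exists_triangle_subset hsym hdiag hx₀ hne
  set a := u' x₀ with ha
  obtain ⟨ε, hε, μ, hμ, -, hμb⟩ := hagree (a, a) ⟨x₀, hx₀, Prod.ext rfl (hdiag x₀ hx₀).symm⟩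
  obtain ⟨d, hd, hdd, hdε⟩ : ∃ d > 0, d ≤ d₁ ∧ d ≤ ε :=
    ⟨min d₁ ε, lt_min hd₁ hε, min_le_left _ _, min_le_right _ _⟩
  have hD : NullDust.triangle (a - d) (a + d) ⊆ NullDust.offAxisImage u' v' :=
    (NullDust.triangle_mono (by linarith) (by linarith)).trans hD₁
  have hμb' : τb'.restrict (NullDust.offAxisImage u' v' ∩ Metric.ball (a, a) d) =
      (volume.prod μ).restrict (NullDust.offAxisImage u' v' ∩ Metric.ball (a, a) d) :=
    Measure.restrict_congr_mono
      (inter_subset_inter_right _ (Metric.ball_subset_ball hdε)) hμb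
  obtain ⟨d', hd', hdd', hμ0⟩ := hsol.exists_measure_Ioo_eq_zero hd hD
    (fun w hw => hΓ₁ w ⟨by linarith [hw.1], by linarith [hw.2]⟩) hfol.r_continuous
    hfol.W_continuous hfol.r_axis hfol.W_ne_zero hμb'
  -- the dust charges a box in which `μ` vanishes
  refine hτb.measure_ne_zero hvs hδ₁ hδ₁δ (fun p hp => hdev.dust_eq_initial hvs hδ hp)
    (hdata.smooth_τb.continuousOn.mono fun v hv =>
      ⟨by linarith [hv.1], by linarith [hv.2]⟩) hdust hU hUL.continuousOn hV hVL hd' ?_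
  rw [← huV, ← hu₀]
  have hbox : Ioo (a - d') a ×ˢ Ioo a (a + d') ⊆
      NullDust.offAxisImage u' v' ∩ Metric.ball (a, a) d := by
    have : Ioo (a - d') a ×ˢ Ioo a (a + d') ⊆ NullDust.triangle (a - d) (a + d) := fun z hz =>
      ⟨by linarith [hz.1.1], by linarith [hz.1.2, hz.2.1], by linarith [hz.2.2]⟩
    exact subset_inter (this.trans hD) (this.trans (NullDust.triangle_subset_ball a d))
  rw [← Measure.restrict_eq_self τb' hbox, hμb', Measure.restrict_eq_self _ hbox,
    Measure.prod_prod, measure_mono_null (Ioo_subset_Ioo_left (by linarith)) hμ0, mul_zero]
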